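/- Let $k$ be a finite field with $q$ elements, $q$ odd, and let $E/k$ be the quadratic extension, with $\bar x=x^q$, $\mathrm{Nm}(x)=x\bar x$, $\mathrm{Tr}(x)=x+\bar x$ and $E^1=\{x\in E^\times:\mathrm{Nm}(x)=1\}$. Write $\widehat E^\times$, $\widehat E^1$ for the groups of characters of $E^\times$, $E^1$. Let $\psi$ be a non-trivial additive character of $k$, and let $U_2(k)=\{g\in GL_2(E): gJ\,{}^t\bar g=J\}$, where $J=\begin{pmatrix}0&1\\-1&0\end{pmatrix}$. All representations are over $\mathbb C$. * For $\eta\in\widehat E^1$, write $\eta$ also for the one-dimensional representation $\eta\circ\det$ of $U_2(k)$. * For $\chi\in\widehat E^\times$, let $I(\chi)$ be the representation of $U_2(k)$ induced from the character $\begin{pmatrix}a&*\\&\bar a^{-1}\end{pmatrix}\mapsto\chi(a)$ of the upper triangular Borel subgroup. Let $\bar\chi^{-1}(a)=\chi(\bar a^{-1})$. * $\mathrm{St}$ is the Steinberg representation, $I(1)=1\oplus \mathrm{St}$, and $\mathrm{St}_\eta=\eta\otimes \mathrm{St}$. * $\omega_\psi$ is the Weil representation of $U_2(k)$ on functions $f:E\to\mathbb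 C$, determined by $\omega_\psi\begin{pmatrix}a&\\&\bar a^{-1}\end{pmatrix}f(\xi)=f(a\xi)$ for $a\in E^\times$, $\omega_\psi\begin{pmatrix}1&b\\&1\end{pmatrix}f(\xi)=\psi(b\,\mathrm{Nm}(\xi))f(\xi)$ for $b\in k$, and $\omega_\psi\begin{pmatrix}&1\\-1&\end{pmatrix}f(\xi)=-q^{-1}\sum_{y\in E}\psi(\mathrm{Tr}(\bar y\xi))f(y)$. * For $\mu,\eta\in\widehat E^1$ with $\mu\neq1$, $\omega_{\psi,\mu,\eta}$ is $\eta$ tensored with the restriction of $\omega_\psi$ to the invariant subspace $\{f: f(yx)=\mu^{-1}(y)f(x)\ \text{for all } y\in E^1,\ x\in E\}$. Let $A$ be a set of representatives of the characters $\chi\in\widehat E^\times$ with $\chi|_{k^\times}\neq1$ modulo $\chi\sim\bar\chi^{-1}$, and let $B$ be a set of representatives of the pairs $(\mu,\eta)\in\widehat E^1\times\widehat E^1$ with $\mu\ne1$ modulo $(\mu,\eta)\sim(\mu^{-1},\eta\mu^{-1})$. Let $\chi_1\in\widehat E^\times$ with $\chi_1\neq\bar\chi_1^{-1}$ and let $\eta_1,\mu_1\in\widehat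 E^1$ with $\mu_1\ne1$. Then, as representations of $U_2(k)$, $$\eta_1\otimes\omega_\psi\cong \mathrm{St}_{\eta_1}\oplus\bigoplus_{\mu\in\widehat E^1,\ \mu\neq1}\omega_{\psi,\mu,\eta_1},$$ $$I(\chi_1)\otimes\omega_\psi\cong 2\,I(\chi_1)\oplus\bigoplus_{\chi\in A,\ \chi\neq\chi_1,\bar\chi_1^{-1}}I(\chi)\oplus\bigoplus_{\eta\in\widehat E^1}\mathrm{St}_\eta\oplus\bigoplus_{(\mu,\eta)\in B}\omega_{\psi,\mu,\eta},$$ $$\mathrm{St}\otimes\omega_\psi\cong 1\oplus\bigoplus_{\chi\in A}I(\chi)\oplus\bigoplus_{\eta\in\widehat E^1}\mathrm{St}_\eta\oplus\bigoplus_{(\mu,\eta)\in B,\ \eta\neq1,\ \eta\neq\mu}\omega_{\psi,\mu,\eta},$$ $$\omega_{\psi,\mu_1,1}\otimes\omega_\psi\cong 1\oplus\mu_1^{-1}\oplus\bigoplus_{\chi\in A}I(\chi)\oplus\bigoplus_{\eta\neq1,\ \eta\neq\mu_1^{-1}}\mathrm{St}_\eta\oplus\bigoplus_{\substack{(\mu,\eta)\in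 B,\ \eta\neq1,\ \eta\neq\mu,\\ \eta\neq\mu_1^{-1},\ \eta\neq\mu_1^{-1}\mu}}\omega_{\psi,\mu,\eta}.$$ Here the representations $\eta$, $\mathrm{St}_\eta$, $I(\chi)$ ($\chi\neq\bar\chi^{-1}$) and $\omega_{\psi,\mu,\eta}$ ($\mu\neq1$) are irreducible. Members of two different ones of these four families are never isomorphic; within a family, $\eta\cong\eta'$ or $\mathrm{St}_\eta\cong\mathrm{St}_{\eta'}$ only if $\eta'=\eta$, $I(\chi)\cong I(\chi')$ only if $\chi'\in\{\chi,\bar\chi^{-1}\}$, and $\omega_{\psi,\mu,\eta}\cong\omega_{\psi,\mu',\eta'}$ only if $(\mu',\eta')\in\{(\mu,\eta),(\mu^{-1},\eta\mu^{-1})\}$. In particular $I(\chi_1)$ has multiplicity exactly $2$ in $I(\chi_1)\otimes\omega_\psi$. -/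

import Mathlib

open scoped Matrix

set_option linter.unusedSectionVars false

noncomputable section

namespace FinU2

/-! ## The quadratic extension `E / k` of finite fields -/

section Field

variable (k E : Type*) [Field k] [Fintype k] [Field E] [Fintype E] [Algebra k E]

/-- The non-trivial automorphism `x ↦ x̄ = x ^ q` of `E / k`, where `q = |k|`. -/
abbrev conj : E →ₐ[k] E := FiniteField.frobeniusAlgHom k E

/-- The group `E¹` of elements of norm one. -/
def E1 : Subgroup Eˣ := (Units.map (Algebra.norm k : E →* k)).ker

variable {k E}

theorem mem_E1 (x : Eˣ) : x ∈ E1 k E ↔ Algebra.norm k (x : E) = 1 := by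
  simp [E1, MonoidHom.mem_ker, Units.ext_iff]

theorem conj_mul_self [Algebra.IsQuadraticExtension k E] (x : E) :
    x * conj k E x = algebraMap k E (Algebra.norm k x) := by
  rw [FiniteField.algebraMap_norm_eq_prod_pow]
  simp [Algebra.IsQuadraticExtension.finrank_eq_two, Finset.prod_range_succ]

theorem add_conj [Algebra.IsQuadraticExtension k E] (x : E) :
    x + conj k E x = algebraMap k E (Algebra.trace k E x) := by
  rw [FiniteField.algebraMap_trace_eq_sum_pow]
  simp [Algebra.IsQuadraticExtension.finrank_eq_two, Finset.sum_range_succ]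

theorem card_E [Algebra.IsQuadraticExtension k E] : Fintype.card E = Fintype.card k ^ 2 := by
  rw [Module.card_eq_pow_finrank (K := k) (V := E), Algebra.IsQuadraticExtension.finrank_eq_two]

theorem conj_conj [Algebra.IsQuadraticExtension k E] (x : E) : conj k E (conj k E x) = x := by
  simp only [FiniteField.coe_frobeniusAlgHom, ← pow_mul]
  rw [← sq, ← card_E (k := k) (E := E), FiniteField.pow_card]

theorem norm_conj [Algebra.IsQuadraticExtension k E] (x : E) :
    Algebra.norm k (conj k E x) = Algebra.norm k x := by
  apply (algebraMap k E).injective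
  rw [← conj_mul_self, ← conj_mul_self, conj_conj, mul_comm]

theorem trace_conj [Algebra.IsQuadraticExtension k E] (x : E) :
    Algebra.trace k E (conj k E x) = Algebra.trace k E x := by
  apply (algebraMap k E).injective
  rw [← add_conj, ← add_conj, conj_conj, add_comm]

/-- `Tr(x) / 2`; on the subfield `k` of `E` this is the identity. It is used to regard
elements of `E` that lie in `k` as elements of `k`. -/
def toBase (x : E) : k := Algebra.trace k E x / 2

theorem toBase_algebraMap [Algebra.IsQuadraticExtension k E] [NeZero (2 : k)] (x : k) :
    toBase (algebraMap k E x) = x := by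
  rw [toBase, Algebra.trace_algebraMap, Algebra.IsQuadraticExtension.finrank_eq_two]
  have := NeZero.ne (2 : k)
  simp
  field_simp

theorem toBase_add (x y : E) : toBase (x + y) = (toBase x + toBase y : k) := by
  simp [toBase, add_div]

theorem toBase_mul (c : k) (x : E) : toBase (algebraMap k E c * x) = (c * toBase x : k) := by
  rw [toBase, toBase, ← Algebra.smul_def, map_smul, smul_eq_mul, mul_div_assoc]

theorem algebraMap_toBase [Algebra.IsQuadraticExtension k E] [NeZero (2 : k)] {x : E}
    (hx : conj k E x = x) : algebraMap k E (toBase x) = x := by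
  have h := add_conj (k := k) x
  rw [hx] at h
  have h2 : (algebraMap k E 2) ≠ 0 := by
    rw [Ne, map_eq_zero]; exact NeZero.ne (2 : k)
  rw [toBase, map_div₀, ← h, div_eq_iff h2, map_ofNat]; ring

end Field

/-! ## The unitary group `U₂(k)` -/

section Group

variable (k E : Type*) [Field k] [Fintype k] [Field E] [Fintype E] [Algebra k E]

/-- The group `U₂(k)` of all `g ∈ GL₂(E)` with `g J ᵗḡ = J`, where `J = (0, 1; -1, 0)`. -/
def U2 : Subgroup (GL (Fin 2) E) where
  carrier := {g | g.1 * !![0, 1; -1, 0] * (g.1.map (conj k E))ᵀ = !![0, 1; -1, 0]}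
  one_mem' := by simp [Matrix.map_one]
  mul_mem' := by
    intro g h hg hh
    simp only [Set.mem_ofPred_eq] at hg hh ⊢
    rw [Units.val_mul, Matrix.map_mul, Matrix.transpose_mul]
    calc _ = g.1 * (h.1 * !![0, 1; -1, 0] * (h.1.map (conj k E))ᵀ) * (g.1.map (conj k E))ᵀ := by
          simp only [Matrix.mul_assoc]
      _ = _ := by rw [hh, hg]
  inv_mem' := by
    intro g hg
    simp only [Set.mem_ofPred_eq] at hg ⊢
    have h1 : (g⁻¹).1 * g.1 = 1 := by rw [← Units.val_mul]; simp
    have h2 : (g.1.map (conj k E))ᵀ * ((g⁻¹).1.map (conj k E))ᵀ = 1 := by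
      rw [← Matrix.transpose_mul, ← Matrix.map_mul, h1]; simp [Matrix.map_one]
    calc _ = (g⁻¹).1 * (g.1 * !![0, 1; -1, 0] * (g.1.map (conj k E))ᵀ)
          * ((g⁻¹).1.map (conj k E))ᵀ := by rw [hg]
      _ = ((g⁻¹).1 * g.1) * !![0, 1; -1, 0] * ((g.1.map (conj k E))ᵀ
          * ((g⁻¹).1.map (conj k E))ᵀ) := by simp only [Matrix.mul_assoc]
      _ = _ := by rw [h1, h2]; simp

instance : Fintype (U2 k E) := Fintype.ofFinite _

variable {k E}

/-- The entries of an element of `U₂(k)`. -/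
abbrev entry (g : U2 k E) (i j : Fin 2) : E := g.1.1 i j

theorem entry_mul (g h : U2 k E) (i j : Fin 2) :
    entry (g * h) i j = entry g i 0 * entry h 0 j + entry g i 1 * entry h 1 j := by
  simp [entry, Matrix.mul_apply, Fin.sum_univ_two]

theorem entry_one (i j : Fin 2) : entry (1 : U2 k E) i j = if i = j then 1 else 0 := by
  simp [entry, Matrix.one_apply]

theorem ext_entry {g h : U2 k E} (h00 : entry g 0 0 = entry h 0 0)
    (h01 : entry g 0 1 = entry h 0 1) (h10 : entry g 1 0 = entry h 1 0)
    (h11 : entry g 1 1 = entry h 1 1) : g = h := by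
  apply Subtype.ext; apply Units.ext; ext i j
  fin_cases i <;> fin_cases j <;> assumption

theorem mem_U2_iff (g : GL (Fin 2) E) : g ∈ U2 k E ↔
    g.1 0 0 * conj k E (g.1 0 1) = g.1 0 1 * conj k E (g.1 0 0) ∧
    g.1 0 0 * conj k E (g.1 1 1) - g.1 0 1 * conj k E (g.1 1 0) = 1 ∧
    g.1 1 1 * conj k E (g.1 0 0) - g.1 1 0 * conj k E (g.1 0 1) = 1 ∧
    g.1 1 0 * conj k E (g.1 1 1) = g.1 1 1 * conj k E (g.1 1 0) := by
  change g.1 * !![0, 1; -1, 0] * (g.1.map (conj k E))ᵀ = !![0, 1; -1, 0] ↔ _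
  rw [← Matrix.ext_iff]
  simp only [Fin.forall_fin_two, Matrix.mul_apply, Fin.sum_univ_two, Matrix.transpose_apply,
    Matrix.map_apply, Matrix.of_apply, Matrix.cons_val', Matrix.cons_val_zero,
    Matrix.cons_val_one, Matrix.cons_val_fin_one]
  constructor
  · rintro ⟨⟨h1, h2⟩, h3, h4⟩
    refine ⟨?_, ?_, ?_, ?_⟩
    · linear_combination h1
    · linear_combination h2
    · linear_combination -h3
    · linear_combination h4
  · rintro ⟨h1, h2, h3, h4⟩
    refine ⟨⟨?_, ?_⟩, ?_, ?_⟩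
    · linear_combination h1
    · linear_combination h2
    · linear_combination -h3
    · linear_combination h4

theorem rel1 (g : U2 k E) :
    entry g 0 0 * conj k E (entry g 0 1) = entry g 0 1 * conj k E (entry g 0 0) :=
  ((mem_U2_iff g.1).1 g.2).1

theorem rel2 (g : U2 k E) : entry g 0 0 * conj k E (entry g 1 1)
    - entry g 0 1 * conj k E (entry g 1 0) = 1 :=
  ((mem_U2_iff g.1).1 g.2).2.1

theorem rel3 (g : U2 k E) : entry g 1 1 * conj k E (entry g 0 0)
    - entry g 1 0 * conj k E (entry g 0 1) = 1 :=
  ((mem_U2_iff g.1).1 g.2).2.2.1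

theorem rel4 (g : U2 k E) :
    entry g 1 0 * conj k E (entry g 1 1) = entry g 1 1 * conj k E (entry g 1 0) :=
  ((mem_U2_iff g.1).1 g.2).2.2.2

theorem rel5 (g : U2 k E) :
    conj k E (entry g 0 0) * entry g 1 0 = entry g 0 0 * conj k E (entry g 1 0) := by
  linear_combination (-conj k E (entry g 0 0) * entry g 1 0) * rel2 g
    + (entry g 0 0 * conj k E (entry g 0 0)) * rel4 g
    + (entry g 1 0 * conj k E (entry g 1 0)) * rel1 g
    + (entry g 0 0 * conj k E (entry g 1 0)) * rel3 g

/-- The matrix `(a, b; c, d)` as an element of `U₂(k)`, given the defining relations. -/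
def mkU2 (a b c d : E) (h : a * d - b * c ≠ 0)
    (h1 : a * conj k E b = b * conj k E a) (h2 : a * conj k E d - b * conj k E c = 1)
    (h3 : d * conj k E a - c * conj k E b = 1) (h4 : c * conj k E d = d * conj k E c) :
    U2 k E :=
  ⟨Matrix.GeneralLinearGroup.mkOfDetNeZero !![a, b; c, d] (by simpa [Matrix.det_fin_two] using h),
    (mem_U2_iff _).2 ⟨h1, h2, h3, h4⟩⟩

/-- The element `diag(a, ā⁻¹)`. -/
def diagU [Algebra.IsQuadraticExtension k E] (a : Eˣ) : U2 k E :=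
  mkU2 (a : E) 0 0 (conj k E (a : E))⁻¹ (by simp) (by simp)
    (by rw [map_inv₀, conj_conj]; simp)
    (by
      have : conj k E (a : E) ≠ 0 := by simp
      simp only [zero_mul, sub_zero]; exact inv_mul_cancel₀ this)
    (by simp)

/-- The element `(1, b; 0, 1)` with `b ∈ k`. -/
def unipU (b : k) : U2 k E :=
  mkU2 1 (algebraMap k E b) 0 1 (by simp) (by rw [AlgHom.commutes]; simp) (by simp) (by simp)
    (by simp)

variable (k E) in
/-- The element `w = (0, 1; -1, 0)`. -/
def wU : U2 k E :=
  mkU2 0 1 (-1) 0 (by simp) (by rw [map_zero]; simp) (by rw [map_neg, map_one]; simp)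
    (by rw [map_one]; simp) (by rw [map_zero]; simp)

theorem norm_det [Algebra.IsQuadraticExtension k E] (g : U2 k E) :
    Algebra.norm k (g.1.1.det) = 1 := by
  apply (algebraMap k E).injective
  rw [← conj_mul_self, map_one, Matrix.det_fin_two, map_sub, map_mul, map_mul]
  obtain ⟨h1, h2, h3, h4⟩ := (mem_U2_iff g.1).1 g.2
  linear_combination (g.1.1 0 0 * conj k E (g.1.1 1 1) - g.1.1 0 1 * conj k E (g.1.1 1 0)) * h3
    + h2 + (g.1.1 1 0 * conj k E (g.1.1 1 1) - g.1.1 1 1 * conj k E (g.1.1 1 0)) * h1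

end Group

/-! ## The Weil representation of `U₂(k)` on functions on `E` -/

section Weil

variable {k E : Type*} [Field k] [Fintype k] [Field E] [Fintype E] [Algebra k E]

/-- The operator `f ↦ (ξ ↦ f (a ξ))`. -/
def opM (a : E) : (E → ℂ) →ₗ[ℂ] (E → ℂ) where
  toFun f := fun ξ => f (a * ξ)
  map_add' _ _ := rfl
  map_smul' _ _ := rfl

/-- The operator `f ↦ (ξ ↦ ψ(b Nm(ξ)) f(ξ))`. -/
def opN (ψ : AddChar k ℂ) (b : k) : (E → ℂ) →ₗ[ℂ] (E → ℂ) where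
  toFun f := fun ξ => ψ (b * Algebra.norm k ξ) * f ξ
  map_add' _ _ := by ext; simp [mul_add]
  map_smul' _ _ := by ext; simp [mul_left_comm]

/-- The operator `f ↦ (ξ ↦ - q⁻¹ ∑ y, ψ(Tr(ȳ ξ)) f(y))`. -/
def opW (ψ : AddChar k ℂ) : (E → ℂ) →ₗ[ℂ] (E → ℂ) where
  toFun f := fun ξ => -(Fintype.card k : ℂ)⁻¹ *
    ∑ y : E, ψ (Algebra.trace k E (conj k E y * ξ)) * f y
  map_add' _ _ := by ext; simp [mul_add, Finset.sum_add_distrib]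
  map_smul' c f := by
    ext
    simp only [Pi.smul_apply, smul_eq_mul, RingHom.id_apply, Finset.mul_sum]
    exact Finset.sum_congr rfl fun _ _ => by ring

@[simp] theorem opM_apply (a : E) (f : E → ℂ) (ξ : E) : opM a f ξ = f (a * ξ) := rfl
@[simp] theorem opN_apply (ψ : AddChar k ℂ) (b : k) (f : E → ℂ) (ξ : E) :
    opN ψ b f ξ = ψ (b * Algebra.norm k ξ) * f ξ := rfl
@[simp] theorem opW_apply (ψ : AddChar k ℂ) (f : E → ℂ) (ξ : E) :
    opW ψ f ξ = -(Fintype.card k : ℂ)⁻¹ *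
      ∑ y : E, ψ (Algebra.trace k E (conj k E y * ξ)) * f y := rfl

theorem opM_one : opM (1 : E) = 1 := by ext f ξ; simp
theorem opN_zero (ψ : AddChar k ℂ) : opN (E := E) ψ 0 = 1 := by ext f ξ; simp

theorem opM_opM (a b : E) : opM a * opM b = opM (a * b) := by
  ext f ξ; simp [Module.End.mul_apply, mul_assoc, mul_left_comm]

theorem opN_opN (ψ : AddChar k ℂ) (a b : k) : opN (E := E) ψ a * opN ψ b = opN ψ (a + b) := by
  ext f ξ; simp [Module.End.mul_apply, add_mul, AddChar.map_add_eq_mul, mul_assoc]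

theorem opM_opN (ψ : AddChar k ℂ) (a : E) (b : k) :
    opM a * opN ψ b = opN ψ (b * Algebra.norm k a) * opM a := by
  ext f ξ; simp [Module.End.mul_apply, mul_assoc]

theorem opW_opM [Algebra.IsQuadraticExtension k E] (ψ : AddChar k ℂ) (a : E) (ha : a ≠ 0) :
    opW ψ * opM a = opM (conj k E a)⁻¹ * opW ψ := by
  refine LinearMap.ext fun f => funext fun ξ => ?_
  simp only [Module.End.mul_apply, opM_apply, opW_apply]
  congr 1
  refine Fintype.sum_bijective (a * ·) (mulLeft_bijective₀ a ha) _ _ fun y => ?_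
  have hc : conj k E a ≠ 0 := by simpa using ha
  congr 3
  rw [map_mul]
  generalize conj k E a = z at *
  generalize conj k E y = t at *
  field_simp

open scoped Classical in
/-- Orthogonality of characters of `E`. -/
theorem sum_trace [Algebra.IsQuadraticExtension k E] {ψ : AddChar k ℂ} (hψ : ψ ≠ 1) (v : E) :
    ∑ y : E, ψ (Algebra.trace k E (conj k E y * v)) =
      if v = 0 then (Fintype.card k : ℂ) ^ 2 else 0 := by
  classical
  split_ifs with h
  · simp [h, card_E (k := k) (E := E)]
  · let φ : AddChar E ℂ := ψ.compAddMonoidHom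
      ((Algebra.trace k E).toAddMonoidHom.comp ((AddMonoidHom.mulRight v).comp
        (conj k E : E →+* E).toAddMonoidHom))
    have hφ : φ ≠ 0 := by
      intro h0
      apply hψ
      ext x
      obtain ⟨z, hz⟩ := Algebra.trace_surjective k E x
      have := DFunLike.congr_fun h0 (conj k E (z / v))
      simp only [φ, AddChar.compAddMonoidHom_apply] at this
      change ψ (Algebra.trace k E (conj k E (conj k E (z / v)) * v)) = 1 at this
      rw [conj_conj, div_mul_cancel₀ _ h, hz] at this
      simpa using this
    exact AddChar.sum_eq_zero_of_ne_one hφ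

theorem opW_opW [Algebra.IsQuadraticExtension k E] {ψ : AddChar k ℂ} (hψ : ψ ≠ 1) :
    opW ψ * opW ψ = opM (-1 : E) := by
  classical
  have hq : (Fintype.card k : ℂ) ≠ 0 := by simp
  refine LinearMap.ext fun f => funext fun ξ => ?_
  simp only [Module.End.mul_apply, opM_apply, opW_apply]
  have : ∀ y : E, ψ (Algebra.trace k E (conj k E y * ξ)) * (-(Fintype.card k : ℂ)⁻¹ *
      ∑ z : E, ψ (Algebra.trace k E (conj k E z * y)) * f z) =
      ∑ z : E, -(Fintype.card k : ℂ)⁻¹ * (f z * ψ (Algebra.trace k E (conj k E y * (ξ + z)))) := by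
    intro y
    rw [Finset.mul_sum, Finset.mul_sum]
    refine Finset.sum_congr rfl fun z _ => ?_
    have e : Algebra.trace k E (conj k E z * y) = Algebra.trace k E (conj k E y * z) := by
      rw [← trace_conj, map_mul, conj_conj, mul_comm]
    rw [mul_add, map_add, AddChar.map_add_eq_mul, e]; ring
  simp_rw [this]
  rw [Finset.sum_comm]
  simp_rw [← Finset.mul_sum, sum_trace hψ]
  rw [Finset.sum_eq_single (-ξ)]
  · simp; field_simp
  · intro b _ hb
    rw [if_neg, mul_zero]
    intro h; exact hb (eq_neg_of_add_eq_zero_right h)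
  · simp

open scoped Classical in
theorem sum_norm_fiber [Algebra.IsQuadraticExtension k E] (F : k → ℂ) :
    ∑ y : E, F (Algebra.norm k y) = F 0 + (Fintype.card k + 1) * ∑ a : kˣ, F a := by
  classical
  have h1 : ∀ G : E → ℂ, ∑ y : E, G y = G 0 + ∑ y : Eˣ, G y := by
    intro G
    rw [← Finset.add_sum_erase _ _ (Finset.mem_univ (0 : E))]
    congr 1
    refine Finset.sum_bij' (fun y hy => Units.mk0 y (Finset.ne_of_mem_erase hy))
      (fun y _ => (y : E)) ?_ ?_ ?_ ?_ ?_ <;> simp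
  rw [h1, Algebra.norm_zero]
  congr 1
  let N : Eˣ →* kˣ := Units.map (Algebra.norm k : E →* k)
  have hs : Function.Surjective N := FiniteField.unitsMap_norm_surjective k E
  have hfib : ∀ a : kˣ, (Finset.univ.filter fun y => N y = a).card = Fintype.card k + 1 := by
    have hall : ∀ a : kˣ, (Finset.univ.filter fun y => N y = a).card =
        (Finset.univ.filter fun y => N y = 1).card := fun a =>
      MonoidHom.card_fiber_eq_of_mem_range N (hs a) (hs 1)
    have htot : Fintype.card Eˣ = Fintype.card kˣ * (Finset.univ.filter fun y => N y = 1).card := by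
      rw [← Finset.card_univ, Finset.card_eq_sum_card_fiberwise (f := N) (t := Finset.univ)
        (by simp)]
      simp only [hall]
      simp
    rw [Fintype.card_units, Fintype.card_units, card_E (k := k)] at htot
    have hk : 1 < Fintype.card k := Fintype.one_lt_card
    intro a
    rw [hall a]
    obtain ⟨m, hm⟩ : ∃ m, Fintype.card k = m + 2 := ⟨Fintype.card k - 2, by omega⟩
    rw [hm] at htot ⊢
    have : (m + 2) ^ 2 - 1 = (m + 2 - 1) * (m + 2 + 1) := by
      have e : (m + 2) ^ 2 = (m + 1) * (m + 3) + 1 := by ring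
      rw [e]; simp
    rw [this] at htot
    exact (Nat.eq_of_mul_eq_mul_left (by omega) htot).symm
  have : ∀ y : Eˣ, F (Algebra.norm k (y : E)) = F (N y : k) := fun y => rfl
  simp_rw [this]
  rw [← Finset.sum_fiberwise_of_maps_to (s := Finset.univ) (t := Finset.univ) (g := N) (by simp),
    Finset.mul_sum]
  refine Finset.sum_congr rfl fun a _ => ?_
  rw [Finset.sum_congr rfl (g := fun _ => F a) (by simp +contextual), Finset.sum_const, hfib]
  simp

/-- The quadratic Gauss sum of the norm form. -/
theorem gauss [Algebra.IsQuadraticExtension k E] {ψ : AddChar k ℂ} (hψ : ψ ≠ 1)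
    {s : k} (hs : s ≠ 0) : ∑ y : E, ψ (s * Algebra.norm k y) = -(Fintype.card k : ℂ) := by
  classical
  rw [sum_norm_fiber (E := E) (fun a => ψ (s * a))]
  have h0 : ∑ a : k, ψ (s * a) = 0 := by
    rw [Fintype.sum_bijective (s * ·) (mulLeft_bijective₀ s hs) _ (fun a => ψ a) fun _ => rfl]
    exact AddChar.sum_eq_zero_of_ne_one hψ
  have h1 : ∑ a : k, ψ (s * a) = 1 + ∑ a : kˣ, ψ (s * a) := by
    rw [← Finset.add_sum_erase _ _ (Finset.mem_univ (0 : k))]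
    congr 1
    · simp
    refine Finset.sum_bij' (fun y hy => Units.mk0 y (Finset.ne_of_mem_erase hy))
      (fun y _ => (y : k)) ?_ ?_ ?_ ?_ ?_ <;> simp
  have h2 : ∑ a : kˣ, ψ (s * a) = -1 := by
    rw [h0] at h1; linear_combination -h1
  rw [h2]; simp

theorem norm_add [Algebra.IsQuadraticExtension k E] (x y : E) :
    Algebra.norm k (x + y) = Algebra.norm k x + Algebra.trace k E (conj k E x * y)
      + Algebra.norm k y := by
  apply (algebraMap k E).injective
  rw [map_add (algebraMap k E), map_add (algebraMap k E), ← conj_mul_self, ← conj_mul_self,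
    ← conj_mul_self, ← add_conj, map_mul, conj_conj, map_add]
  ring

theorem opW_opN_opW [Algebra.IsQuadraticExtension k E] {ψ : AddChar k ℂ} (hψ : ψ ≠ 1)
    {s : k} (hs : s ≠ 0) :
    opW (E := E) ψ * opN ψ s * opW ψ =
      opN ψ (-s⁻¹) * opW ψ * opM (-algebraMap k E s) * opN ψ (-s⁻¹) := by
  classical
  have hq : (Fintype.card k : ℂ) ≠ 0 := by simp
  have hsE : algebraMap k E s ≠ 0 := by simpa using hs
  refine LinearMap.ext fun f => funext fun ξ => ?_
  simp only [Module.End.mul_apply, opM_apply, opW_apply, opN_apply]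
  have key : ∀ z : E, ∑ y : E, ψ (Algebra.trace k E (conj k E y * (ξ + z)) +
      s * Algebra.norm k y) = -(Fintype.card k : ℂ) * ψ (-s⁻¹ * Algebra.norm k (ξ + z)) := by
    intro z
    rw [← gauss (E := E) hψ hs, Finset.sum_mul]
    refine Fintype.sum_bijective (· + (algebraMap k E s)⁻¹ * (ξ + z))
      (Equiv.addRight ((algebraMap k E s)⁻¹ * (ξ + z))).bijective _ _
      fun y => ?_
    rw [← AddChar.map_add_eq_mul]
    congr 1
    rw [norm_add, map_mul (Algebra.norm k), ← map_inv₀, Algebra.norm_algebraMap,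
      Algebra.IsQuadraticExtension.finrank_eq_two, mul_left_comm, ← Algebra.smul_def, map_smul,
      smul_eq_mul]
    field_simp
    ring
  have hL : ∀ y : E, ψ (Algebra.trace k E (conj k E y * ξ)) * (ψ (s * Algebra.norm k y) *
      (-(Fintype.card k : ℂ)⁻¹ * ∑ z : E, ψ (Algebra.trace k E (conj k E z * y)) * f z)) =
      ∑ z : E, -(Fintype.card k : ℂ)⁻¹ * (f z * ψ (Algebra.trace k E (conj k E y * (ξ + z)) +
        s * Algebra.norm k y)) := by
    intro y
    rw [Finset.mul_sum, Finset.mul_sum, Finset.mul_sum]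
    refine Finset.sum_congr rfl fun z _ => ?_
    have e : Algebra.trace k E (conj k E z * y) = Algebra.trace k E (conj k E y * z) := by
      rw [← trace_conj, map_mul, conj_conj, mul_comm]
    rw [mul_add, map_add (Algebra.trace k E), AddChar.map_add_eq_mul, AddChar.map_add_eq_mul, e]
    ring
  simp_rw [hL]
  rw [Finset.sum_comm]
  simp_rw [← Finset.mul_sum, key]
  rw [mul_left_comm (ψ (-s⁻¹ * Algebra.norm k ξ)), Finset.mul_sum]
  congr 1
  rw [Finset.mul_sum]
  symm
  refine Fintype.sum_bijective (-algebraMap k E s * ·)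
    (mulLeft_bijective₀ _ (neg_ne_zero.2 hsE)) _ _ fun y => ?_
  have hh : ψ (-s⁻¹ * Algebra.norm k (ξ + -algebraMap k E s * y)) =
      ψ (-s⁻¹ * Algebra.norm k ξ) * ψ (Algebra.trace k E (conj k E y * ξ)) *
        ψ (-s⁻¹ * Algebra.norm k (-algebraMap k E s * y)) := by
    rw [← AddChar.map_add_eq_mul, ← AddChar.map_add_eq_mul, norm_add]
    congr 1
    have e : Algebra.trace k E (conj k E ξ * (-algebraMap k E s * y)) =
        -s * Algebra.trace k E (conj k E y * ξ) := by
      rw [← trace_conj (conj k E y * ξ), map_mul (conj k E), conj_conj, neg_mul, mul_neg,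
        map_neg (Algebra.trace k E), mul_left_comm, ← Algebra.smul_def, map_smul, smul_eq_mul, mul_comm (conj k E ξ) y]
      ring
    rw [e]
    field_simp
    ring
  rw [hh]
  field_simp

/-- The operator by which `g = (a, b; c, d) ∈ U₂(k)` acts in the Weil representation.
If `c = 0`, then `g = (1, b ā; 0, 1) diag(a, ā⁻¹)` with `b ā ∈ k`. If `c ≠ 0`, then
`g = (1, a / c; 0, 1) w diag(-c, -c̄⁻¹) (1, d / c; 0, 1)` with `a / c, d / c ∈ k`. -/
def weilOp (ψ : AddChar k ℂ) (g : U2 k E) : (E → ℂ) →ₗ[ℂ] (E → ℂ) :=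
  open scoped Classical in
  if entry g 1 0 = 0 then
    opN ψ (toBase (entry g 0 1 * conj k E (entry g 0 0))) * opM (entry g 0 0)
  else
    opN ψ (toBase (entry g 0 0 / entry g 1 0)) * opW ψ * opM (-entry g 1 0) *
      opN ψ (toBase (entry g 1 1 / entry g 1 0))

theorem weilOp_of_eq (ψ : AddChar k ℂ) (g : U2 k E) (h : entry g 1 0 = 0) :
    weilOp ψ g = opN ψ (toBase (entry g 0 1 * conj k E (entry g 0 0))) * opM (entry g 0 0) :=
  if_pos h

theorem weilOp_of_ne (ψ : AddChar k ℂ) (g : U2 k E) (h : entry g 1 0 ≠ 0) :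
    weilOp ψ g = opN ψ (toBase (entry g 0 0 / entry g 1 0)) * opW ψ * opM (-entry g 1 0) *
      opN ψ (toBase (entry g 1 1 / entry g 1 0)) :=
  if_neg h

variable [Algebra.IsQuadraticExtension k E]

section entries

variable (a : Eˣ) (b : k)

@[simp] theorem diagU_00 : entry (diagU (k := k) a) 0 0 = a := rfl
@[simp] theorem diagU_01 : entry (diagU (k := k) a) 0 1 = 0 := rfl
@[simp] theorem diagU_10 : entry (diagU (k := k) a) 1 0 = 0 := rfl
@[simp] theorem diagU_11 : entry (diagU (k := k) a) 1 1 = (conj k E (a : E))⁻¹ := rfl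
@[simp] theorem unipU_00 : entry (unipU (E := E) b) 0 0 = 1 := rfl
@[simp] theorem unipU_01 : entry (unipU (E := E) b) 0 1 = algebraMap k E b := rfl
@[simp] theorem unipU_10 : entry (unipU (E := E) b) 1 0 = 0 := rfl
@[simp] theorem unipU_11 : entry (unipU (E := E) b) 1 1 = 1 := rfl
@[simp] theorem wU_00 : entry (wU k E) 0 0 = 0 := rfl
@[simp] theorem wU_01 : entry (wU k E) 0 1 = 1 := rfl
@[simp] theorem wU_10 : entry (wU k E) 1 0 = -1 := rfl
@[simp] theorem wU_11 : entry (wU k E) 1 1 = 0 := rfl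

end entries

variable [NeZero (2 : k)]

theorem weilOp_diag (ψ : AddChar k ℂ) (a : Eˣ) :
    weilOp ψ (diagU (k := k) a) = opM (a : E) := by
  rw [weilOp_of_eq _ _ (diagU_10 a), diagU_01, diagU_00, zero_mul]
  simp only [toBase, map_zero, zero_div]
  rw [opN_zero, one_mul]

theorem weilOp_unip (ψ : AddChar k ℂ) (b : k) :
    weilOp ψ (unipU (E := E) b) = opN ψ b := by
  rw [weilOp_of_eq _ _ (unipU_10 b), unipU_01, unipU_00, map_one, mul_one, toBase_algebraMap,
    opM_one, mul_one]

theorem weilOp_w (ψ : AddChar k ℂ) : weilOp ψ (wU k E) = opW ψ := by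
  rw [weilOp_of_ne _ _ (by simp), wU_00, wU_10, wU_11, zero_div, neg_neg]
  simp only [toBase, map_zero, zero_div]
  rw [opN_zero, opM_one, one_mul, mul_one, mul_one]

theorem weilOp_unip_mul (ψ : AddChar k ℂ) (s : k) (g : U2 k E) :
    weilOp ψ (unipU s * g) = opN ψ s * weilOp ψ g := by
  have e00 : entry (unipU s * g) 0 0 = entry g 0 0 + algebraMap k E s * entry g 1 0 := by
    simp [entry_mul]
  have e01 : entry (unipU s * g) 0 1 = entry g 0 1 + algebraMap k E s * entry g 1 1 := by
    simp [entry_mul]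
  have e10 : entry (unipU s * g) 1 0 = entry g 1 0 := by simp [entry_mul]
  have e11 : entry (unipU s * g) 1 1 = entry g 1 1 := by simp [entry_mul]
  by_cases h : entry g 1 0 = 0
  · have h3 := rel3 g
    rw [h, zero_mul, sub_zero] at h3
    rw [weilOp_of_eq _ _ (e10.trans h), weilOp_of_eq _ _ h, e00, e01, h, mul_zero, add_zero,
      add_mul, mul_assoc, h3, mul_one, toBase_add, toBase_algebraMap, ← mul_assoc, opN_opN,
      add_comm]
  · rw [weilOp_of_ne _ _ (by rwa [e10]), weilOp_of_ne _ _ h, e00, e10, e11, add_div,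
      mul_div_assoc, div_self h, mul_one, toBase_add, toBase_algebraMap, add_comm, ← opN_opN]
    simp only [mul_assoc]

theorem weilOp_diag_mul (ψ : AddChar k ℂ) (t : Eˣ) (g : U2 k E) :
    weilOp ψ (diagU t * g) = opM (t : E) * weilOp ψ g := by
  have ht : conj k E (t : E) ≠ 0 := by simp
  have e00 : entry (diagU t * g) 0 0 = t * entry g 0 0 := by simp [entry_mul]
  have e01 : entry (diagU t * g) 0 1 = t * entry g 0 1 := by simp [entry_mul]
  have e10 : entry (diagU t * g) 1 0 = (conj k E (t : E))⁻¹ * entry g 1 0 := by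
    rw [entry_mul, diagU_10, diagU_11, zero_mul, zero_add]
  have e11 : entry (diagU t * g) 1 1 = (conj k E (t : E))⁻¹ * entry g 1 1 := by
    rw [entry_mul, diagU_10, diagU_11, zero_mul, zero_add]
  by_cases h : entry g 1 0 = 0
  · rw [weilOp_of_eq _ _ (by rw [e10, h, mul_zero]), weilOp_of_eq _ _ h, e00, e01,
      map_mul (conj k E), mul_mul_mul_comm, conj_mul_self, toBase_mul, ← mul_assoc, opM_opN,
      mul_assoc (opN _ _), opM_opM, mul_comm (Algebra.norm k (t : E))]
  · have h' : entry (diagU t * g) 1 0 ≠ 0 := by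
      rw [e10]; exact mul_ne_zero (inv_ne_zero ht) h
    have h0 : (t : E) * entry g 0 0 / ((conj k E (t : E))⁻¹ * entry g 1 0) =
        algebraMap k E (Algebra.norm k (t : E)) * (entry g 0 0 / entry g 1 0) := by
      rw [← conj_mul_self]
      generalize conj k E (t : E) = T at *
      field_simp
    have h1 : (conj k E (t : E))⁻¹ * entry g 1 1 / ((conj k E (t : E))⁻¹ * entry g 1 0) =
        entry g 1 1 / entry g 1 0 := by
      generalize conj k E (t : E) = T at *
      field_simp
    have hM : opM (t : E) * opW ψ = opW ψ * opM (conj k E (t : E))⁻¹ := by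
      rw [opW_opM _ _ (inv_ne_zero ht), map_inv₀, conj_conj, inv_inv]
    rw [weilOp_of_ne _ _ h', weilOp_of_ne _ _ h, e00, e10, e11, h0, h1, toBase_mul]
    simp only [← mul_assoc]
    rw [opM_opN, mul_assoc (opN _ _) (opM (t : E)), hM, mul_comm (Algebra.norm k (t : E))]
    simp only [mul_assoc]
    rw [← mul_assoc (opM _) (opM _), opM_opM, mul_neg]

theorem weilOp_w_mul {ψ : AddChar k ℂ} (hψ : ψ ≠ 1) (g : U2 k E) :
    weilOp ψ (wU k E * g) = opW ψ * weilOp ψ g := by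
  have e00 : entry (wU k E * g) 0 0 = entry g 1 0 := by simp [entry_mul]
  have e01 : entry (wU k E * g) 0 1 = entry g 1 1 := by simp [entry_mul]
  have e10 : entry (wU k E * g) 1 0 = -entry g 0 0 := by simp [entry_mul]
  have e11 : entry (wU k E * g) 1 1 = -entry g 0 1 := by simp [entry_mul]
  have hc : ∀ x : E, x ≠ 0 → conj k E x ≠ 0 := fun x hx => by simpa using hx
  by_cases h : entry g 1 0 = 0
  · have h3 := rel3 g
    rw [h, zero_mul, sub_zero] at h3
    have ha : entry g 0 0 ≠ 0 := by
      intro h0; rw [h0, map_zero, mul_zero] at h3; exact zero_ne_one h3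
    have hb : conj k E (entry g 0 1 / entry g 0 0) = entry g 0 1 / entry g 0 0 := by
      rw [map_div₀, div_eq_div_iff (hc _ ha) ha]
      linear_combination rel1 g
    have hb' : entry g 0 1 * conj k E (entry g 0 0) =
        algebraMap k E (Algebra.norm k (entry g 0 0)) * (entry g 0 1 / entry g 0 0) := by
      rw [← conj_mul_self]
      generalize conj k E (entry g 0 0) = T at *
      field_simp
    rw [weilOp_of_ne _ _ (by rw [e10]; exact neg_ne_zero.2 ha), weilOp_of_eq _ _ h, e00, e10, e11,
      h, zero_div, neg_neg, neg_div_neg_eq, hb', toBase_mul,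
      mul_comm (Algebra.norm k (entry g 0 0)), ← opM_opN, ← mul_assoc]
    simp only [toBase, map_zero, zero_div]
    rw [opN_zero, one_mul]
  · by_cases ha : entry g 0 0 = 0
    · have h2 := rel2 g
      rw [ha, zero_mul, zero_sub] at h2
      have hd : algebraMap k E (toBase (entry g 1 1 / entry g 1 0)) = entry g 1 1 / entry g 1 0 := by
        apply algebraMap_toBase
        rw [map_div₀, div_eq_div_iff (hc _ h) h]
        linear_combination rel4 g
      have hn : entry g 1 1 * conj k E (entry g 1 0) =
          algebraMap k E (Algebra.norm k (entry g 1 0)) * (entry g 1 1 / entry g 1 0) := by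
        rw [← conj_mul_self]
        generalize conj k E (entry g 1 0) = T at *
        field_simp
      rw [weilOp_of_eq _ _ (by rw [e10, ha, neg_zero]), weilOp_of_ne _ _ h, e00, e01, ha, zero_div,
        hn, toBase_mul, mul_comm (Algebra.norm k (entry g 1 0)), ← opM_opN]
      have hz : (toBase (0 : E) : k) = 0 := by simp [toBase]
      rw [hz, opN_zero, one_mul, ← mul_assoc, ← mul_assoc, opW_opW hψ, opM_opM]
      simp
    · have hs : algebraMap k E (toBase (entry g 0 0 / entry g 1 0)) =
          entry g 0 0 / entry g 1 0 := by
        apply algebraMap_toBase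
        rw [map_div₀, div_eq_div_iff (hc _ h) h]
        linear_combination rel5 g
      have hd : algebraMap k E (toBase (entry g 1 1 / entry g 1 0)) =
          entry g 1 1 / entry g 1 0 := by
        apply algebraMap_toBase
        rw [map_div₀, div_eq_div_iff (hc _ h) h]
        linear_combination rel4 g
      set s : k := toBase (entry g 0 0 / entry g 1 0) with hsdef
      set r : k := toBase (entry g 1 1 / entry g 1 0) with hrdef
      have hs0 : s ≠ 0 := by
        intro h0
        rw [h0, map_zero] at hs
        exact div_ne_zero ha h hs.symm
      have hA : toBase (entry g 1 0 / -entry g 0 0) = -s⁻¹ := by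
        rw [← toBase_algebraMap (E := E) (-s⁻¹), map_neg, map_inv₀, hs, inv_div, div_neg]
      have hdet : entry g 0 1 / entry g 0 0 =
          algebraMap k E (r - s⁻¹ * (Algebra.norm k (entry g 1 0))⁻¹) := by
        have hC := hc _ h
        rw [map_sub, map_mul, map_inv₀, map_inv₀, hs, hd, ← conj_mul_self]
        have h4 := rel4 g
        have h5 := rel5 g
        have h2 := rel2 g
        generalize conj k E (entry g 1 0) = C at *
        generalize conj k E (entry g 1 1) = D at *
        field_simp
        linear_combination (-entry g 1 0) * h2 + (entry g 0 0) * h4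
      have hB : toBase (-entry g 0 1 / -entry g 0 0) =
          r - s⁻¹ * (Algebra.norm k (entry g 1 0))⁻¹ := by
        rw [neg_div_neg_eq, hdet, toBase_algebraMap]
      have hN : Algebra.norm k (-entry g 1 0) = Algebra.norm k (entry g 1 0) := by
        rw [← mul_neg_one, map_mul]
        have : Algebra.norm k (-1 : E) = 1 := by
          apply (algebraMap k E).injective
          rw [← conj_mul_self, map_neg, map_one, map_one]; ring
        rw [this, mul_one]
      have hN0 : Algebra.norm k (entry g 1 0) ≠ 0 := Algebra.norm_ne_zero_iff.2 h
      rw [weilOp_of_ne _ _ (by rw [e10]; exact neg_ne_zero.2 ha), weilOp_of_ne _ _ h, e00, e10, e11,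
        hA, hB, neg_neg]
      simp only [← mul_assoc]
      rw [opW_opN_opW hψ hs0]
      simp only [mul_assoc]
      congr 2
      rw [← mul_assoc (opN _ _) (opM (-entry g 1 0))]
      have : opN ψ (-s⁻¹) * opM (-entry g 1 0) =
          opM (-entry g 1 0) * opN ψ (-s⁻¹ * (Algebra.norm k (entry g 1 0))⁻¹) := by
        rw [opM_opN, hN, mul_assoc, inv_mul_cancel₀ hN0, mul_one]
      rw [this, mul_assoc, opN_opN, ← mul_assoc, opM_opM, neg_mul_neg, hs, div_mul_cancel₀ _ h]
      congr 2
      ring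

/-- Bruhat decomposition. -/
theorem bruhat (g : U2 k E) : (∃ a s, g = unipU s * diagU a) ∨
    ∃ a s r, g = unipU s * (wU k E * (diagU a * unipU r)) := by
  have hc : ∀ x : E, x ≠ 0 → conj k E x ≠ 0 := fun x hx => by simpa using hx
  by_cases h : entry g 1 0 = 0
  · left
    have h3 := rel3 g
    rw [h, zero_mul, sub_zero] at h3
    have ha : entry g 0 0 ≠ 0 := by
      intro h0; rw [h0, map_zero, mul_zero] at h3; exact zero_ne_one h3
    have hb : algebraMap k E (toBase (entry g 0 1 * conj k E (entry g 0 0))) =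
        entry g 0 1 * conj k E (entry g 0 0) := by
      apply algebraMap_toBase
      rw [map_mul, conj_conj, mul_comm, rel1]
    have hA := hc _ ha
    refine ⟨Units.mk0 _ ha, toBase (entry g 0 1 * conj k E (entry g 0 0)), ?_⟩
    apply ext_entry <;> rw [entry_mul]
    · simp
    · rw [diagU_11, diagU_01, unipU_01, hb, Units.val_mk0, mul_inv_cancel_right₀ hA]; simp
    · simp [h]
    · rw [diagU_11, diagU_01, unipU_11, Units.val_mk0, mul_zero, zero_add, one_mul]
      exact eq_inv_of_mul_eq_one_left h3
  · right
    have hC := hc _ h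
    have hs : algebraMap k E (toBase (entry g 0 0 / entry g 1 0)) = entry g 0 0 / entry g 1 0 := by
      apply algebraMap_toBase
      rw [map_div₀, div_eq_div_iff (hc _ h) h]
      linear_combination rel5 g
    have hd : algebraMap k E (toBase (entry g 1 1 / entry g 1 0)) = entry g 1 1 / entry g 1 0 := by
      apply algebraMap_toBase
      rw [map_div₀, div_eq_div_iff (hc _ h) h]
      linear_combination rel4 g
    refine ⟨Units.mk0 _ (neg_ne_zero.2 h), toBase (entry g 0 0 / entry g 1 0),
      toBase (entry g 1 1 / entry g 1 0), ?_⟩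
    have h4 := rel4 g
    have h2 := rel2 g
    apply ext_entry
    · simp [entry_mul, hs]; field_simp
    · simp only [entry_mul, unipU_00, unipU_01, unipU_11, wU_00, wU_01, wU_10, wU_11, diagU_00,
        diagU_01, diagU_10, diagU_11, hs, hd, Units.val_mk0, map_neg]
      generalize conj k E (entry g 1 0) = C at *
      generalize conj k E (entry g 1 1) = D at *
      field_simp
      linear_combination (-entry g 1 0 ^ 2) * h2 + (entry g 1 0 * entry g 0 0) * h4
    · simp [entry_mul]
    · simp only [entry_mul, unipU_01, unipU_11, unipU_10, wU_00, wU_01, wU_10, wU_11,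
        diagU_00, diagU_01, diagU_10, diagU_11, hd, Units.val_mk0]
      field_simp
      ring

theorem weilOp_mul {ψ : AddChar k ℂ} (hψ : ψ ≠ 1) (g h : U2 k E) :
    weilOp ψ (g * h) = weilOp ψ g * weilOp ψ h := by
  rcases bruhat g with ⟨a, s, rfl⟩ | ⟨a, s, r, rfl⟩
  · simp only [mul_assoc, weilOp_unip_mul, weilOp_diag_mul, weilOp_diag]
  · simp only [mul_assoc, weilOp_unip_mul, weilOp_diag_mul, weilOp_w_mul hψ, weilOp_unip]

/-- The Weil representation `ω_ψ` of `U₂(k)` on the space of functions on `E`. -/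
def weil (ψ : AddChar k ℂ) (hψ : ψ ≠ 1) : Representation ℂ (U2 k E) (E → ℂ) where
  toFun := weilOp ψ
  map_one' := by
    have : (1 : U2 k E) = unipU 0 := by
      apply ext_entry <;> simp [entry_one]
    rw [this, weilOp_unip, opN_zero]
  map_mul' := weilOp_mul hψ

theorem weil_diag (ψ : AddChar k ℂ) (hψ : ψ ≠ 1) (a : Eˣ) (f : E → ℂ) (ξ : E) :
    weil ψ hψ (diagU (k := k) a) f ξ = f (a * ξ) :=
  congrArg (fun T : (E → ℂ) →ₗ[ℂ] (E → ℂ) => T f ξ) (weilOp_diag ψ a)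

theorem weil_unip (ψ : AddChar k ℂ) (hψ : ψ ≠ 1) (b : k) (f : E → ℂ) (ξ : E) :
    weil ψ hψ (unipU (E := E) b) f ξ = ψ (b * Algebra.norm k ξ) * f ξ :=
  congrArg (fun T : (E → ℂ) →ₗ[ℂ] (E → ℂ) => T f ξ) (weilOp_unip ψ b)

theorem weil_w (ψ : AddChar k ℂ) (hψ : ψ ≠ 1) (f : E → ℂ) (ξ : E) :
    weil ψ hψ (wU k E) f ξ = -(Fintype.card k : ℂ)⁻¹ *
      ∑ y : E, ψ (Algebra.trace k E (conj k E y * ξ)) * f y :=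
  congrArg (fun T : (E → ℂ) →ₗ[ℂ] (E → ℂ) => T f ξ) (weilOp_w ψ)

end Weil

/-! ## Characters and the irreducible representations -/

section Reps

variable {k E : Type*} [Field k] [Fintype k] [Field E] [Fintype E] [Algebra k E]

/-- The one-dimensional representation attached to a character of a group. -/
def ofChar {G : Type*} [Group G] (c : G →* ℂˣ) : Representation ℂ G ℂ where
  toFun g := (c g : ℂ) • LinearMap.id
  map_one' := by ext; simp
  map_mul' g h := by ext; simp [mul_comm]

/-- The twist `c ⊗ ρ` of a representation `ρ`, on the same space, by a character `c`. -/
def twist {G V : Type*} [Group G] [AddCommMonoid V] [Module ℂ V] (c : G →* ℂˣ)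
    (ρ : Representation ℂ G V) : Representation ℂ G V where
  toFun g := (c g : ℂ) • ρ g
  map_one' := by ext; simp
  map_mul' g h := by ext; simp [mul_smul, smul_comm (c g : ℂ)]

variable [Algebra.IsQuadraticExtension k E]

/-- The determinant `U₂(k) → E¹`. -/
def detU : U2 k E →* E1 k E :=
  (Matrix.GeneralLinearGroup.det.comp (U2 k E).subtype).codRestrict (E1 k E) fun g =>
    (mem_E1 _).2 (norm_det g)

/-- The one-dimensional representation `η ∘ det` of `U₂(k)`, for a character `η` of `E¹`. -/
def charRep (η : E1 k E →* ℂˣ) : Representation ℂ (U2 k E) ℂ := ofChar (η.comp detU)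

variable (k E) in
/-- The upper triangular Borel subgroup of `U₂(k)`. -/
def borel : Subgroup (U2 k E) where
  carrier := {g | entry g 1 0 = 0}
  one_mem' := by simp [entry_one]
  mul_mem' := by
    intro g h hg hh
    simp only [Set.mem_ofPred_eq] at *
    rw [entry_mul, hg, hh]; simp
  inv_mem' := by
    intro g hg
    simp only [Set.mem_ofPred_eq] at *
    have h3 := rel3 g
    rw [hg, zero_mul, sub_zero] at h3
    have hd : entry g 1 1 ≠ 0 := by
      intro h0; rw [h0, zero_mul] at h3; exact zero_ne_one h3
    have h := entry_mul g g⁻¹ 1 0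
    rw [mul_inv_cancel, entry_one, hg, zero_mul, zero_add] at h
    simpa [hd] using h.symm

/-- The homomorphism from the Borel subgroup to `Eˣ` sending `(a, b; 0, ā⁻¹)` to `a`. -/
def borelDiag : borel k E →* Eˣ where
  toFun g := ⟨entry g.1 0 0, conj k E (entry g.1 1 1),
    by have h := rel2 g.1
       rw [show entry g.1 1 0 = 0 from g.2, map_zero, mul_zero, sub_zero] at h; exact h,
    by have h := rel2 g.1
       rw [show entry g.1 1 0 = 0 from g.2, map_zero, mul_zero, sub_zero, mul_comm] at h; exact h⟩
  map_one' := by ext; simp [entry_one]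
  map_mul' g h := by
    ext
    change entry (g.1 * h.1) 0 0 = entry g.1 0 0 * entry h.1 0 0
    rw [entry_mul, show entry h.1 1 0 = 0 from h.2, mul_zero, add_zero]

/-- The space of `I(χ)`: functions `f` on `U₂(k)` with `f(b g) = χ(b) f(g)` for all `b` in the
Borel subgroup. -/
abbrev PSSpace (χ : Eˣ →* ℂˣ) : Submodule ℂ (U2 k E → ℂ) :=
  Representation.coindV (borel k E).subtype (ofChar (χ.comp borelDiag))

/-- The induced representation `I(χ)` of `U₂(k)`; the group acts by right translation. -/
def ps (k : Type*) {E : Type*} [Field k] [Fintype k] [Field E] [Fintype E] [Algebra k E]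
    [Algebra.IsQuadraticExtension k E] (χ : Eˣ →* ℂˣ) :
    Representation ℂ (U2 k E) (PSSpace (k := k) χ) :=
  Representation.coind (borel k E).subtype (ofChar (χ.comp borelDiag))

variable (k E) in
/-- The action of `U₂(k)` on functions on itself by right translation; `I(χ)` is a
subrepresentation of it. -/
def rightReg : Representation ℂ (U2 k E) (U2 k E → ℂ) where
  toFun g := LinearMap.funLeft ℂ ℂ (· * g)
  map_one' := LinearMap.ext fun f => funext fun x => by simp [LinearMap.funLeft_apply]
  map_mul' g h := LinearMap.ext fun f => funext fun x => by
    simp [LinearMap.funLeft_apply, mul_assoc]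

theorem ps_apply_coe (χ : Eˣ →* ℂˣ) (g : U2 k E) (f : PSSpace (k := k) χ) :
    (ps k χ g f : U2 k E → ℂ) = rightReg k E g f := rfl

variable (k E) in
/-- The space of the Steinberg representation: the functions in `I(1)` of total sum zero. This is
an invariant complement of the line of constant functions in `I(1)`. -/
def StSpace : Submodule ℂ (U2 k E → ℂ) where
  carrier := {f | f ∈ PSSpace (k := k) (1 : Eˣ →* ℂˣ) ∧ ∑ g : U2 k E, f g = 0}
  zero_mem' := ⟨Submodule.zero_mem _, by simp⟩
  add_mem' := by
    intro f f' hf hf'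
    refine ⟨Submodule.add_mem _ hf.1 hf'.1, ?_⟩
    simp [Finset.sum_add_distrib, hf.2, hf'.2]
  smul_mem' := by
    intro c f hf
    refine ⟨Submodule.smul_mem _ c hf.1, ?_⟩
    simp [← Finset.mul_sum, hf.2]

variable (k E) in
/-- The Steinberg representation `St` of `U₂(k)`, where `I(1) = 1 ⊕ St`. -/
def steinberg : Representation ℂ (U2 k E) (StSpace k E) :=
  (rightReg k E).subrepresentation (StSpace k E) fun g f hf => by
    refine ⟨(ps k (1 : Eˣ →* ℂˣ) g ⟨f, hf.1⟩).2, ?_⟩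
    change ∑ h : U2 k E, f (h * g) = 0
    rw [Fintype.sum_bijective (· * g) (Group.mulRight_bijective g) _ f fun _ => rfl]
    exact hf.2

/-- The representation `St_η = η ⊗ St`. -/
def steinbergTwist (η : E1 k E →* ℂˣ) : Representation ℂ (U2 k E) (StSpace k E) :=
  twist (η.comp detU) (steinberg k E)

/-- The space `W(μ)` of functions `f` on `E` such that `f(y x) = μ⁻¹(y) f(x)` for `y ∈ E¹`. -/
def WSpace (μ : E1 k E →* ℂˣ) : Submodule ℂ (E → ℂ) where
  carrier := {f | ∀ (y : E1 k E) (x : E), f ((y : Eˣ) * x) = ((μ⁻¹ y : ℂˣ) : ℂ) * f x}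
  zero_mem' := by simp
  add_mem' := by
    intro f f' hf hf' y x
    simp only [Pi.add_apply, hf y x, hf' y x, mul_add]
  smul_mem' := by
    intro c f hf y x
    simp only [Pi.smul_apply, smul_eq_mul, hf y x]; ring

theorem opM_mem {μ : E1 k E →* ℂˣ} (a : E) {f : E → ℂ} (hf : f ∈ WSpace μ) :
    opM a f ∈ WSpace μ := by
  intro y x
  rw [opM_apply, opM_apply, mul_left_comm, hf y]

theorem opN_mem {μ : E1 k E →* ℂˣ} (ψ : AddChar k ℂ) (b : k) {f : E → ℂ} (hf : f ∈ WSpace μ) :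
    opN ψ b f ∈ WSpace μ := by
  intro y x
  rw [opN_apply, opN_apply, hf y, map_mul (Algebra.norm k), (mem_E1 _).1 y.2, one_mul]; ring

theorem opW_mem {μ : E1 k E →* ℂˣ} (ψ : AddChar k ℂ) {f : E → ℂ} (hf : f ∈ WSpace μ) :
    opW ψ f ∈ WSpace μ := by
  intro y x
  have hy : (((y : Eˣ) : E)) * conj k E ((y : Eˣ) : E) = 1 := by
    rw [conj_mul_self, (mem_E1 _).1 y.2, map_one]
  rw [opW_apply, opW_apply, mul_left_comm]
  congr 1
  rw [Finset.mul_sum]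
  symm
  refine Fintype.sum_bijective (((y : Eˣ) : E) * ·) (mulLeft_bijective₀ _ (Units.ne_zero _)) _ _
    fun z => ?_
  have e : conj k E (((y : Eˣ) : E) * z) * (((y : Eˣ) : E) * x) = conj k E z * x := by
    rw [map_mul]
    linear_combination (conj k E z * x) * hy
  rw [e, hf y]; ring

variable [NeZero (2 : k)]

theorem weil_mem (ψ : AddChar k ℂ) (hψ : ψ ≠ 1) {μ : E1 k E →* ℂˣ} (g : U2 k E) {f : E → ℂ}
    (hf : f ∈ WSpace μ) : weil ψ hψ g f ∈ WSpace μ := by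
  change weilOp ψ g f ∈ _
  by_cases h : entry g 1 0 = 0
  · rw [weilOp_of_eq _ _ h]
    exact opN_mem _ _ (opM_mem _ hf)
  · rw [weilOp_of_ne _ _ h]
    exact opN_mem _ _ (opW_mem _ (opM_mem _ (opN_mem _ _ hf)))

/-- The representation `ω_{ψ,μ,η}` of `U₂(k)` on `W(μ)`: `U₂(k)` acts on `W(μ) ⊆ (E → ℂ)` through
`ω_ψ`, twisted by `η ∘ det`. On `diag(a, ā⁻¹)` it is `f ↦ η(a / ā) f(a ·)`, and on `SL₂(k)` it is
the usual cuspidal representation `ω_{ψ,μ}`. -/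
def cusp (ψ : AddChar k ℂ) (hψ : ψ ≠ 1) (μ η : E1 k E →* ℂˣ) :
    Representation ℂ (U2 k E) (WSpace μ) :=
  twist (η.comp detU) ((weil ψ hψ).subrepresentation (WSpace μ) fun g _ hf => weil_mem ψ hψ g hf)

theorem cusp_apply_coe (ψ : AddChar k ℂ) (hψ : ψ ≠ 1) (μ η : E1 k E →* ℂˣ) (g : U2 k E)
    (f : WSpace μ) : (cusp ψ hψ μ η g f : E → ℂ) = (η (detU g) : ℂ) • weil ψ hψ g f := rfl

theorem detU_diagU (a : Eˣ) :
    ((detU (diagU (k := k) a) : Eˣ) : E) = a * (conj k E (a : E))⁻¹ := by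
  change ((diagU (k := k) a).1.1).det = _
  rw [Matrix.det_fin_two]
  change entry (diagU (k := k) a) 0 0 * entry (diagU (k := k) a) 1 1 -
    entry (diagU (k := k) a) 0 1 * entry (diagU (k := k) a) 1 0 = _
  rw [diagU_01, zero_mul, sub_zero, diagU_00, diagU_11]

/-- The character `χ̄⁻¹ : a ↦ χ(ā⁻¹)` of `Eˣ`. -/
def conjInv (k : Type*) {E : Type*} [Field k] [Fintype k] [Field E] [Fintype E] [Algebra k E]
    (χ : Eˣ →* ℂˣ) : Eˣ →* ℂˣ :=
  (χ.comp (Units.map (conj k E : E →* E)))⁻¹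

/-- `A` is a set of representatives of `S` modulo the relation `x ∼ σ x`, for an involution `σ`
of `S`. -/
structure IsRepresentatives {X : Type*} (S : Set X) (σ : X → X) (A : Set X) : Prop where
  subset : A ⊆ S
  existsUnique : ∀ x ∈ S, ∃! a, a ∈ A ∧ (a = x ∨ a = σ x)

/-- `A` is a set of representatives of the characters `χ` of `Eˣ` that are non-trivial on `kˣ`,
modulo `χ ∼ χ̄⁻¹`. -/
def IsRepsA (k : Type*) {E : Type*} [Field k] [Fintype k] [Field E] [Fintype E] [Algebra k E]
    (A : Set (Eˣ →* ℂˣ)) : Prop :=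
  IsRepresentatives {χ | χ.comp (Units.map (algebraMap k E : k →* E)) ≠ 1} (conjInv k) A

/-- `B` is a set of representatives of the pairs `(μ, η)` of characters of `E¹` with `μ ≠ 1`,
modulo `(μ, η) ∼ (μ⁻¹, η μ⁻¹)`. -/
def IsRepsB (B : Set ((E1 k E →* ℂˣ) × (E1 k E →* ℂˣ))) : Prop :=
  IsRepresentatives {p | p.1 ≠ 1} (fun p => (p.1⁻¹, p.2 * p.1⁻¹)) B

/-- Two representations are isomorphic. -/
def Iso {G V W : Type*} [Group G] [AddCommMonoid V] [Module ℂ V] [AddCommMonoid W]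
    [Module ℂ W] (ρ : Representation ℂ G V) (σ : Representation ℂ G W) : Prop :=
  Nonempty (ρ.Equiv σ)

end Reps

end FinU2
end

open scoped Matrix

set_option linter.unusedSectionVars false

noncomputable section

/-! A complex representation of a finite group is determined by its character
(`iso_of_character_eq`), so each of the four decompositions is an identity of class functions. The
identity is checked on four types of elements (`type_induction`): scalars z in E¹; non-scalar
elements with a repeated eigenvalue z in E¹; split elements with eigenvalues x and x̄⁻¹, where x is
not in E¹; anisotropic elements with distinct eigenvalues z, z' in E¹. That nothing else occurs
follows from Hilbert 90 and from the fact that every element of k is a square in E.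

On these types all characters are explicit in q and the eigenvalues. The character of ω_ψ at g is
(-q)^dim ker(g - 1), that is q², -q or 1; this comes from Gauss sums for the norm form
(`char_weil`). Averaging it over the centre against μ gives the character of ω_{ψ,μ,η}
(`char_cusp_eq_sum`). The character of I(χ) is a sum over the fixed points of g on the projective
line over k (`char_ps_eq_sum`), and the character of St is that of I(1) minus 1. In the order of the
types above, I(χ) has the values (q+1)χ(z), χ(z), χ(x) + χ(x̄⁻¹), 0, and ω_{ψ,μ,η} has the values
(q-1)η(z²)μ(z)⁻¹, -η(z²)μ(z)⁻¹, 0, -η(zz')(μ(z)⁻¹ + μ(z')⁻¹).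

The involutions defining A and B have no fixed points and preserve these characters, so twice a sum
over representatives is a sum over all admissible characters or pairs
(`IsRepresentatives.two_mul_sum`). Orthogonality turns the latter into indicators of z = 1, z' = 1
and zz' = 1 (`sum_dual_nontrivial`, `pairSum`), and what remains is polynomial arithmetic in q.

Irreducibility uses `isIrreducible_of_eval`: every non-zero invariant subspace meets a suitable
eigenspace, of the Borel subgroup or of its unipotent radical, and that eigenspace is at most a line
because one evaluation is injective on it. The four families have dimensions 1, q, q+1 and q-1,
distinct because q ≥ 3. Inside a family the parameters are recovered from the determinant, from the
characters through which the Borel subgroup acts on eigenvectors, or from the character values on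
scalar and anisotropic elements. -/

namespace FinU2

/-! ## Characters determine representations of finite groups -/

section Representations

variable {G : Type*} [Group G]

/-- The direct sum of two isomorphisms of representations. -/
def prodEquiv {V V' W W' : Type*} [AddCommGroup V] [Module ℂ V] [AddCommGroup V'] [Module ℂ V']
    [AddCommGroup W] [Module ℂ W] [AddCommGroup W'] [Module ℂ W']
    {ρ : Representation ℂ G V} {ρ' : Representation ℂ G V'}
    {σ : Representation ℂ G W} {σ' : Representation ℂ G W'}
    (e : ρ.Equiv σ) (e' : ρ'.Equiv σ') : (ρ.prod ρ').Equiv (σ.prod σ') :=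
  .mk (e.toLinearEquiv.prodCongr e'.toLinearEquiv) fun g => by
    refine LinearMap.ext fun x => Prod.ext ?_ ?_
    · exact Representation.IntertwiningMap.isIntertwining _ _ e.toIntertwiningMap g x.1
    · exact Representation.IntertwiningMap.isIntertwining _ _ e'.toIntertwiningMap g x.2

/-- A representation is the direct sum of two complementary subrepresentations. -/
def isComplEquiv {V : Type*} [AddCommGroup V] [Module ℂ V] {ρ : Representation ℂ G V}
    {p q : Subrepresentation ρ} (h : IsCompl p.toSubmodule q.toSubmodule) :
    (p.toRepresentation.prod q.toRepresentation).Equiv ρ :=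
  .mk (Submodule.prodEquivOfIsCompl _ _ h) fun g => by
    refine LinearMap.ext fun x => ?_
    simp [Subrepresentation.toRepresentation]

theorem isCompl_toSubmodule {V : Type*} [AddCommGroup V] [Module ℂ V] {ρ : Representation ℂ G V}
    {p q : Subrepresentation ρ} (h : IsCompl p q) : IsCompl p.toSubmodule q.toSubmodule := by
  refine ⟨disjoint_iff.2 ?_, codisjoint_iff.2 ?_⟩
  · rw [← Subrepresentation.toSubmodule_inf, h.inf_eq_bot]; rfl
  · rw [← Subrepresentation.toSubmodule_sup, h.sup_eq_top]; rfl

theorem char_prod {V W : Type*} [AddCommGroup V] [Module ℂ V] [FiniteDimensional ℂ V]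
    [AddCommGroup W] [Module ℂ W] [FiniteDimensional ℂ W] (ρ : Representation ℂ G V)
    (σ : Representation ℂ G W) (g : G) :
    (ρ.prod σ).character g = ρ.character g + σ.character g :=
  LinearMap.trace_prodMap' (ρ g) (σ g)

theorem char_directSum {ι : Type*} [Fintype ι] {V : ι → Type*} [∀ i, AddCommGroup (V i)]
    [∀ i, Module ℂ (V i)] [∀ i, FiniteDimensional ℂ (V i)]
    (ρ : ∀ i, Representation ℂ G (V i)) (g : G) :
    (Representation.directSum ρ).character g = ∑ i, (ρ i).character g := by
  classical
  -- The block-diagonal operator is a sum of terms factoring through single summands, so cyclicity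
  -- of the trace reduces each term to the trace on that summand.
  have h : Representation.directSum ρ g =
      ∑ i, DirectSum.lof ℂ ι V i ∘ₗ (ρ i g ∘ₗ DirectSum.component ℂ ι V i) := by
    refine DirectSum.linearMap_ext ℂ fun j => LinearMap.ext fun x => ?_
    rw [LinearMap.comp_apply, LinearMap.comp_apply, LinearMap.sum_apply, Finset.sum_eq_single j]
    · simp [Representation.directSum, DirectSum.component.lof_self]
    · intro i _ hij
      simp [DirectSum.component.of, hij.symm]
    · simp
  change LinearMap.trace ℂ _ (Representation.directSum ρ g) = _
  rw [h, map_sum]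
  refine Finset.sum_congr rfl fun i _ => ?_
  rw [LinearMap.trace_comp_comm', LinearMap.comp_assoc]
  have : DirectSum.component ℂ ι V i ∘ₗ DirectSum.lof ℂ ι V i = LinearMap.id :=
    LinearMap.ext fun x => DirectSum.component.lof_self ℂ i x
  rw [this]
  rfl

variable [Fintype G]

/-- The normalised pairing of two characters is the dimension of the space of intertwining maps.
Equal characters make Hom(ρ, σ) as large as End(ρ), which contains the identity. -/
theorem exists_ne_zero_intertwiningMap {V W : Type*} [AddCommGroup V] [Module ℂ V]
    [FiniteDimensional ℂ V] [AddCommGroup W] [Module ℂ W] [FiniteDimensional ℂ W]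
    [Nontrivial V] {ρ : Representation ℂ G V} {σ : Representation ℂ G W}
    (h : ρ.character = σ.character) : ∃ f : ρ.IntertwiningMap σ, f ≠ 0 := by
  have : Invertible (Nat.card G : ℂ) := invertibleOfNonzero (by simp)
  have h1 := ρ.card_inv_mul_sum_char_mul_char_eq_finrank σ
  have h2 := ρ.card_inv_mul_sum_char_mul_char_eq_finrank ρ
  rw [← h, h2, Nat.cast_inj] at h1
  have : Nontrivial (ρ.IntertwiningMap ρ) := by
    refine ⟨.id ρ, 0, fun h => ?_⟩
    obtain ⟨v, hv⟩ := exists_ne (0 : V)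
    exact hv (congrArg (fun f : ρ.IntertwiningMap ρ => f v) h)
  have : 0 < Module.finrank ℂ (ρ.IntertwiningMap σ) := h1 ▸ Module.finrank_pos
  exact Module.finrank_pos_iff_exists_ne_zero.1 this

universe u v in
/-- Complex representations of a finite group with the same character are isomorphic. -/
theorem iso_of_character_eq {V : Type u} {W : Type v} [AddCommGroup V] [Module ℂ V]
    [FiniteDimensional ℂ V] [AddCommGroup W] [Module ℂ W] [FiniteDimensional ℂ W]
    {ρ : Representation ℂ G V} {σ : Representation ℂ G W}
    (h : ρ.character = σ.character) : Iso ρ σ := by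
  induction hn : Module.finrank ℂ V using Nat.strong_induction_on generalizing V W with
  | _ n ih =>
  have hVW : (Module.finrank ℂ V : ℂ) = Module.finrank ℂ W := by
    rw [← ρ.char_one, ← σ.char_one, h]
  rcases subsingleton_or_nontrivial V with hV | hV
  · have hW : Subsingleton W := by
      rw [← Module.finrank_zero_iff (R := ℂ)]
      rw [Module.finrank_zero_of_subsingleton] at hVW
      exact_mod_cast hVW.symm
    exact ⟨.mk (LinearEquiv.ofSubsingleton V W) fun g => LinearMap.ext fun x => Subsingleton.elim _ _⟩
  -- A non-zero intertwining map splits off a common summand: a complement of the kernel is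
  -- isomorphic to the range. Subtracting its character leaves the kernel and a complement of the
  -- range with equal characters, in smaller dimension.
  obtain ⟨f, hf⟩ := exists_ne_zero_intertwiningMap h
  obtain ⟨U, hU⟩ := exists_isCompl f.ker
  obtain ⟨R, hR⟩ := exists_isCompl f.range
  have hU' := isCompl_toSubmodule hU
  have hR' := isCompl_toSubmodule hR
  let e₁ := isComplEquiv hU'
  let e₂ := isComplEquiv hR'
  have e₃ : U.toRepresentation.Equiv f.range.toRepresentation := by
    refine .mk (LinearEquiv.ofBijective ((f.toLinearMap.domRestrict U.toSubmodule).codRestrict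
      f.range.toSubmodule fun x => ⟨x, rfl⟩) ⟨?_, ?_⟩) fun g => ?_
    · rw [← LinearMap.ker_eq_bot, LinearMap.ker_eq_bot']
      intro x hx
      have h1 : (x : V) ∈ f.ker.toSubmodule := congrArg Subtype.val hx
      exact Subtype.ext (Submodule.disjoint_def.1 hU'.disjoint _ h1 x.2)
    · rintro ⟨y, x, rfl⟩
      obtain ⟨a, ha, b, hb, rfl⟩ := Submodule.mem_sup.1
        (hU'.sup_eq_top ▸ Submodule.mem_top : x ∈ f.ker.toSubmodule ⊔ U.toSubmodule)
      refine ⟨⟨b, hb⟩, Subtype.ext ?_⟩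
      have : f a = 0 := ha
      change f b = f (a + b)
      rw [map_add, this, zero_add]
    · exact LinearMap.ext fun x => Subtype.ext (Representation.IntertwiningMap.isIntertwining _ _ f g x)
  have hchar : f.ker.toRepresentation.character = R.toRepresentation.character := by
    funext g
    have h1 := congrFun (Representation.char_iso e₁) g
    have h2 := congrFun (Representation.char_iso e₂) g
    have h3 := congrFun (Representation.char_iso e₃) g
    rw [char_prod] at h1 h2
    rw [congrFun h g] at h1
    linear_combination h1 - h2 - h3
  have hlt : Module.finrank ℂ f.ker.toSubmodule < n := by
    rw [← hn]
    refine Submodule.finrank_lt fun htop => hf ?_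
    ext x
    exact (htop ▸ Submodule.mem_top : x ∈ f.ker.toSubmodule)
  obtain ⟨e₄⟩ := ih _ hlt hchar rfl
  exact ⟨e₁.symm.trans ((prodEquiv e₄ e₃).trans (.trans (.mk (LinearEquiv.prodComm ℂ _ _)
    fun g => LinearMap.ext fun x => rfl) e₂))⟩

/-- A representation of a finite group is irreducible as soon as there is a non-zero vector that
lies in every non-zero subrepresentation. -/
theorem isIrreducible_of_mem {V : Type*} [AddCommGroup V] [Module ℂ V]
    (ρ : Representation ℂ G V) (v : V) (hv : v ≠ 0)
    (h : ∀ U : Submodule ℂ V, (∀ g, ∀ x ∈ U, ρ g x ∈ U) → ∀ x ∈ U, x ≠ 0 → v ∈ U) :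
    ρ.IsIrreducible := by
  have key : ∀ p : Subrepresentation ρ, p ≠ ⊥ → v ∈ p.toSubmodule := by
    intro p hp
    have : p.toSubmodule ≠ ⊥ := fun h0 => hp (Subrepresentation.toSubmodule_injective h0)
    obtain ⟨x, hx, hx0⟩ := p.toSubmodule.exists_mem_ne_zero_of_ne_bot this
    exact h _ (fun g x hx => p.apply_mem_toSubmodule g hx) x hx hx0
  have hnt : Nontrivial (Subrepresentation ρ) := by
    refine ⟨⊥, ⊤, fun h0 => hv ?_⟩
    have : v ∈ (⊥ : Subrepresentation ρ).toSubmodule := h0 ▸ Submodule.mem_top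
    exact this
  refine { eq_bot_or_eq_top := fun p => ?_ }
  by_contra! hp
  -- By Maschke a proper non-zero subrepresentation has a non-zero complement; both would contain
  -- `v`, although they meet in zero.
  obtain ⟨q, hq⟩ := exists_isCompl p
  have hq0 : q ≠ ⊥ := by
    rintro rfl
    exact hp.2 (by simpa using hq.sup_eq_top)
  exact hv (Submodule.disjoint_def.1 (isCompl_toSubmodule hq).disjoint v (key p hp.1) (key q hq0))

end Representations

/-! ## Character sums on finite abelian groups -/

section Dual

variable {H : Type*} [CommGroup H]

instance dualFintype [Finite H] : Fintype (H →* ℂˣ) := by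
  have : Finite (H →* ℂˣ) := by
    obtain ⟨e⟩ := CommGroup.monoidHom_mulEquiv_of_hasEnoughRootsOfUnity H ℂ
    exact Finite.of_equiv H e.symm.toEquiv
  exact Fintype.ofFinite _

theorem card_dual [Fintype H] : Fintype.card (H →* ℂˣ) = Fintype.card H := by
  rw [← Nat.card_eq_fintype_card, ← Nat.card_eq_fintype_card,
    CommGroup.card_monoidHom_of_hasEnoughRootsOfUnity H ℂ]

open scoped Classical in
/-- Orthogonality: the sum of the values at `x` of all characters. -/
theorem sum_dual [Fintype H] (x : H) :
    ∑ χ : H →* ℂˣ, (χ x : ℂ) = if x = 1 then (Fintype.card H : ℂ) else 0 := by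
  split_ifs with h
  · simp [h, card_dual]
  · obtain ⟨φ, hφ⟩ := CommGroup.exists_apply_ne_one_of_hasEnoughRootsOfUnity H ℂ h
    -- Multiplication by a character with φ(x) ≠ 1 permutes the characters and scales the sum by
    -- φ(x), so the sum vanishes.
    have h1 : ∑ χ : H →* ℂˣ, (χ x : ℂ) = φ x * ∑ χ : H →* ℂˣ, (χ x : ℂ) := by
      rw [Finset.mul_sum, ← Equiv.sum_comp (Equiv.mulLeft φ)]
      simp
    have h2 : (φ x : ℂ) - 1 ≠ 0 := by
      rw [sub_ne_zero, Ne, Units.val_eq_one]; exact hφ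
    refine (mul_eq_zero.1 (?_ : ((φ x : ℂ) - 1) * _ = 0)).resolve_left h2
    linear_combination -h1

open scoped Classical in
/-- Orthogonality: the sum of the values of a character. -/
theorem sum_char [Fintype H] (χ : H →* ℂˣ) :
    ∑ x : H, (χ x : ℂ) = if χ = 1 then (Fintype.card H : ℂ) else 0 := by
  split_ifs with h
  · simp [h]
  · obtain ⟨y, hy⟩ : ∃ y, χ y ≠ 1 := by
      by_contra! h0
      exact h (MonoidHom.ext h0)
    have h1 : ∑ x : H, (χ x : ℂ) = χ y * ∑ x : H, (χ x : ℂ) := by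
      rw [Finset.mul_sum, ← Equiv.sum_comp (Equiv.mulLeft y)]
      simp
    have h2 : (χ y : ℂ) - 1 ≠ 0 := by
      rw [sub_ne_zero, Ne, Units.val_eq_one]; exact hy
    refine (mul_eq_zero.1 (?_ : ((χ y : ℂ) - 1) * _ = 0)).resolve_left h2
    linear_combination -h1

open scoped Classical in
theorem sum_dual_inv [Fintype H] (x : H) :
    ∑ χ : H →* ℂˣ, ((χ x)⁻¹ : ℂ) = if x = 1 then (Fintype.card H : ℂ) else 0 := by
  have h := sum_dual x⁻¹
  simpa using h

end Dual

/-! ## The groups `Eˣ` and `E¹` -/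

section Field

variable {k E : Type*} [Field k] [Fintype k] [Field E] [Fintype E] [Algebra k E]
  [Algebra.IsQuadraticExtension k E]

instance unitsFintype {F : Type*} [Field F] [Fintype F] : Fintype Fˣ := by
  classical infer_instance

instance E1Fintype : Fintype (E1 k E) := Fintype.ofFinite _

theorem conj_ne_zero {x : E} (hx : x ≠ 0) : conj k E x ≠ 0 := by simpa using hx

theorem conj_coe_ne_zero (x : Eˣ) : conj k E (x : E) ≠ 0 := conj_ne_zero x.ne_zero

theorem mem_E1_iff (x : Eˣ) : x ∈ E1 k E ↔ (x : E) * conj k E x = 1 := by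
  rw [mem_E1, conj_mul_self, map_eq_one_iff _ (algebraMap k E).injective]

theorem E1_mul_conj (z : E1 k E) : ((z : Eˣ) : E) * conj k E ((z : Eˣ) : E) = 1 :=
  (mem_E1_iff _).1 z.2

theorem card_units : (Fintype.card Eˣ : ℂ) = (Fintype.card k : ℂ) ^ 2 - 1 := by
  classical
  have h : Fintype.card Eˣ + 1 = Fintype.card k ^ 2 := by
    rw [← card_E (k := k) (E := E), ← Nat.card_eq_fintype_card (α := E),
      ← Nat.card_eq_fintype_card, Nat.card_eq_card_units_add_one E]
  rw [eq_sub_iff_add_eq]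
  exact_mod_cast h

theorem card_base_units : (Fintype.card kˣ : ℂ) = (Fintype.card k : ℂ) - 1 := by
  have h : Fintype.card kˣ + 1 = Fintype.card k := by
    rw [← Nat.card_eq_fintype_card (α := k), ← Nat.card_eq_fintype_card,
      Nat.card_eq_card_units_add_one k]
  rw [eq_sub_iff_add_eq]
  exact_mod_cast h

variable (k) in
theorem card_sub_one_ne_zero : (Fintype.card k : ℂ) - 1 ≠ 0 := by
  rw [sub_ne_zero]
  exact_mod_cast (Fintype.one_lt_card (α := k)).ne'

variable (k) in
theorem card_add_one_ne_zero : (Fintype.card k : ℂ) + 1 ≠ 0 := by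
  exact_mod_cast (Fintype.card k).succ_ne_zero

/-- The norm maps Eˣ onto kˣ with kernel E¹, and (q² - 1) / (q - 1) = q + 1. -/
theorem card_E1 : (Fintype.card (E1 k E) : ℂ) = (Fintype.card k : ℂ) + 1 := by
  classical
  let N : Eˣ →* kˣ := Units.map (Algebra.norm k : E →* k)
  have hs : Function.Surjective N := FiniteField.unitsMap_norm_surjective k E
  have hc : Nat.card (E1 k E) * Nat.card kˣ = Nat.card Eˣ := by
    have h1 := Subgroup.card_mul_index N.ker
    rw [Subgroup.index_ker, MonoidHom.range_eq_top.2 hs, Nat.card_congr Subgroup.topEquiv.toEquiv] at h1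
    exact h1
  rw [Nat.card_eq_fintype_card, Nat.card_eq_fintype_card, Nat.card_eq_fintype_card] at hc
  have hc' : (Fintype.card (E1 k E) : ℂ) * Fintype.card kˣ = Fintype.card Eˣ := by
    exact_mod_cast hc
  rw [card_units (k := k) (E := E), card_base_units] at hc'
  have := card_sub_one_ne_zero k
  apply mul_right_cancel₀ this
  rw [hc']; ring

variable (k E) in
/-- The homomorphism `Eˣ → E¹`, `u ↦ u / ū`. -/
def divConj : Eˣ →* E1 k E :=
  (MonoidHom.id Eˣ / Units.map (conj k E : E →* E)).codRestrict (E1 k E) fun u => by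
    rw [mem_E1_iff]
    have h := conj_coe_ne_zero (k := k) u
    have h' := u.ne_zero
    simp only [MonoidHom.div_apply, MonoidHom.id_apply, Units.val_div_eq_div_val, Units.coe_map,
      MonoidHom.coe_coe, map_div₀, conj_conj]
    field_simp

theorem coe_divConj (u : Eˣ) : ((divConj k E u : Eˣ) : E) = u / conj k E (u : E) := by
  simp [divConj]

theorem divConj_eq_one_iff (u : Eˣ) : divConj k E u = 1 ↔ conj k E (u : E) = u := by
  rw [← Subtype.coe_inj, Units.ext_iff, coe_divConj, OneMemClass.coe_one, Units.val_one,
    div_eq_one_iff_eq (conj_coe_ne_zero u), eq_comm]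

variable [NeZero (2 : k)]

theorem two_ne_zero_of_base (k E : Type*) [Field k] [Field E] [Algebra k E] [NeZero (2 : k)] :
    (2 : E) ≠ 0 := by
  intro h
  apply NeZero.ne (2 : k)
  apply (algebraMap k E).injective
  rw [map_ofNat, map_zero, h]

theorem conj_eq_self_iff (x : E) : conj k E x = x ↔ ∃ c : k, algebraMap k E c = x :=
  ⟨fun h => ⟨_, algebraMap_toBase h⟩, fun ⟨c, hc⟩ => by rw [← hc, AlgHom.commutes]⟩

theorem exists_conj_ne : ∃ x : E, conj k E x ≠ x := by
  by_contra! h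
  have hs : Function.Surjective (algebraMap k E) := fun x => (conj_eq_self_iff x).1 (h x)
  have h1 := Fintype.card_le_of_surjective _ hs
  rw [card_E (k := k)] at h1
  have := Fintype.one_lt_card (α := k)
  nlinarith

/-- Hilbert's Theorem 90 for `E / k`. -/
theorem divConj_surjective : Function.Surjective (divConj k E) := by
  intro z
  have hz := E1_mul_conj z
  -- Any non-zero u = y + zȳ satisfies zū = u because z has norm one. The choice y = 1 works unless
  -- z = -1, and then any y outside k works.
  obtain ⟨y, hy⟩ : ∃ y : E, y + ((z : Eˣ) : E) * conj k E y ≠ 0 := by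
    by_cases h : ((z : Eˣ) : E) = -1
    · obtain ⟨x, hx⟩ := exists_conj_ne (k := k) (E := E)
      refine ⟨x, fun h0 => hx ?_⟩
      rw [h] at h0
      linear_combination -h0
    · refine ⟨1, fun h0 => h ?_⟩
      rw [map_one] at h0
      linear_combination h0
  refine ⟨Units.mk0 _ hy, Subtype.ext (Units.ext ?_)⟩
  rw [coe_divConj, div_eq_iff (conj_coe_ne_zero _), Units.val_mk0, map_add, map_mul, conj_conj]
  linear_combination (-y) * hz

open scoped Classical in
/-- The sum of the values at `x` of all characters of `Eˣ` that are non-trivial on `kˣ`. -/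
theorem sum_dual_nontrivial (x : Eˣ) :
    (∑ χ : Eˣ →* ℂˣ with χ.comp (Units.map (algebraMap k E : k →* E)) ≠ 1, (χ x : ℂ)) =
      (if x = 1 then (Fintype.card k : ℂ) ^ 2 - 1 else 0) -
        (if conj k E (x : E) = x then (Fintype.card k : ℂ) + 1 else 0) := by
  have hq := card_sub_one_ne_zero k
  have h1 : (∑ χ : Eˣ →* ℂˣ with χ.comp (Units.map (algebraMap k E : k →* E)) = 1, (χ x : ℂ)) =
      if conj k E (x : E) = x then (Fintype.card k : ℂ) + 1 else 0 := by
    -- The sum of χ(xc) over c in kˣ is (q - 1)χ(x) if χ is trivial on kˣ and 0 otherwise. This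
    -- trades the condition on χ for a sum over c, and orthogonality over all χ then detects xc = 1,
    -- which is possible only for x in k.
    have h2 : ((Fintype.card k : ℂ) - 1) *
        (∑ χ : Eˣ →* ℂˣ with χ.comp (Units.map (algebraMap k E : k →* E)) = 1, (χ x : ℂ)) =
        ∑ χ : Eˣ →* ℂˣ, ∑ c : kˣ, (χ (x * Units.map (algebraMap k E : k →* E) c) : ℂ) := by
      rw [Finset.sum_filter, Finset.mul_sum]
      refine Finset.sum_congr rfl fun χ _ => ?_
      have h3 := sum_char (χ.comp (Units.map (algebraMap k E : k →* E)))
      rw [card_base_units] at h3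
      simp only [map_mul, Units.val_mul, ← Finset.mul_sum]
      simp only [MonoidHom.comp_apply] at h3
      rw [h3]
      split_ifs <;> ring
    rw [Finset.sum_comm] at h2
    simp only [sum_dual, card_units (k := k)] at h2
    apply mul_left_cancel₀ hq
    rw [h2]
    split_ifs with hx
    · obtain ⟨c, hc⟩ := (conj_eq_self_iff (x : E)).1 hx
      have hc0 : c ≠ 0 := by
        rintro rfl
        exact x.ne_zero (by rw [← hc, map_zero])
      rw [Finset.sum_eq_single (Units.mk0 c hc0)⁻¹]
      · rw [if_pos]
        · ring
        · ext; simp [← hc, hc0]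
      · intro b _ hb
        rw [if_neg]
        intro h
        apply hb
        rw [eq_inv_iff_mul_eq_one, mul_comm]
        ext
        apply (algebraMap k E).injective
        have := congrArg Units.val h
        simpa [← hc] using this
      · simp
    · rw [mul_zero]
      refine Finset.sum_eq_zero fun c _ => if_neg fun h => hx ?_
      rw [mul_eq_one_iff_eq_inv, ← map_inv] at h
      rw [h]
      exact AlgHom.commutes _ _
  have h4 := Finset.sum_filter_add_sum_filter_not Finset.univ
    (fun χ : Eˣ →* ℂˣ => χ.comp (Units.map (algebraMap k E : k →* E)) = 1) fun χ => (χ x : ℂ)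
  rw [h1, sum_dual, card_units (k := k)] at h4
  by_cases hx : x = 1
  · simp only [hx, if_true] at h4 ⊢
    linear_combination h4
  · simp only [hx, if_false] at h4 ⊢
    linear_combination h4

end Field

/-! ## Conjugacy types in `U₂(k)` -/

section Types

variable {k E : Type*} [Field k] [Fintype k] [Field E] [Fintype E] [Algebra k E]
  [Algebra.IsQuadraticExtension k E] [NeZero (2 : k)]

theorem coe_detU (g : U2 k E) : ((detU g : Eˣ) : E) =
    entry g 0 0 * entry g 1 1 - entry g 0 1 * entry g 1 0 := by
  change (g.1.1).det = _
  rw [Matrix.det_fin_two]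

theorem detU_diagU_eq (a : Eˣ) : detU (diagU (k := k) a) = divConj k E a :=
  Subtype.ext (Units.ext (by rw [detU_diagU, coe_divConj, div_eq_mul_inv]))

theorem divConj_E1 (z : E1 k E) : divConj k E z = z * z := by
  refine Subtype.ext (Units.ext ?_)
  have h := E1_mul_conj z
  rw [coe_divConj, div_eq_iff (conj_coe_ne_zero _)]
  push_cast
  linear_combination (-((z : Eˣ) : E)) * h

theorem E1_conj_inv (z : E1 k E) : (conj k E ((z : Eˣ) : E))⁻¹ = ((z : Eˣ) : E) :=
  inv_eq_of_mul_eq_one_left (E1_mul_conj z)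

/-- `x` and `y` are the roots of the characteristic polynomial of `g`. -/
def HasEigenvalues (g : U2 k E) (x y : E) : Prop :=
  entry g 0 0 + entry g 1 1 = x + y ∧ ((detU g : Eˣ) : E) = x * y

theorem hasEigenvalues_diagU (a : Eˣ) :
    HasEigenvalues (diagU (k := k) a) a (conj k E (a : E))⁻¹ :=
  ⟨by rw [diagU_00, diagU_11], by rw [detU_diagU]⟩

theorem hasEigenvalues_scalar (z : E1 k E) :
    HasEigenvalues (diagU (k := k) (z : Eˣ)) (z : Eˣ) (z : Eˣ) := by
  have h := hasEigenvalues_diagU (k := k) (z : Eˣ)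
  rwa [E1_conj_inv] at h

theorem HasEigenvalues.eq_or_eq {g : U2 k E} {x y x' y' : E} (h : HasEigenvalues g x y)
    (h' : HasEigenvalues g x' y') : x' = x ∨ x' = y := by
  have h1 : (x' - x) * (x' - y) = 0 := by
    linear_combination x' * h.1 - h.2 - x' * h'.1 + h'.2
  rcases mul_eq_zero.1 h1 with h2 | h2
  · exact .inl (sub_eq_zero.1 h2)
  · exact .inr (sub_eq_zero.1 h2)

theorem HasEigenvalues.symm {g : U2 k E} {x y : E} (h : HasEigenvalues g x y) :
    HasEigenvalues g y x :=
  ⟨by rw [h.1, add_comm], by rw [h.2, mul_comm]⟩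

theorem HasEigenvalues.ne_scalar {g : U2 k E} {x y : E} (h : HasEigenvalues g x y) (hxy : x ≠ y)
    (z : E1 k E) : g ≠ diagU (k := k) (z : Eˣ) := by
  rintro rfl
  have h1 := (hasEigenvalues_scalar z).eq_or_eq h
  have h2 := (hasEigenvalues_scalar z).eq_or_eq h.symm
  rw [or_self] at h1 h2
  exact hxy (h1.trans h2.symm)

theorem HasEigenvalues.mul_scalar {g : U2 k E} {x y : E} (h : HasEigenvalues g x y)
    (z : E1 k E) : HasEigenvalues (g * diagU (k := k) (z : Eˣ)) (x * (z : Eˣ)) (y * (z : Eˣ)) := by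
  constructor
  · simp only [entry_mul, diagU_00, diagU_01, diagU_10, diagU_11, E1_conj_inv]
    linear_combination ((z : Eˣ) : E) * h.1
  · rw [map_mul, detU_diagU_eq, divConj_E1]
    push_cast
    rw [h.2]; ring

/-- Euler's criterion in E: as q is odd, (q² - 1)/2 is the multiple (q - 1)·(q + 1)/2 of q - 1, so a
non-zero c in k has power 1 at this exponent. -/
theorem isSquare_algebraMap (c : k) : ∃ δ : E, δ * δ = algebraMap k E c := by
  by_cases hc : c = 0
  · exact ⟨0, by simp [hc]⟩
  · have h2 : ringChar E ≠ 2 := by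
      intro h
      have h3 : ((2 : ℕ) : E) = 0 := h ▸ ringChar.Nat.cast_ringChar
      have h4 : algebraMap k E 2 = 0 := by rw [map_ofNat]; exact_mod_cast h3
      exact NeZero.ne (2 : k) (by simpa using h4)
    have hk2 : ringChar k ≠ 2 := by
      intro h
      have h3 : ((2 : ℕ) : k) = 0 := h ▸ ringChar.Nat.cast_ringChar
      exact NeZero.ne (2 : k) (by exact_mod_cast h3)
    have hodd : Fintype.card k % 2 = 1 := FiniteField.odd_card_of_char_ne_two hk2
    have h3 : IsSquare (algebraMap k E c) := by
      rw [FiniteField.isSquare_iff h2 (by simpa using hc), ← map_pow, card_E (k := k)]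
      have : Fintype.card k ^ 2 / 2 = (Fintype.card k - 1) * ((Fintype.card k + 1) / 2) := by
        obtain ⟨m, hm⟩ : ∃ m, Fintype.card k = 2 * m + 1 := ⟨Fintype.card k / 2, by omega⟩
        rw [hm, show (2 * m + 1) ^ 2 = 2 * (2 * m * (m + 1)) + 1 by ring,
          show 2 * m + 1 + 1 = 2 * (m + 1) by ring]
        simp only [Nat.add_sub_cancel]
        rw [Nat.mul_div_cancel_left _ (by norm_num)]
        omega
      rw [this, pow_mul, FiniteField.pow_card_sub_one_eq_one c hc, one_pow, map_one]
    obtain ⟨δ, hδ⟩ := h3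
    exact ⟨δ, hδ.symm⟩

/-- The unitary relation makes g similar to the inverse of its conjugate transpose, so its
eigenvalues are permuted by x ↦ x̄⁻¹. For the trace t and the determinant d this says t̄d = t. -/
theorem conj_trace_mul_det (g : U2 k E) :
    conj k E (entry g 0 0 + entry g 1 1) * ((detU g : Eˣ) : E) = entry g 0 0 + entry g 1 1 := by
  rw [coe_detU, map_add]
  linear_combination entry g 0 0 * rel3 g + entry g 1 0 * rel1 g + entry g 1 1 * rel2 g
    - entry g 0 1 * rel4 g

/-- The possible eigenvalues of an element of `U₂(k)`. -/
theorem exists_hasEigenvalues (g : U2 k E) :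
    (∃ x : Eˣ, x ∉ E1 k E ∧ HasEigenvalues g x (conj k E (x : E))⁻¹) ∨
    ∃ z z' : E1 k E, HasEigenvalues g (z : Eˣ) (z' : Eˣ) := by
  have h2 := two_ne_zero_of_base k E
  -- Writing det g = u/ū by Hilbert 90 makes c = t/u an element of k, since t̄ · det g = t. The
  -- discriminant t² - 4 det g becomes u²(c² - 4/Nm(u)), whose second factor lies in k and hence has
  -- a square root δ in E; the eigenvalues are u(c ± δ)/2.
  obtain ⟨u, hu⟩ := divConj_surjective (detU g)
  have hu0 := u.ne_zero
  have hU0 := conj_coe_ne_zero (k := k) u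
  have hd : ((detU g : Eˣ) : E) * conj k E (u : E) = u := by
    rw [← hu, coe_divConj, div_mul_cancel₀ _ hU0]
  have hd0 := (detU g : Eˣ).ne_zero
  have ht := conj_trace_mul_det g
  generalize hD : ((detU g : Eˣ) : E) = d at *
  generalize hT : entry g 0 0 + entry g 1 1 = t at *
  obtain ⟨c, hc⟩ := (conj_eq_self_iff (k := k) (t / u)).1 (by
    rw [map_div₀, div_eq_div_iff hU0 hu0]
    linear_combination (-conj k E t) * hd + conj k E (u : E) * ht)
  obtain ⟨δ, hδ⟩ := isSquare_algebraMap (E := E) (c ^ 2 - 4 / Algebra.norm k (u : E))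
  have hN : algebraMap k E (Algebra.norm k (u : E)) = u * conj k E (u : E) :=
    (conj_mul_self _).symm
  set x : E := u * (algebraMap k E c + δ) / 2 with hx
  set y : E := u * (algebraMap k E c - δ) / 2 with hy
  have hxy : t = x + y ∧ d = x * y := by
    have h4 : (4 : E) ≠ 0 := by
      rw [show (4 : E) = 2 * 2 by norm_num]; exact mul_ne_zero h2 h2
    have hct : algebraMap k E c * u = t := by rw [hc, div_mul_cancel₀ _ hu0]
    constructor
    · rw [hx, hy, ← hct]; field_simp; ring
    · have : x * y = u ^ 2 * (algebraMap k E c ^ 2 - δ * δ) / 4 := by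
        rw [hx, hy]; field_simp; ring
      rw [this, hδ, map_sub, map_pow, map_div₀, hN, map_ofNat]
      rw [eq_div_iff h4]
      generalize conj k E (u : E) = U at *
      field_simp
      linear_combination 4 * hd
  have hx0 : x ≠ 0 := fun h => hd0 (by rw [hxy.2, h, zero_mul])
  have hy0 : y ≠ 0 := fun h => hd0 (by rw [hxy.2, h, mul_zero])
  have hg : HasEigenvalues g x y := ⟨hT.trans hxy.1, hD.trans hxy.2⟩
  have hcx : conj k E x = conj k E (u : E) * (algebraMap k E c + conj k E δ) / 2 := by
    rw [hx, map_div₀, map_mul, map_add, AlgHom.commutes, map_ofNat]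
  have hcy : conj k E y = conj k E (u : E) * (algebraMap k E c - conj k E δ) / 2 := by
    rw [hy, map_div₀, map_mul, map_sub, AlgHom.commutes, map_ofNat]
  have hδ' : (conj k E δ - δ) * (conj k E δ + δ) = 0 := by
    have := congrArg (conj k E) hδ
    rw [map_mul, AlgHom.commutes, ← hδ] at this
    linear_combination this
  -- As δ² lies in k, δ̄ = ±δ. If δ̄ = δ then x̄ · det g = x, and det g = xy gives y = x̄⁻¹. If δ̄ =
  -- -δ then x̄ · det g = y and ȳ · det g = x, so both eigenvalues have norm one.
  rcases mul_eq_zero.1 hδ' with h | h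
  · have h1 : conj k E x * d = x := by
      rw [hcx, sub_eq_zero.1 h]
      rw [hx]
      linear_combination (algebraMap k E c + δ) / 2 * hd
    have h3 : y = (conj k E x)⁻¹ := by
      apply eq_inv_of_mul_eq_one_right
      apply mul_left_cancel₀ hx0
      linear_combination h1 - conj k E x * hxy.2
    by_cases hxE : Units.mk0 x hx0 ∈ E1 k E
    · right
      refine ⟨⟨_, hxE⟩, ⟨_, hxE⟩, ?_⟩
      have h4 := E1_conj_inv (⟨_, hxE⟩ : E1 k E)
      simp only [Units.val_mk0] at h4 ⊢
      rwa [h3, h4] at hg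
    · left
      refine ⟨_, hxE, ?_⟩
      rw [Units.val_mk0, ← h3]
      exact hg
  · have h' : conj k E δ = -δ := eq_neg_of_add_eq_zero_left h
    have h1 : conj k E x * d = y := by
      rw [hcx, h', hy]
      linear_combination (algebraMap k E c - δ) / 2 * hd
    have h3 : conj k E y * d = x := by
      rw [hcy, h', hx]
      linear_combination (algebraMap k E c + δ) / 2 * hd
    right
    refine ⟨⟨Units.mk0 x hx0, (mem_E1_iff _).2 ?_⟩, ⟨Units.mk0 y hy0, (mem_E1_iff _).2 ?_⟩, hg⟩
    · apply mul_left_cancel₀ hy0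
      rw [Units.val_mk0]
      linear_combination h1 - conj k E x * hxy.2
    · apply mul_left_cancel₀ hx0
      rw [Units.val_mk0]
      linear_combination h3 - conj k E y * hxy.2

/-- A property of elements of `U₂(k)` may be checked on the four types of elements. -/
theorem type_induction {p : U2 k E → Prop}
    (scalar : ∀ z : E1 k E, p (diagU (z : Eˣ)))
    (unip : ∀ (g : U2 k E) (z : E1 k E), (∀ z' : E1 k E, g ≠ diagU (z' : Eˣ)) →
      HasEigenvalues g (z : Eˣ) (z : Eˣ) → p g)
    (split : ∀ (g : U2 k E) (x : Eˣ), x ∉ E1 k E →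
      HasEigenvalues g x (conj k E (x : E))⁻¹ → p g)
    (aniso : ∀ (g : U2 k E) (z z' : E1 k E), z ≠ z' →
      HasEigenvalues g (z : Eˣ) (z' : Eˣ) → p g) (g : U2 k E) : p g := by
  by_cases hs : ∃ z : E1 k E, g = diagU (z : Eˣ)
  · obtain ⟨z, rfl⟩ := hs
    exact scalar z
  push Not at hs
  rcases exists_hasEigenvalues g with ⟨x, hx, h⟩ | ⟨z, z', h⟩
  · exact split g x hx h
  · by_cases hz : z = z'
    · subst hz
      exact unip g z hs h
    · exact aniso g z z' hz h

theorem conj_inv_ne_self {x : Eˣ} (hx : x ∉ E1 k E) : (x : E) ≠ (conj k E (x : E))⁻¹ := by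
  intro h
  apply hx
  rw [mem_E1_iff]
  nth_rewrite 1 [h]
  exact inv_mul_cancel₀ (conj_coe_ne_zero x)

/-- There are elements of `U₂(k)` with any two given eigenvalues of norm one. -/
theorem exists_aniso (z z' : E1 k E) :
    ∃ g : U2 k E, HasEigenvalues g (z : Eˣ) (z' : Eˣ) := by
  obtain ⟨u, hu⟩ := divConj_surjective (z * z')
  have hu0 := u.ne_zero
  have hU0 := conj_coe_ne_zero (k := k) u
  have hz := E1_mul_conj z
  have hz' := E1_mul_conj z'
  have hd : ((z : Eˣ) : E) * ((z' : Eˣ) : E) * conj k E (u : E) = u := by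
    have h := coe_divConj (k := k) u
    rw [hu] at h
    push_cast at h
    rw [h, div_mul_cancel₀ _ hU0]
  -- A rescaled companion matrix: its trace is z + z' and its determinant u/ū = zz', and the choice
  -- of u by Hilbert 90 makes it unitary.
  refine ⟨mkU2 0 (-(conj k E (u : E))⁻¹) u (((z : Eˣ) : E) + ((z' : Eˣ) : E)) ?_ ?_ ?_ ?_ ?_,
    ?_, ?_⟩
  · simp
  · simp
  · rw [zero_mul, zero_sub, neg_mul, neg_neg, inv_mul_cancel₀ hU0]
  · rw [map_zero, mul_zero, zero_sub, map_neg, map_inv₀, conj_conj, mul_neg, neg_neg,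
      mul_inv_cancel₀ hu0]
  · rw [map_add]
    linear_combination (-(conj k E ((z : Eˣ) : E) + conj k E ((z' : Eˣ) : E))) * hd
      + conj k E (u : E) * (((z' : Eˣ) : E) * hz + ((z : Eˣ) : E) * hz')
  · exact zero_add _
  · rw [coe_detU]
    change 0 * _ - (-(conj k E (u : E))⁻¹) * (u : E) = _
    rw [zero_mul, zero_sub, neg_mul, neg_neg, inv_mul_eq_iff_eq_mul₀ hU0]
    linear_combination -hd

end Types

/-! ## Traces -/

section Trace

theorem trace_pi {X : Type*} [Fintype X] [DecidableEq X] (T : (X → ℂ) →ₗ[ℂ] (X → ℂ)) :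
    LinearMap.trace ℂ (X → ℂ) T = ∑ x, T (Pi.single x 1) x := by
  rw [LinearMap.trace_eq_matrix_trace ℂ (Pi.basisFun ℂ X), Matrix.trace]
  refine Finset.sum_congr rfl fun x _ => ?_
  simp

/-- The trace on an invariant subspace, computed by means of a projection onto the subspace. -/
theorem trace_restrict_eq {V : Type*} [AddCommGroup V] [Module ℂ V] [FiniteDimensional ℂ V]
    {p : Submodule ℂ V} (T P : V →ₗ[ℂ] V) (hT : ∀ x ∈ p, T x ∈ p) (hP : ∀ x, P x ∈ p)
    (hP' : ∀ x ∈ p, P x = x) :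
    LinearMap.trace ℂ p (T.restrict hT) = LinearMap.trace ℂ V (T * P) := by
  -- Since T preserves p and P is the identity there, applying P after T changes nothing on p;
  -- cyclicity then moves P to the other side.
  have h : T.restrict hT = P.codRestrict p hP ∘ₗ (T ∘ₗ p.subtype) := by
    refine LinearMap.ext fun x => Subtype.ext ?_
    exact (hP' _ (hT x x.2)).symm
  rw [h, LinearMap.trace_comp_comm']
  rfl

theorem char_ofChar {G : Type*} [Group G] (c : G →* ℂˣ) (g : G) :
    (ofChar c).character g = c g := by
  change LinearMap.trace ℂ ℂ ((c g : ℂ) • LinearMap.id) = _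
  rw [map_smul, LinearMap.trace_id]
  simp

theorem char_twist {G V : Type*} [Group G] [AddCommGroup V] [Module ℂ V] (c : G →* ℂˣ)
    (ρ : Representation ℂ G V) (g : G) :
    (twist c ρ).character g = c g * ρ.character g := by
  change LinearMap.trace ℂ V ((c g : ℂ) • ρ g) = _
  rw [map_smul, smul_eq_mul]
  rfl

end Trace

/-! ## The characters of the representations -/

section Char

variable {k E : Type*} [Field k] [Fintype k] [Field E] [Fintype E] [Algebra k E]
  [Algebra.IsQuadraticExtension k E] [NeZero (2 : k)]

theorem char_charRep (η : E1 k E →* ℂˣ) (g : U2 k E) :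
    (charRep η).character g = η (detU g) :=
  char_ofChar _ _

open scoped Classical in
theorem sum_psi_norm {ψ : AddChar k ℂ} (hψ : ψ ≠ 1) (s : k) :
    ∑ y : E, ψ (s * Algebra.norm k y) =
      if s = 0 then (Fintype.card k : ℂ) ^ 2 else -(Fintype.card k : ℂ) := by
  split_ifs with h
  · simp [h, card_E (k := k) (E := E)]
  · exact gauss hψ h

open scoped Classical in
-- A point mass at x contributes to the trace only if ax = x. For a ≠ 1 this leaves x = 0; for a = 1
-- the trace is a Gauss sum of the norm form.
theorem trace_opN_opM {ψ : AddChar k ℂ} (hψ : ψ ≠ 1) (s : k) (a : E) :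
    LinearMap.trace ℂ (E → ℂ) (opN ψ s * opM a) =
      if a = 1 then (if s = 0 then (Fintype.card k : ℂ) ^ 2 else -(Fintype.card k : ℂ)) else 1 := by
  rw [trace_pi]
  simp only [Module.End.mul_apply, opN_apply, opM_apply]
  split_ifs with ha hs
  · simp [ha, hs, card_E (k := k) (E := E)]
  · simp [ha, gauss hψ hs]
  · rw [Finset.sum_eq_single 0]
    · simp
    · intro x _ hx
      rw [Pi.single_eq_of_ne, mul_zero]
      intro h
      exact ha (mul_right_cancel₀ hx (by rw [h, one_mul]))
    · simp

open scoped Classical in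
-- The dilation moves the point mass at x to a⁻¹x, so the Fourier kernel contributes ψ(Tr(a⁻¹)
-- Nm(x)). The diagonal entry at x is thus -q⁻¹ψ(τ Nm(x)) with τ = s + r + Tr(a⁻¹), and summing over
-- x gives a Gauss sum.
theorem trace_opN_opW_opM_opN {ψ : AddChar k ℂ} (hψ : ψ ≠ 1) (s r : k) {a : E} (ha : a ≠ 0) :
    LinearMap.trace ℂ (E → ℂ) (opN ψ s * opW ψ * opM a * opN ψ r) =
      if s + r + Algebra.trace k E a⁻¹ = 0 then -(Fintype.card k : ℂ) else 1 := by
  have hq : (Fintype.card k : ℂ) ≠ 0 := by simp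
  rw [trace_pi]
  have h : ∀ x : E, ((opN ψ s * opW ψ * opM a * opN ψ r : (E → ℂ) →ₗ[ℂ] (E → ℂ))) (Pi.single x 1) x =
      -(Fintype.card k : ℂ)⁻¹ * ψ ((s + r + Algebra.trace k E a⁻¹) * Algebra.norm k x) := by
    intro x
    simp only [Module.End.mul_apply, opN_apply, opM_apply, opW_apply]
    rw [Finset.sum_eq_single (a⁻¹ * x)]
    · rw [mul_inv_cancel_left₀ ha, Pi.single_eq_same]
      have e : Algebra.trace k E (conj k E (a⁻¹ * x) * x) =
          Algebra.trace k E a⁻¹ * Algebra.norm k x := by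
        rw [← trace_conj a⁻¹, map_mul (conj k E), mul_assoc, mul_comm (conj k E x), conj_mul_self,
          mul_comm, ← Algebra.smul_def, map_smul, smul_eq_mul, mul_comm]
      rw [e, add_mul, add_mul, AddChar.map_add_eq_mul, AddChar.map_add_eq_mul]
      ring
    · intro y _ hy
      rw [Pi.single_eq_of_ne, mul_zero, mul_zero]
      intro h
      exact hy (by rw [← h, inv_mul_cancel_left₀ ha])
    · simp
  simp only [h, ← Finset.mul_sum, sum_psi_norm hψ]
  split_ifs
  · field_simp
  · field_simp

theorem diagU_one : diagU (k := k) (1 : Eˣ) = 1 := by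
  apply ext_entry <;> simp [entry_one]

open scoped Classical in
/-- The character of the Weil representation. -/
theorem char_weil {ψ : AddChar k ℂ} (hψ : ψ ≠ 1) {g : U2 k E} {x y : E}
    (h : HasEigenvalues g x y) :
    (weil ψ hψ).character g = if g = 1 then (Fintype.card k : ℂ) ^ 2 else
      if x = 1 ∨ y = 1 then -(Fintype.card k : ℂ) else 1 := by
  -- The number 1 is an eigenvalue exactly when the characteristic polynomial 1 - t + d vanishes
  -- there; this form needs no explicit eigenvalues.
  have hxy : x = 1 ∨ y = 1 ↔ 1 + ((detU g : Eˣ) : E) = entry g 0 0 + entry g 1 1 := by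
    rw [h.1, h.2, ← sub_eq_zero (a := x), ← sub_eq_zero (a := y), ← mul_eq_zero, ← sub_eq_zero (a := 1 + x * y)]
    ring_nf
  have hdet := coe_detU g
  change LinearMap.trace ℂ _ (weilOp ψ g) = _
  by_cases hc : entry g 1 0 = 0
  · rw [weilOp_of_eq _ _ hc, trace_opN_opM hψ]
    have h3 := rel3 g
    rw [hc, zero_mul, sub_zero] at h3
    have hb : algebraMap k E (toBase (entry g 0 1 * conj k E (entry g 0 0))) =
        entry g 0 1 * conj k E (entry g 0 0) := by
      apply algebraMap_toBase
      rw [map_mul, conj_conj, mul_comm, rel1]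
    by_cases ha : entry g 0 0 = 1
    · have hd : entry g 1 1 = 1 := by rw [ha, map_one, mul_one] at h3; exact h3
      rw [if_pos ha]
      rw [ha, map_one, mul_one] at hb
      have hg : toBase (entry g 0 1 * conj k E (entry g 0 0)) = (0 : k) ↔ g = 1 := by
        rw [ha, map_one, mul_one]
        constructor
        · intro h0
          rw [h0, map_zero] at hb
          apply ext_entry <;> simp [entry_one, ha, hc, hd, ← hb]
        · rintro rfl
          simp [entry_one, toBase]
      have h1 : x = 1 ∨ y = 1 := by
        rw [hxy, hdet, ha, hd, hc]; ring
      simp only [hg, h1, if_true]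
    · have h1 : ¬ (x = 1 ∨ y = 1) := by
        rw [hxy, hdet, hc]
        intro h0
        have hA : entry g 0 0 ≠ 0 := by
          intro h0; rw [h0, map_zero, mul_zero] at h3; exact zero_ne_one h3
        have h4 : (entry g 0 0 - 1) * (entry g 1 1 - 1) = 0 := by linear_combination h0
        rcases mul_eq_zero.1 h4 with h5 | h5
        · exact ha (sub_eq_zero.1 h5)
        · rw [sub_eq_zero.1 h5, one_mul] at h3
          rw [← conj_conj (k := k) (entry g 0 0), h3, map_one] at ha
          exact ha rfl
      have hg : g ≠ 1 := by
        rintro rfl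
        simp [entry_one] at ha
      rw [if_neg ha, if_neg hg, if_neg h1]
  · have hC := conj_ne_zero (k := k) hc
    have hg : g ≠ 1 := by
      rintro rfl
      simp [entry_one] at hc
    rw [weilOp_of_ne _ _ hc, trace_opN_opW_opM_opN hψ _ _ (neg_ne_zero.2 hc), if_neg hg]
    refine if_congr ?_ rfl rfl
    rw [hxy]
    have hs : algebraMap k E (toBase (entry g 0 0 / entry g 1 0)) = entry g 0 0 / entry g 1 0 := by
      apply algebraMap_toBase
      rw [map_div₀, div_eq_div_iff hC hc]
      linear_combination rel5 g
    have hr : algebraMap k E (toBase (entry g 1 1 / entry g 1 0)) = entry g 1 1 / entry g 1 0 := by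
      apply algebraMap_toBase
      rw [map_div₀, div_eq_div_iff hC hc]
      linear_combination rel4 g
    have hdet' : ((detU g : Eˣ) : E) = entry g 1 0 / conj k E (entry g 1 0) := by
      rw [hdet, eq_div_iff hC]
      linear_combination entry g 1 0 * rel2 g - entry g 0 0 * rel4 g
    -- With c the lower left entry and det g = c/c̄, the quantity a/c + d/c - 1/c - 1/c̄ is (trace -
    -- 1 - det)/c.
    rw [← map_eq_zero (algebraMap k E), map_add, map_add, hs, hr, ← add_conj, map_inv₀, map_neg,
      hdet']
    generalize conj k E (entry g 1 0) = C at *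
    field_simp
    constructor <;> intro h0 <;> linear_combination -h0

theorem diagU_mul (a b : Eˣ) : diagU (k := k) (a * b) = diagU a * diagU b := by
  apply ext_entry <;>
    simp only [entry_mul, diagU_00, diagU_01, diagU_10, diagU_11, Units.val_mul, map_mul, mul_inv] <;>
    ring

open scoped Classical in
/-- The character of `ω_{ψ,μ,η}` as a sum over the centre. -/
theorem char_cusp_eq_sum {ψ : AddChar k ℂ} (hψ : ψ ≠ 1) (μ η : E1 k E →* ℂˣ) (g : U2 k E) :
    (cusp ψ hψ μ η).character g = η (detU g) * (((Fintype.card k : ℂ) + 1)⁻¹ *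
      ∑ z : E1 k E, (μ z : ℂ) * (weil ψ hψ).character (g * diagU (z : Eˣ))) := by
  rw [cusp, char_twist]
  congr 1
  -- The projection onto W(μ), obtained by averaging over the centre E¹. Its summands are Weil
  -- operators of scalars, so the trace on W(μ) becomes a sum of Weil characters at central
  -- translates of g.
  let P : (E → ℂ) →ₗ[ℂ] (E → ℂ) := ((Fintype.card k : ℂ) + 1)⁻¹ •
    ∑ z : E1 k E, (μ z : ℂ) • weil ψ hψ (diagU (z : Eˣ))
  have hPapply : ∀ f x, P f x = ((Fintype.card k : ℂ) + 1)⁻¹ *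
      ∑ z : E1 k E, (μ z : ℂ) * f ((z : Eˣ) * x) := by
    intro f x
    simp only [P, LinearMap.smul_apply, LinearMap.sum_apply, Pi.smul_apply, Finset.sum_apply,
      smul_eq_mul]
    congr 1
    exact Finset.sum_congr rfl fun z _ => by rw [weil_diag]
  refine (trace_restrict_eq (weil ψ hψ g) P (fun _ hf => weil_mem ψ hψ g hf) ?_ ?_).trans ?_
  · intro f y x
    rw [hPapply, hPapply, mul_left_comm]
    congr 1
    rw [Finset.mul_sum, ← Equiv.sum_comp (Equiv.mulRight y⁻¹)]
    refine Finset.sum_congr rfl fun z _ => ?_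
    simp [← mul_assoc]
    exact .inl (by ring)
  · intro f hf
    funext x
    rw [hPapply]
    have : ∀ z : E1 k E, (μ z : ℂ) * f ((z : Eˣ) * x) = f x := by
      intro z
      rw [hf z x]
      simp
    simp only [this, Finset.sum_const, Finset.card_univ, nsmul_eq_mul, card_E1]
    rw [inv_mul_cancel_left₀ (card_add_one_ne_zero k)]
  · simp only [P, mul_smul_comm, Finset.mul_sum, map_smul, map_sum, smul_eq_mul]
    refine Finset.sum_congr rfl fun z _ => ?_
    rw [← map_mul]
    rfl

theorem scalar_injective {z z' : E1 k E}
    (h : diagU (k := k) (z : Eˣ) = diagU (k := k) (z' : Eˣ)) : z = z' := by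
  have := congrArg (fun g : U2 k E => entry g 0 0) h
  exact Subtype.ext (Units.ext this)

theorem E1_coe_eq_one_iff (z : E1 k E) : ((z : Eˣ) : E) = 1 ↔ z = 1 := by simp

open scoped Classical in
-- Writing the value as a constant plus a multiple of an indicator prepares the sum against μ over
-- the centre: for μ ≠ 1 the constant cancels and the indicator selects one translate.
theorem char_weil_scalar {ψ : AddChar k ℂ} (hψ : ψ ≠ 1) (z : E1 k E) :
    (weil ψ hψ).character (diagU (z : Eˣ)) =
      1 + ((Fintype.card k : ℂ) ^ 2 - 1) * if z = 1 then 1 else 0 := by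
  rw [char_weil hψ (hasEigenvalues_scalar z)]
  by_cases h : z = 1
  · simp [h, diagU_one]
  · have h1 : diagU (k := k) (z : Eˣ) ≠ 1 := by
      rw [← diagU_one]
      intro h0
      exact h (scalar_injective (z' := 1) h0)
    simp [h, h1]

open scoped Classical in
theorem char_weil_unip {ψ : AddChar k ℂ} (hψ : ψ ≠ 1) {g : U2 k E} {z : E1 k E}
    (hg : ∀ z' : E1 k E, g ≠ diagU (z' : Eˣ)) (h : HasEigenvalues g (z : Eˣ) (z : Eˣ)) :
    (weil ψ hψ).character g = 1 - ((Fintype.card k : ℂ) + 1) * if z = 1 then 1 else 0 := by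
  have h1 : g ≠ 1 := by
    have := hg 1
    rwa [OneMemClass.coe_one, diagU_one] at this
  rw [char_weil hψ h, if_neg h1]
  simp only [E1_coe_eq_one_iff, or_self]
  split_ifs <;> ring

theorem char_weil_split {ψ : AddChar k ℂ} (hψ : ψ ≠ 1) {g : U2 k E} {x : Eˣ} (hx : x ∉ E1 k E)
    (h : HasEigenvalues g x (conj k E (x : E))⁻¹) : (weil ψ hψ).character g = 1 := by
  have hx1 : (x : E) ≠ 1 := by
    intro h0
    exact hx ((Units.val_eq_one.1 h0).symm ▸ one_mem _)
  have hx2 : (conj k E (x : E))⁻¹ ≠ 1 := by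
    intro h0
    rw [inv_eq_one] at h0
    apply hx1
    rw [← conj_conj (k := k) (x : E), h0, map_one]
  have h1 : g ≠ 1 := by
    have := h.ne_scalar (conj_inv_ne_self hx) 1
    rwa [OneMemClass.coe_one, diagU_one] at this
  rw [char_weil hψ h, if_neg h1, if_neg (by simp only [hx1, hx2, or_self, not_false_iff])]

open scoped Classical in
theorem char_weil_aniso {ψ : AddChar k ℂ} (hψ : ψ ≠ 1) {g : U2 k E} {z z' : E1 k E}
    (hz : z ≠ z') (h : HasEigenvalues g (z : Eˣ) (z' : Eˣ)) :
    (weil ψ hψ).character g = 1 - ((Fintype.card k : ℂ) + 1) *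
      ((if z = 1 then 1 else 0) + if z' = 1 then 1 else 0) := by
  have h1 : g ≠ 1 := by
    have := h.ne_scalar (fun h => hz (Subtype.ext (Units.ext h))) 1
    rwa [OneMemClass.coe_one, diagU_one] at this
  rw [char_weil hψ h, if_neg h1]
  simp only [E1_coe_eq_one_iff]
  by_cases h2 : z = 1
  · have h3 : z' ≠ 1 := fun h3 => hz (h2.trans h3.symm)
    simp [h2, h3]
  · by_cases h3 : z' = 1 <;> simp [h2, h3]

theorem sum_char_of_ne_one {H : Type*} [CommGroup H] [Fintype H] {χ : H →* ℂˣ} (h : χ ≠ 1) :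
    ∑ x : H, (χ x : ℂ) = 0 := by
  classical
  rw [sum_char, if_neg h]

variable {ψ : AddChar k ℂ} (hψ : ψ ≠ 1) {μ : E1 k E →* ℂˣ} (η : E1 k E →* ℂˣ)

/-- Only the translate by w = z⁻¹ survives the average, and (q² - 1)/(q + 1) = q - 1. -/
theorem char_cusp_scalar (hμ : μ ≠ 1) (z : E1 k E) :
    (cusp ψ hψ μ η).character (diagU (z : Eˣ)) =
      ((Fintype.card k : ℂ) - 1) * (η (z * z) * (μ z : ℂ)⁻¹) := by
  classical
  have hq := card_add_one_ne_zero k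
  rw [char_cusp_eq_sum, detU_diagU_eq, divConj_E1]
  have h : ∀ w : E1 k E, (μ w : ℂ) * (weil ψ hψ).character (diagU (z : Eˣ) * diagU (w : Eˣ)) =
      μ w + ((Fintype.card k : ℂ) ^ 2 - 1) * if w = z⁻¹ then (μ w : ℂ) else 0 := by
    intro w
    have e : ∀ u : E1 k E, u * w = 1 ↔ w = u⁻¹ := fun u => by rw [mul_eq_one_iff_inv_eq, eq_comm]
    rw [← diagU_mul, ← Subgroup.coe_mul, char_weil_scalar hψ]
    simp only [e]
    split_ifs <;> ring
  simp only [h, Finset.sum_add_distrib, ← Finset.mul_sum, sum_char_of_ne_one hμ,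
    Finset.sum_ite_eq', Finset.mem_univ, if_true, map_inv, Units.val_inv_eq_inv_val]
  field_simp
  ring

theorem char_cusp_unip (hμ : μ ≠ 1) {g : U2 k E} {z : E1 k E} (hg : ∀ z' : E1 k E, g ≠ diagU (z' : Eˣ))
    (h : HasEigenvalues g (z : Eˣ) (z : Eˣ)) :
    (cusp ψ hψ μ η).character g = -(η (detU g) * (μ z : ℂ)⁻¹) := by
  classical
  have hq := card_add_one_ne_zero k
  rw [char_cusp_eq_sum]
  have h : ∀ w : E1 k E, (μ w : ℂ) * (weil ψ hψ).character (g * diagU (w : Eˣ)) =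
      μ w - ((Fintype.card k : ℂ) + 1) * if w = z⁻¹ then (μ w : ℂ) else 0 := by
    intro w
    have e : ∀ u : E1 k E, u * w = 1 ↔ w = u⁻¹ := fun u => by rw [mul_eq_one_iff_inv_eq, eq_comm]
    rw [char_weil_unip hψ (z := z * w)]
    · simp only [e]
      split_ifs <;> ring
    · intro z' hz'
      apply hg (z' * w⁻¹)
      rw [Subgroup.coe_mul, diagU_mul, ← hz', mul_assoc, ← diagU_mul, ← Subgroup.coe_mul,
        mul_inv_cancel, OneMemClass.coe_one, diagU_one, mul_one]
    · exact h.mul_scalar w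
  simp only [h, Finset.sum_sub_distrib, ← Finset.mul_sum, sum_char_of_ne_one hμ,
    Finset.sum_ite_eq', Finset.mem_univ, if_true, map_inv, Units.val_inv_eq_inv_val]
  field_simp
  ring

/-- Every central translate of a split element is split, so the Weil character is 1 on all of them
and the average against μ ≠ 1 vanishes. -/
theorem char_cusp_split (hμ : μ ≠ 1) {g : U2 k E} {x : Eˣ} (hx : x ∉ E1 k E)
    (h : HasEigenvalues g x (conj k E (x : E))⁻¹) :
    (cusp ψ hψ μ η).character g = 0 := by
  rw [char_cusp_eq_sum]
  have h : ∀ w : E1 k E, (μ w : ℂ) * (weil ψ hψ).character (g * diagU (w : Eˣ)) = μ w := by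
    intro w
    have hw := h.mul_scalar w
    rw [char_weil_split hψ (x := x * (w : Eˣ)), mul_one]
    · rwa [Subgroup.mul_mem_cancel_right _ w.2]
    · rw [Units.val_mul, map_mul, mul_inv, E1_conj_inv]
      exact hw
  simp only [h, sum_char_of_ne_one hμ, mul_zero]

/-- Exactly two central translates, by z⁻¹ and by z'⁻¹, have 1 as an eigenvalue; each contributes
one term. -/
theorem char_cusp_aniso (hμ : μ ≠ 1) {g : U2 k E} {z z' : E1 k E} (hz : z ≠ z')
    (h : HasEigenvalues g (z : Eˣ) (z' : Eˣ)) :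
    (cusp ψ hψ μ η).character g = -(η (detU g) * ((μ z : ℂ)⁻¹ + (μ z' : ℂ)⁻¹)) := by
  classical
  have hq := card_add_one_ne_zero k
  rw [char_cusp_eq_sum]
  have h : ∀ w : E1 k E, (μ w : ℂ) * (weil ψ hψ).character (g * diagU (w : Eˣ)) =
      μ w - ((Fintype.card k : ℂ) + 1) * ((if w = z⁻¹ then (μ w : ℂ) else 0) +
        if w = z'⁻¹ then (μ w : ℂ) else 0) := by
    intro w
    have e : ∀ u : E1 k E, u * w = 1 ↔ w = u⁻¹ := fun u => by rw [mul_eq_one_iff_inv_eq, eq_comm]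
    rw [char_weil_aniso hψ (z := z * w) (z' := z' * w)]
    · simp only [e]
      split_ifs <;> ring
    · exact fun h => hz (mul_right_cancel h)
    · exact h.mul_scalar w
  simp only [h, Finset.sum_sub_distrib, ← Finset.mul_sum, sum_char_of_ne_one hμ,
    Finset.sum_add_distrib,
    Finset.sum_ite_eq', Finset.mem_univ, if_true, map_inv, Units.val_inv_eq_inv_val]
  field_simp
  ring

theorem detU_of_hasEigenvalues {g : U2 k E} {z z' : E1 k E}
    (h : HasEigenvalues g (z : Eˣ) (z' : Eˣ)) : detU g = z * z' :=
  Subtype.ext (Units.ext h.2)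

theorem detU_of_split {g : U2 k E} {x : Eˣ}
    (h : HasEigenvalues g x (conj k E (x : E))⁻¹) : detU g = divConj k E x :=
  Subtype.ext (Units.ext (by rw [h.2, coe_divConj, div_eq_mul_inv]))

end Char

/-! ## The principal series -/

section PrincipalSeries

variable {k E : Type*} [Field k] [Fintype k] [Field E] [Fintype E] [Algebra k E]
  [Algebra.IsQuadraticExtension k E] [NeZero (2 : k)]

theorem mem_PSSpace (χ : Eˣ →* ℂˣ) (f : U2 k E → ℂ) : f ∈ PSSpace (k := k) χ ↔
    ∀ (b : borel k E) (g : U2 k E), f (b * g) = χ (borelDiag b) * f g :=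
  Iff.rfl

theorem PSSpace_unipU_mul {χ : Eˣ →* ℂˣ} {f : U2 k E → ℂ} (hf : f ∈ PSSpace (k := k) χ) (s : k)
    (g : U2 k E) : f (unipU s * g) = f g := by
  have h := (mem_PSSpace χ f).1 hf ⟨unipU s, unipU_10 s⟩ g
  have h1 : borelDiag (⟨unipU s, unipU_10 s⟩ : borel k E) = 1 := Units.ext (unipU_00 s)
  rwa [h1, map_one, Units.val_one, one_mul] at h

theorem PSSpace_diagU_mul {χ : Eˣ →* ℂˣ} {f : U2 k E → ℂ} (hf : f ∈ PSSpace (k := k) χ) (a : Eˣ)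
    (g : U2 k E) : f (diagU a * g) = χ a * f g := by
  have h := (mem_PSSpace χ f).1 hf ⟨diagU a, diagU_10 a⟩ g
  have h1 : borelDiag (⟨diagU a, diagU_10 a⟩ : borel k E) = a := Units.ext (diagU_00 a)
  rwa [h1] at h

theorem wU_mul_diagU (a : Eˣ) :
    wU k E * diagU a = diagU (Units.map (conj k E : E →* E) a)⁻¹ * wU k E := by
  apply ext_entry <;>
    simp only [entry_mul, diagU_00, diagU_01, diagU_10, diagU_11, wU_00, wU_01, wU_10, wU_11,
      Units.val_inv_eq_inv_val, Units.coe_map, MonoidHom.coe_coe, map_inv₀, conj_conj, inv_inv] <;>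
    ring

theorem PSSpace_wU_mul_diagU_mul {χ : Eˣ →* ℂˣ} {f : U2 k E → ℂ} (hf : f ∈ PSSpace (k := k) χ)
    (a : Eˣ) (g : U2 k E) : f (wU k E * (diagU a * g)) = conjInv k χ a * f (wU k E * g) := by
  rw [← mul_assoc, wU_mul_diagU, mul_assoc, PSSpace_diagU_mul hf, map_inv]
  rfl

/-- By the Bruhat decomposition, 1 and the elements w (1, r; 0, 1) represent all cosets of the Borel
subgroup, that is, the points ∞ and r of the projective line over k. -/
theorem PSSpace_ext {χ : Eˣ →* ℂˣ} {f f' : U2 k E → ℂ} (hf : f ∈ PSSpace (k := k) χ)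
    (hf' : f' ∈ PSSpace (k := k) χ) (h1 : f 1 = f' 1)
    (hw : ∀ r : k, f (wU k E * unipU r) = f' (wU k E * unipU r)) : f = f' := by
  funext g
  rcases bruhat g with ⟨a, s, rfl⟩ | ⟨a, s, r, rfl⟩
  · rw [PSSpace_unipU_mul hf, PSSpace_unipU_mul hf', ← mul_one (diagU a), PSSpace_diagU_mul hf,
      PSSpace_diagU_mul hf', h1]
  · rw [PSSpace_unipU_mul hf, PSSpace_unipU_mul hf', PSSpace_wU_mul_diagU_mul hf,
      PSSpace_wU_mul_diagU_mul hf', hw]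

open scoped Classical in
/-- The function in `I(χ)` with prescribed values at `1` and at the elements `w (1, r; 0, 1)`. -/
def psExtend (χ : Eˣ →* ℂˣ) (v : Option k → ℂ) (g : U2 k E) : ℂ :=
  if entry g 1 0 = 0 then MulChar.ofUnitHom χ (entry g 0 0) * v none
  else (MulChar.ofUnitHom χ (conj k E (-entry g 1 0)))⁻¹ *
    v (some (toBase (entry g 1 1 / entry g 1 0)))

theorem psExtend_mem (χ : Eˣ →* ℂˣ) (v : Option k → ℂ) :
    psExtend χ v ∈ PSSpace (k := k) χ := by
  rw [mem_PSSpace]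
  rintro b g
  have hb : entry b.1 1 0 = 0 := b.2
  have h3 := rel3 b.1
  rw [hb, zero_mul, sub_zero] at h3
  have hd : entry b.1 1 1 ≠ 0 := by
    intro h0; rw [h0, zero_mul] at h3; exact zero_ne_one h3
  have e10 : entry (b.1 * g) 1 0 = entry b.1 1 1 * entry g 1 0 := by
    rw [entry_mul, hb, zero_mul, zero_add]
  have e11 : entry (b.1 * g) 1 1 = entry b.1 1 1 * entry g 1 1 := by
    rw [entry_mul, hb, zero_mul, zero_add]
  have hχ : (χ (borelDiag b) : ℂ) = MulChar.ofUnitHom χ (entry b.1 0 0) :=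
    (MulChar.ofUnitHom_coe χ (borelDiag b)).symm
  by_cases hg : entry g 1 0 = 0
  · have e00 : entry (b.1 * g) 0 0 = entry b.1 0 0 * entry g 0 0 := by
      rw [entry_mul, hg, mul_zero, add_zero]
    rw [psExtend, psExtend, if_pos hg, if_pos (by rw [e10, hg, mul_zero]), e00, map_mul, hχ,
      mul_assoc]
  · have h0 : entry (b.1 * g) 1 0 ≠ 0 := by rw [e10]; exact mul_ne_zero hd hg
    -- On the Borel subgroup a = d̄⁻¹, which explains the conjugate and the inverse on the big cell
    -- in `psExtend`.
    have hA : MulChar.ofUnitHom χ (entry b.1 0 0) =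
        (MulChar.ofUnitHom χ (conj k E (entry b.1 1 1)))⁻¹ := by
      apply eq_inv_of_mul_eq_one_left
      have h2 := rel2 b.1
      rw [hb, map_zero, mul_zero, sub_zero] at h2
      rw [← map_mul, h2, map_one]
    rw [psExtend, psExtend, if_neg hg, if_neg h0, e10, e11, mul_div_mul_left _ _ hd, ← mul_neg,
      map_mul, map_mul, mul_inv, hχ, hA, mul_assoc]

theorem psExtend_one (χ : Eˣ →* ℂˣ) (v : Option k → ℂ) : psExtend χ v (1 : U2 k E) = v none := by
  simp [psExtend, entry_one]

theorem psExtend_w (χ : Eˣ →* ℂˣ) (v : Option k → ℂ) (r : k) :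
    psExtend χ v (wU k E * unipU r) = v (some r) := by
  have e10 : entry (wU k E * unipU r) 1 0 = -1 := by simp [entry_mul]
  have e11 : entry (wU k E * unipU r) 1 1 = -algebraMap k E r := by simp [entry_mul]
  rw [psExtend, e10, e11, if_neg (by simp), neg_neg, map_one, map_one, inv_one, one_mul,
    neg_div_neg_eq, div_one, toBase_algebraMap]

/-- The values of a function at `1` and at the elements `w (1, r; 0, 1)`. -/
def psRestrict (f : U2 k E → ℂ) (i : Option k) : ℂ :=
  i.elim (f 1) fun r => f (wU k E * unipU r)

/-- The functions in `I(χ)` are given by their values at `1` and at the elements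
`w (1, r; 0, 1)`. -/
def psEquiv (χ : Eˣ →* ℂˣ) : PSSpace (k := k) χ ≃ₗ[ℂ] (Option k → ℂ) where
  toFun f := psRestrict f.1
  map_add' f f' := by funext i; cases i <;> rfl
  map_smul' c f := by funext i; cases i <;> rfl
  invFun v := ⟨psExtend χ v, psExtend_mem χ v⟩
  left_inv f := by
    refine Subtype.ext (PSSpace_ext (psExtend_mem χ (psRestrict f.1)) f.2 ?_ fun r => ?_)
    · exact psExtend_one χ (psRestrict f.1)
    · exact psExtend_w χ (psRestrict f.1) r
  right_inv v := by
    funext i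
    cases i
    · exact psExtend_one χ v
    · exact psExtend_w χ v _

instance (χ : Eˣ →* ℂˣ) : FiniteDimensional ℂ (PSSpace (k := k) χ) :=
  Module.Finite.of_injective (PSSpace (k := k) χ).subtype Subtype.val_injective

open scoped Classical in
/-- The character of `I(χ)` as a sum over the fixed points on the projective line over `k`. -/
theorem char_ps_eq_sum (χ : Eˣ →* ℂˣ) (g : U2 k E) : (ps k χ).character g =
    (if entry g 1 0 = 0 then MulChar.ofUnitHom χ (entry g 0 0) else 0) +
      ∑ b : k, if entry g 0 0 + algebraMap k E b * entry g 1 0 ≠ 0 ∧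
          entry g 0 1 + algebraMap k E b * entry g 1 1 =
            algebraMap k E b * (entry g 0 0 + algebraMap k E b * entry g 1 0) then
        (MulChar.ofUnitHom χ (conj k E (entry g 0 0 + algebraMap k E b * entry g 1 0)))⁻¹
      else 0 := by
  have h : (ps k χ).character g = LinearMap.trace ℂ (Option k → ℂ)
      ((psEquiv χ).conj (ps k χ g)) := (LinearMap.trace_conj' _ _).symm
  rw [h, trace_pi, Fintype.sum_option]
  congr 1
  · change psExtend χ (Pi.single none 1) (1 * g) = _
    rw [one_mul, psExtend, Pi.single_eq_same, Pi.single_eq_of_ne (by simp), mul_zero, mul_one]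
  · refine Finset.sum_congr rfl fun b _ => ?_
    change psExtend χ (Pi.single (some b) 1) (wU k E * unipU b * g) = _
    have e10 : entry (wU k E * unipU b * g) 1 0 =
        -(entry g 0 0 + algebraMap k E b * entry g 1 0) := by
      simp [entry_mul]; ring
    have e11 : entry (wU k E * unipU b * g) 1 1 =
        -(entry g 0 1 + algebraMap k E b * entry g 1 1) := by
      simp [entry_mul]; ring
    have hrel := rel4 (wU k E * unipU b * g)
    rw [psExtend, e10, e11]
    rw [e10, e11] at hrel
    -- The lower row of w (1, b; 0, 1) g is -(l, m). The coset of w (1, b; 0, 1) is therefore fixed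
    -- by g exactly when l ≠ 0 and m/l = b.
    set l := entry g 0 0 + algebraMap k E b * entry g 1 0
    set m := entry g 0 1 + algebraMap k E b * entry g 1 1
    by_cases hl : l = 0
    · simp [hl]
    · have hm : algebraMap k E (toBase (m / l)) = m / l := by
        apply algebraMap_toBase
        rw [map_div₀, div_eq_div_iff (conj_ne_zero hl) hl]
        simp only [map_neg] at hrel
        linear_combination hrel
      have hiff : toBase (m / l) = b ↔ m = algebraMap k E b * l := by
        rw [← (algebraMap k E).injective.eq_iff, hm, div_eq_iff hl]
      rw [if_neg (neg_ne_zero.2 hl), neg_neg, neg_div_neg_eq]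
      simp only [Pi.single_apply, Option.some_inj, hiff, ne_eq, hl, not_false_eq_true, true_and]
      split_ifs <;> simp


theorem ofUnitHom_conj_inv (χ : Eˣ →* ℂˣ) (x : Eˣ) :
    (MulChar.ofUnitHom χ (conj k E (x : E)))⁻¹ = conjInv k χ x := by
  have h : conj k E (x : E) = (Units.map (conj k E : E →* E) x : Eˣ) := rfl
  rw [h, MulChar.ofUnitHom_coe, ← Units.val_inv_eq_inv_val]
  rfl

theorem conjInv_E1 (χ : Eˣ →* ℂˣ) (z : E1 k E) : conjInv k χ (z : Eˣ) = χ (z : Eˣ) := by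
  have h : (Units.map (conj k E : E →* E) (z : Eˣ))⁻¹ = (z : Eˣ) :=
    Units.ext (by rw [Units.val_inv_eq_inv_val]; exact E1_conj_inv z)
  change (χ (Units.map (conj k E : E →* E) (z : Eˣ)))⁻¹ = _
  rw [← map_inv, h]

theorem char_ps_scalar (χ : Eˣ →* ℂˣ) (z : E1 k E) :
    (ps k χ).character (diagU (z : Eˣ)) = ((Fintype.card k : ℂ) + 1) * χ (z : Eˣ) := by
  classical
  have h0 : ((z : Eˣ) : E) ≠ 0 := Units.ne_zero _
  rw [char_ps_eq_sum, diagU_00, diagU_01, diagU_10, diagU_11, if_pos rfl, E1_conj_inv,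
    MulChar.ofUnitHom_coe]
  simp only [mul_zero, add_zero, zero_add, ne_eq, h0, not_false_eq_true, and_self, if_true,
    ofUnitHom_conj_inv, conjInv_E1, Finset.sum_const, Finset.card_univ, nsmul_eq_mul]
  ring

/-- A fixed point b means that the row vector (1, b) is an eigenvector of g with eigenvalue l = a +
bc. The characteristic polynomial at l equals c times the defect of this equation, so for c ≠ 0 the
equation holds exactly when l is an eigenvalue. -/
theorem fixed_iff {g : U2 k E} {x y : E} (h : HasEigenvalues g x y) (hc : entry g 1 0 ≠ 0) (b : E) :
    (entry g 0 0 + b * entry g 1 0 ≠ 0 ∧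
      entry g 0 1 + b * entry g 1 1 = b * (entry g 0 0 + b * entry g 1 0)) ↔
    entry g 0 0 + b * entry g 1 0 = x ∨ entry g 0 0 + b * entry g 1 0 = y := by
  have hdet := coe_detU g
  rw [h.2] at hdet
  have hd0 : x * y ≠ 0 := h.2 ▸ (detU g : Eˣ).ne_zero
  set l := entry g 0 0 + b * entry g 1 0 with hl
  have key : (l - x) * (l - y) =
      entry g 1 0 * (b * l - (entry g 0 1 + b * entry g 1 1)) := by
    linear_combination hdet + l * h.1 + (entry g 1 1 - l) * hl
  constructor
  · rintro ⟨-, h2⟩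
    rw [h2, sub_self, mul_zero] at key
    rcases mul_eq_zero.1 key with h3 | h3
    · exact .inl (sub_eq_zero.1 h3)
    · exact .inr (sub_eq_zero.1 h3)
  · intro h1
    have h2 : (l - x) * (l - y) = 0 := by
      rcases h1 with h1 | h1 <;> simp [h1]
    rw [h2] at key
    refine ⟨?_, (sub_eq_zero.1 ((mul_eq_zero.1 key.symm).resolve_left hc)).symm⟩
    rcases h1 with h1 | h1 <;> rw [h1]
    · exact left_ne_zero_of_mul hd0
    · exact right_ne_zero_of_mul hd0

/-- Solving for b gives (x - a)/c. Since a/c lies in k and det g = c/c̄, this quotient is fixed by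
conjugation exactly when x̄ · det g = x; this is the rationality condition for a fixed point. -/
theorem exists_add_mul_eq_iff {g : U2 k E} (hc : entry g 1 0 ≠ 0) (x : E) :
    (∃ b : k, entry g 0 0 + algebraMap k E b * entry g 1 0 = x) ↔
      conj k E x * ((detU g : Eˣ) : E) = x := by
  have hC := conj_ne_zero (k := k) hc
  have hdet : ((detU g : Eˣ) : E) * conj k E (entry g 1 0) = entry g 1 0 := by
    rw [coe_detU]
    linear_combination entry g 1 0 * rel2 g - entry g 0 0 * rel4 g
  have h5 := rel5 g
  constructor
  · rintro ⟨b, rfl⟩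
    apply mul_right_cancel₀ hC
    rw [map_add, map_mul, AlgHom.commutes]
    linear_combination (conj k E (entry g 0 0) + algebraMap k E b * conj k E (entry g 1 0)) * hdet
      + h5
  · intro hx
    obtain ⟨b, hb⟩ := (conj_eq_self_iff (k := k) ((x - entry g 0 0) / entry g 1 0)).1 (by
      rw [map_div₀, div_eq_div_iff hC hc, map_sub]
      linear_combination conj k E (entry g 1 0) * hx - conj k E x * hdet - h5)
    exact ⟨b, by rw [hb, div_mul_cancel₀ _ hc]; ring⟩

open scoped Classical in
theorem sum_eigenvalue {g : U2 k E} (hc : entry g 1 0 ≠ 0) (x : E) (t : ℂ) :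
    (∑ b : k, if entry g 0 0 + algebraMap k E b * entry g 1 0 = x then t else 0) =
      if conj k E x * ((detU g : Eˣ) : E) = x then t else 0 := by
  split_ifs with h
  · obtain ⟨b, hb⟩ := (exists_add_mul_eq_iff hc x).2 h
    rw [Finset.sum_eq_single b]
    · rw [if_pos hb]
    · intro b' _ hb'
      refine if_neg fun h' => hb' ((algebraMap k E).injective (mul_right_cancel₀ hc ?_))
      linear_combination h' - hb
    · simp
  · exact Finset.sum_eq_zero fun b _ => if_neg fun h' => h ((exists_add_mul_eq_iff hc x).1 ⟨b, h'⟩)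

theorem char_ps_of_ne {χ : Eˣ →* ℂˣ} {g : U2 k E} {x y : E} (h : HasEigenvalues g x y)
    (hc : entry g 1 0 ≠ 0) (hxy : x ≠ y) [Decidable (conj k E x * ((detU g : Eˣ) : E) = x)]
    [Decidable (conj k E y * ((detU g : Eˣ) : E) = y)] : (ps k χ).character g =
      (if conj k E x * ((detU g : Eˣ) : E) = x then
        (MulChar.ofUnitHom χ (conj k E x))⁻¹ else 0) +
      (if conj k E y * ((detU g : Eˣ) : E) = y then
        (MulChar.ofUnitHom χ (conj k E y))⁻¹ else 0) := by
  classical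
  rw [char_ps_eq_sum, if_neg hc, zero_add]
  simp only [fixed_iff h hc]
  have h1 := sum_eigenvalue hc x (MulChar.ofUnitHom χ (conj k E x))⁻¹
  have h2 := sum_eigenvalue hc y (MulChar.ofUnitHom χ (conj k E y))⁻¹
  convert congrArg₂ (· + ·) h1 h2 using 1
  · rw [← Finset.sum_add_distrib]
    refine Finset.sum_congr rfl fun b _ => ?_
    by_cases hx : entry g 0 0 + algebraMap k E b * entry g 1 0 = x
    · simp [hx, hxy]
    · simp only [hx, false_or, if_false, zero_add]
      split_ifs with hy
      · rw [hy]
      · rfl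
  · congr

theorem borel_entry {g : U2 k E} (hc : entry g 1 0 = 0) :
    entry g 0 0 ≠ 0 ∧ entry g 1 1 = (conj k E (entry g 0 0))⁻¹ := by
  have h3 := rel3 g
  rw [hc, zero_mul, sub_zero] at h3
  refine ⟨?_, eq_inv_of_mul_eq_one_left h3⟩
  intro h0
  rw [h0, map_zero, mul_zero] at h3
  exact zero_ne_one h3

theorem hasEigenvalues_borel {g : U2 k E} (hc : entry g 1 0 = 0) :
    HasEigenvalues g (entry g 0 0) (entry g 1 1) :=
  ⟨rfl, by rw [coe_detU, hc, mul_zero, sub_zero]⟩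

/-- A non-scalar element with a repeated eigenvalue has a single fixed point: ∞ if it is upper
triangular, and otherwise the finite point belonging to z. -/
theorem char_ps_unip (χ : Eˣ →* ℂˣ) {g : U2 k E} {z : E1 k E}
    (hg : ∀ z' : E1 k E, g ≠ diagU (z' : Eˣ)) (h : HasEigenvalues g (z : Eˣ) (z : Eˣ)) :
    (ps k χ).character g = χ (z : Eˣ) := by
  classical
  by_cases hc : entry g 1 0 = 0
  · have hb := hasEigenvalues_borel hc
    have ha := h.eq_or_eq hb
    have hd := h.eq_or_eq hb.symm
    rw [or_self] at ha hd
    rw [char_ps_eq_sum, if_pos hc, ha, MulChar.ofUnitHom_coe, Finset.sum_eq_zero, add_zero]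
    intro b _
    refine if_neg fun h' => hg z ?_
    have h01 : entry g 0 1 = 0 := by
      have := h'.2
      rw [hc, hd] at this
      linear_combination this
    apply ext_entry
    · exact ha
    · exact h01
    · exact hc
    · rw [diagU_11, E1_conj_inv]; exact hd
  · rw [char_ps_eq_sum, if_neg hc, zero_add]
    simp only [fixed_iff h hc, or_self]
    rw [← conjInv_E1 (k := k), ← ofUnitHom_conj_inv]
    have h1 := sum_eigenvalue hc ((z : Eˣ) : E) (MulChar.ofUnitHom χ (conj k E ((z : Eˣ) : E)))⁻¹
    rw [if_pos] at h1
    · rw [← h1]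
      refine Finset.sum_congr rfl fun b _ => ?_
      split_ifs with hb
      · rw [hb]
      · rfl
    · rw [h.2]
      linear_combination ((z : Eˣ) : E) * E1_mul_conj z

/-- Each of the two eigenvalues gives one rational fixed point, because det g = x/x̄ yields x̄ · det
g = x, and likewise for x̄⁻¹. -/
theorem char_ps_split (χ : Eˣ →* ℂˣ) {g : U2 k E} {x : Eˣ} (hx : x ∉ E1 k E)
    (h : HasEigenvalues g x (conj k E (x : E))⁻¹) :
    (ps k χ).character g = χ x + conjInv k χ x := by
  classical
  have hX := conj_coe_ne_zero (k := k) x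
  have hx0 := x.ne_zero
  have hne := conj_inv_ne_self hx
  have hinv : (MulChar.ofUnitHom χ (x : E)⁻¹)⁻¹ = χ x := by
    rw [← Units.val_inv_eq_inv_val, MulChar.ofUnitHom_coe, map_inv, Units.val_inv_eq_inv_val,
      inv_inv]
  have hinv' : MulChar.ofUnitHom χ (conj k E (x : E))⁻¹ =
      (MulChar.ofUnitHom χ (conj k E (x : E)))⁻¹ := by
    have hu : conj k E (x : E) = (Units.map (conj k E : E →* E) x : Eˣ) := rfl
    rw [hu, ← Units.val_inv_eq_inv_val, MulChar.ofUnitHom_coe, MulChar.ofUnitHom_coe, map_inv,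
      Units.val_inv_eq_inv_val]
  by_cases hc : entry g 1 0 = 0
  · have hb := hasEigenvalues_borel hc
    obtain ⟨ha0, hd⟩ := borel_entry hc
    have hA := conj_ne_zero (k := k) ha0
    have had : entry g 0 0 - entry g 1 1 ≠ 0 := by
      rw [sub_ne_zero]
      intro hd'
      rw [← hd'] at hb
      have h1 := hb.eq_or_eq h
      have h2 := hb.eq_or_eq h.symm
      rw [or_self] at h1 h2
      exact hne (h1.trans h2.symm)
    have hcd : conj k E (entry g 0 0 - entry g 1 1) ≠ 0 := conj_ne_zero had
    -- For an upper triangular g one fixed point is ∞, and the other solves b(a - d) = g₀₁; the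
    -- unitary relations place this solution in k.
    obtain ⟨b, hb'⟩ := (conj_eq_self_iff (k := k) (entry g 0 1 / (entry g 0 0 - entry g 1 1))).1 (by
      rw [map_div₀, div_eq_div_iff hcd had, map_sub, hd, map_inv₀, conj_conj]
      have h1 := rel1 g
      generalize conj k E (entry g 0 1) = B at *
      generalize conj k E (entry g 0 0) = A at *
      field_simp
      linear_combination (A * entry g 0 0 - 1) * h1)
    rw [eq_div_iff had] at hb'
    have hsum : (ps k χ).character g = MulChar.ofUnitHom χ (entry g 0 0) +
        (MulChar.ofUnitHom χ (conj k E (entry g 0 0)))⁻¹ := by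
      rw [char_ps_eq_sum, if_pos hc]
      congr 1
      rw [Finset.sum_eq_single b]
      · rw [hc, mul_zero, add_zero, if_pos ⟨ha0, by linear_combination -hb'⟩]
      · intro b' _ hbb
        refine if_neg fun h' => hbb ((algebraMap k E).injective (mul_right_cancel₀ had ?_))
        have := h'.2
        rw [hc] at this
        linear_combination -this - hb'
      · simp
    rw [hsum]
    rcases h.eq_or_eq hb with h1 | h1
    · rw [h1, MulChar.ofUnitHom_coe, ofUnitHom_conj_inv]
    · rw [h1, map_inv₀ (conj k E), conj_conj, hinv, add_comm, ← ofUnitHom_conj_inv, hinv']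
  · rw [char_ps_of_ne h hc hne, if_pos, if_pos, map_inv₀ (conj k E), conj_conj, hinv,
      ofUnitHom_conj_inv, add_comm]
    · rw [h.2, map_inv₀, conj_conj]
      field_simp
    · rw [h.2]
      generalize conj k E (x : E) = X at *
      field_simp

/-- There are no fixed points. An upper triangular element with a in E¹ has d = ā⁻¹ = a, a repeated
eigenvalue; off the Borel subgroup rationality fails, since z̄ · zz' = z' ≠ z. -/
theorem char_ps_aniso (χ : Eˣ →* ℂˣ) {g : U2 k E} {z z' : E1 k E} (hz : z ≠ z')
    (h : HasEigenvalues g (z : Eˣ) (z' : Eˣ)) : (ps k χ).character g = 0 := by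
  classical
  have hne : ((z : Eˣ) : E) ≠ ((z' : Eˣ) : E) := fun h => hz (Subtype.ext (Units.ext h))
  by_cases hc : entry g 1 0 = 0
  · exfalso
    have hb := hasEigenvalues_borel hc
    obtain ⟨ha0, hd⟩ := borel_entry hc
    have had : entry g 1 1 = entry g 0 0 := by
      rcases h.eq_or_eq hb with h1 | h1 <;> rw [hd, h1, E1_conj_inv]
    rw [had] at hb
    have h1 := hb.eq_or_eq h
    have h2 := hb.eq_or_eq h.symm
    rw [or_self] at h1 h2
    exact hne (h1.trans h2.symm)
  · rw [char_ps_of_ne h hc hne, if_neg, if_neg, add_zero]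
    · rw [h.2]
      intro h0
      apply hne
      linear_combination h0 - ((z : Eˣ) : E) * E1_mul_conj z'
    · rw [h.2]
      intro h0
      apply hne
      linear_combination ((z' : Eˣ) : E) * E1_mul_conj z - h0

/-! ## The Steinberg representation -/

theorem one_mem_PSSpace : (fun _ => 1 : U2 k E → ℂ) ∈ PSSpace (k := k) (1 : Eˣ →* ℂˣ) := by
  rw [mem_PSSpace]
  simp

/-- `1 ⊕ St = I(1)`. -/
def steinbergEquiv : ((charRep (1 : E1 k E →* ℂˣ)).prod (steinberg k E)).Equiv
    (ps k (1 : Eˣ →* ℂˣ)) :=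
  .mk (LinearEquiv.ofBijective
    (LinearMap.coprod (LinearMap.toSpanSingleton ℂ _ ⟨_, one_mem_PSSpace⟩)
      (Submodule.inclusion (fun _ hf => hf.1 : StSpace k E ≤ PSSpace (k := k) (1 : Eˣ →* ℂˣ))))
    (by
      have hcard : (Fintype.card (U2 k E) : ℂ) ≠ 0 := by simp
      constructor
      · rw [← LinearMap.ker_eq_bot, LinearMap.ker_eq_bot']
        rintro ⟨c, f⟩ hcf
        have hcf' : ∀ g : U2 k E, c * 1 + f.1 g = 0 := fun g =>
          congrFun (congrArg Subtype.val hcf) g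
        have hc : c = 0 := by
          have h1 : ∑ g : U2 k E, (c * 1 + f.1 g) = 0 := Finset.sum_eq_zero fun g _ => hcf' g
          rw [Finset.sum_add_distrib, f.2.2] at h1
          simpa using h1
        subst hc
        refine Prod.ext rfl (Subtype.ext (funext fun g => ?_))
        have := hcf' g
        rw [zero_mul, zero_add] at this
        exact this
      · intro f
        -- The component along the constants is the mean value of f over the group.
        let c : ℂ := (Fintype.card (U2 k E) : ℂ)⁻¹ * ∑ g : U2 k E, f.1 g
        let f' : U2 k E → ℂ := f.1 - c • fun _ => 1
        have hf' : f' ∈ StSpace k E := by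
          refine ⟨Submodule.sub_mem _ f.2 (Submodule.smul_mem _ c one_mem_PSSpace), ?_⟩
          simp [f', c]
        refine ⟨(c, ⟨f', hf'⟩), Subtype.ext (funext fun g => ?_)⟩
        change c * 1 + (f.1 g - c * 1) = f.1 g
        ring)) fun g => by
    refine LinearMap.ext fun x => Subtype.ext (funext fun h => ?_)
    change (((1 : E1 k E →* ℂˣ) (detU g) : ℂ) * x.1) * 1 + x.2.1 (h * g) = x.1 * 1 + x.2.1 (h * g)
    simp

instance : FiniteDimensional ℂ (StSpace k E) :=
  Module.Finite.of_injective (StSpace k E).subtype Subtype.val_injective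

theorem char_steinberg (g : U2 k E) :
    (steinberg k E).character g = (ps k (1 : Eˣ →* ℂˣ)).character g - 1 := by
  have h := congrFun (Representation.char_iso (steinbergEquiv (k := k) (E := E))) g
  rw [char_prod, char_charRep] at h
  rw [← h]
  simp

theorem char_steinbergTwist (η : E1 k E →* ℂˣ) (g : U2 k E) :
    (steinbergTwist η).character g = η (detU g) * ((ps k (1 : Eˣ →* ℂˣ)).character g - 1) := by
  rw [steinbergTwist, char_twist, char_steinberg]
  rfl

end PrincipalSeries

/-! ## Irreducibility -/

section General

variable {G : Type*} [Group G] [Fintype G]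

/-- A criterion for irreducibility: every non-zero invariant subspace meets a subspace `L` on which
a linear form is injective. -/
theorem isIrreducible_of_eval {V : Type*} [AddCommGroup V] [Module ℂ V] [Nontrivial V]
    (ρ : Representation ℂ G V) (L : Submodule ℂ V) (ev : V →ₗ[ℂ] ℂ)
    (hev : ∀ x ∈ L, ev x = 0 → x = 0)
    (h : ∀ U : Submodule ℂ V, (∀ g, ∀ x ∈ U, ρ g x ∈ U) → ∀ x ∈ U, x ≠ 0 →
      ∃ y ∈ U, y ∈ L ∧ y ≠ 0) : ρ.IsIrreducible := by
  obtain ⟨x, hx⟩ := exists_ne (0 : V)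
  obtain ⟨v, -, hvL, hv⟩ := h ⊤ (fun _ _ _ => Submodule.mem_top) x Submodule.mem_top hx
  refine isIrreducible_of_mem ρ v hv fun U hU x hx hx0 => ?_
  obtain ⟨y, hyU, hyL, hy⟩ := h U hU x hx hx0
  have hy' : ev y ≠ 0 := fun h0 => hy (hev y hyL h0)
  -- The form `ev` is injective on L, so L is a line and v is a multiple of y.
  have hvy : v - (ev v / ev y) • y = 0 := by
    refine hev _ (L.sub_mem hvL (L.smul_mem _ hyL)) ?_
    rw [map_sub, map_smul, smul_eq_mul, div_mul_cancel₀ _ hy', sub_self]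
  rw [sub_eq_zero.1 hvy]
  exact U.smul_mem _ hyU

theorem mem_of_twist_invariant {V : Type*} [AddCommGroup V] [Module ℂ V] (c : G →* ℂˣ)
    (ρ : Representation ℂ G V) {U : Submodule ℂ V} (hU : ∀ g, ∀ x ∈ U, twist c ρ g x ∈ U)
    (g : G) (x : V) (hx : x ∈ U) : ρ g x ∈ U := by
  have h1 : ρ g x = ((c g)⁻¹ : ℂˣ) • twist c ρ g x := by
    change _ = ((c g)⁻¹ : ℂˣ) • ((c g : ℂ) • ρ g x)
    rw [← Units.smul_def, inv_smul_smul]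
  rw [h1, Units.smul_def]
  exact U.smul_mem _ (hU g x hx)

end General

section Irreducible

variable {k E : Type*} [Field k] [Fintype k] [Field E] [Fintype E] [Algebra k E]
  [Algebra.IsQuadraticExtension k E] [NeZero (2 : k)]

/-- This bound separates the dimensions 1 and q - 1; the other dimensions of the four families
differ for every q. -/
theorem three_le_card (k : Type*) [Field k] [Fintype k] [NeZero (2 : k)] : 3 ≤ Fintype.card k := by
  have hk2 : ringChar k ≠ 2 := by
    intro h
    have h3 : ((2 : ℕ) : k) = 0 := h ▸ ringChar.Nat.cast_ringChar
    exact NeZero.ne (2 : k) (by exact_mod_cast h3)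
  have hodd : Fintype.card k % 2 = 1 := FiniteField.odd_card_of_char_ne_two hk2
  have := Fintype.one_lt_card (α := k)
  omega

theorem diagU_one' : diagU (k := k) ((1 : E1 k E) : Eˣ) = 1 := diagU_one

theorem finrank_ps (χ : Eˣ →* ℂˣ) :
    Module.finrank ℂ (PSSpace (k := k) χ) = Fintype.card k + 1 := by
  have h := char_ps_scalar (k := k) χ 1
  rw [diagU_one', Representation.char_one] at h
  have h' : (Module.finrank ℂ (PSSpace (k := k) χ) : ℂ) = (Fintype.card k : ℂ) + 1 := by
    rw [h]; simp
  exact_mod_cast h'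

theorem finrank_steinberg : Module.finrank ℂ (StSpace k E) = Fintype.card k := by
  have h := char_steinberg (1 : U2 k E)
  rw [Representation.char_one, Representation.char_one, finrank_ps] at h
  push_cast at h
  rw [add_sub_cancel_right] at h
  exact_mod_cast h

theorem finrank_cusp {ψ : AddChar k ℂ} (hψ : ψ ≠ 1) {μ : E1 k E →* ℂˣ} (hμ : μ ≠ 1) :
    Module.finrank ℂ (WSpace μ) + 1 = Fintype.card k := by
  have h := char_cusp_scalar hψ (1 : E1 k E →* ℂˣ) hμ 1
  rw [diagU_one', Representation.char_one] at h
  have h' : (Module.finrank ℂ (WSpace μ) : ℂ) + 1 = (Fintype.card k : ℂ) := by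
    rw [h]; simp
  exact_mod_cast h'

theorem isIrreducible_charRep (η : E1 k E →* ℂˣ) : (charRep (k := k) η).IsIrreducible := by
  refine isIrreducible_of_mem _ (1 : ℂ) one_ne_zero fun U _ x hx hx0 => ?_
  have := U.smul_mem x⁻¹ hx
  rwa [smul_eq_mul, inv_mul_cancel₀ hx0] at this

/-- The functions on `U₂(k)` that transform under right translations by the Borel subgroup
through the character `θ`. -/
def rightBorel (θ : Eˣ →* ℂˣ) : Submodule ℂ (U2 k E → ℂ) where
  carrier := {f | ∀ (g : U2 k E) (b : borel k E), f (g * b) = θ (borelDiag b) * f g}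
  zero_mem' := by simp
  add_mem' := by
    intro f f' hf hf' g b
    simp only [Pi.add_apply, hf g b, hf' g b, mul_add]
  smul_mem' := by
    intro c f hf g b
    simp only [Pi.smul_apply, smul_eq_mul, hf g b]; ring

theorem rightBorel_unipU {θ : Eˣ →* ℂˣ} {f : U2 k E → ℂ} (hf : f ∈ rightBorel (k := k) θ)
    (g : U2 k E) (s : k) : f (g * unipU s) = f g := by
  have h := hf g ⟨unipU s, unipU_10 s⟩
  have h1 : borelDiag (⟨unipU s, unipU_10 s⟩ : borel k E) = 1 := Units.ext (unipU_00 s)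
  rwa [h1, map_one, Units.val_one, one_mul] at h

theorem rightBorel_diagU {θ : Eˣ →* ℂˣ} {f : U2 k E → ℂ} (hf : f ∈ rightBorel (k := k) θ)
    (g : U2 k E) (a : Eˣ) : f (g * diagU a) = θ a * f g := by
  have h := hf g ⟨diagU a, diagU_10 a⟩
  have h1 : borelDiag (⟨diagU a, diagU_10 a⟩ : borel k E) = a := Units.ext (diagU_00 a)
  rwa [h1] at h

/-- The value at w diag(a, ā⁻¹) is computed in two ways: from the right it gives θ(a), and moving
the torus element across w gives χ(ā⁻¹). -/
theorem eq_conjInv_of_apply_w_ne_zero {χ θ : Eˣ →* ℂˣ} {f : U2 k E → ℂ}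
    (hf : f ∈ PSSpace (k := k) χ) (hf' : f ∈ rightBorel (k := k) θ) (h : f (wU k E) ≠ 0) :
    θ = conjInv k χ := by
  ext a
  apply mul_right_cancel₀ h
  rw [← rightBorel_diagU hf']
  have := PSSpace_wU_mul_diagU_mul hf a 1
  rwa [mul_one, mul_one] at this

theorem eq_of_apply_one_ne_zero {χ θ : Eˣ →* ℂˣ} {f : U2 k E → ℂ}
    (hf : f ∈ PSSpace (k := k) χ) (hf' : f ∈ rightBorel (k := k) θ) (h : f 1 ≠ 0) : θ = χ := by
  ext a
  apply mul_right_cancel₀ h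
  rw [← rightBorel_diagU hf', ← PSSpace_diagU_mul hf, one_mul, mul_one]

/-- There are two double cosets of the Borel subgroup, represented by 1 and w; a function
equivariant on both sides is determined by its values there. -/
theorem eq_zero_of_apply {χ θ : Eˣ →* ℂˣ} {f : U2 k E → ℂ}
    (hf : f ∈ PSSpace (k := k) χ) (hf' : f ∈ rightBorel (k := k) θ) (h1 : f 1 = 0)
    (hw : f (wU k E) = 0) : f = 0 :=
  PSSpace_ext hf (Submodule.zero_mem _) h1 fun r => by
    rw [rightBorel_unipU hf', hw]; rfl

theorem eq_or_eq_of_ne_zero {χ θ : Eˣ →* ℂˣ} {f : U2 k E → ℂ}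
    (hf : f ∈ PSSpace (k := k) χ) (hf' : f ∈ rightBorel (k := k) θ) (h : f ≠ 0) :
    θ = χ ∨ θ = conjInv k χ := by
  by_contra! hθ
  refine h (eq_zero_of_apply hf hf' ?_ ?_)
  · by_contra h1; exact hθ.1 (eq_of_apply_one_ne_zero hf hf' h1)
  · by_contra h1; exact hθ.2 (eq_conjInv_of_apply_w_ne_zero hf hf' h1)

instance : Fintype (borel k E) := Fintype.ofFinite _

/-- The projection to the functions that transform through `θ` under the Borel subgroup. -/
def borelSum (θ : Eˣ →* ℂˣ) (f : U2 k E → ℂ) : U2 k E → ℂ :=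
  ∑ b : borel k E, ((θ (borelDiag b))⁻¹ : ℂ) • rightReg k E b.1 f

theorem borelSum_apply (θ : Eˣ →* ℂˣ) (f : U2 k E → ℂ) (g : U2 k E) :
    borelSum θ f g = ∑ b : borel k E, ((θ (borelDiag b))⁻¹ : ℂ) * f (g * b.1) := by
  simp only [borelSum, Finset.sum_apply]
  rfl

theorem borelSum_mem (θ : Eˣ →* ℂˣ) (f : U2 k E → ℂ) :
    borelSum θ f ∈ rightBorel (k := k) θ := by
  intro g b
  rw [borelSum_apply, borelSum_apply, Finset.mul_sum]
  symm
  rw [← Equiv.sum_comp (Equiv.mulLeft b)]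
  refine Finset.sum_congr rfl fun b' _ => ?_
  have h1 := (θ (borelDiag b)).ne_zero
  have h2 := (θ (borelDiag b')).ne_zero
  rw [Equiv.coe_mulLeft, map_mul, map_mul, Units.val_mul, Subgroup.coe_mul, mul_assoc g]
  field_simp

/-- At the identity right and left translation agree, so all summands equal f(1). -/
theorem borelSum_apply_one {χ : Eˣ →* ℂˣ} {f : U2 k E → ℂ} (hf : f ∈ PSSpace (k := k) χ)
    (h : f 1 ≠ 0) : borelSum χ f 1 ≠ 0 := by
  have : ∀ b : borel k E, ((χ (borelDiag b))⁻¹ : ℂ) * f (1 * b.1) = f 1 := fun b => by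
    have h1 := (mem_PSSpace χ f).1 hf b 1
    rw [mul_one] at h1
    rw [one_mul, h1, inv_mul_cancel_left₀ (Units.ne_zero _)]
  rw [borelSum_apply]
  simp only [this, Finset.sum_const, Finset.card_univ, nsmul_eq_mul]
  simpa using h

theorem exists_apply_one_ne_zero {f : U2 k E → ℂ} (h : f ≠ 0) :
    ∃ g, rightReg k E g f 1 ≠ 0 := by
  obtain ⟨g, hg⟩ := Function.ne_iff.1 h
  refine ⟨g, ?_⟩
  change f (1 * g) ≠ 0
  rwa [one_mul]

/-- A non-zero invariant subspace of `I(χ)` contains a non-zero vector on which the Borel subgroup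
acts through `χ`. -/
theorem exists_mem_rightBorel {χ : Eˣ →* ℂˣ} {U : Submodule ℂ (U2 k E → ℂ)}
    (hU : ∀ g, ∀ f ∈ U, rightReg k E g f ∈ U) (hUχ : U ≤ PSSpace (k := k) χ)
    {f : U2 k E → ℂ} (hf : f ∈ U) (h : f ≠ 0) : ∃ F ∈ U, F ∈ rightBorel (k := k) χ ∧ F ≠ 0 := by
  obtain ⟨g, hg⟩ := exists_apply_one_ne_zero h
  refine ⟨borelSum χ (rightReg k E g f), ?_, borelSum_mem _ _, fun h0 => ?_⟩
  · exact U.sum_mem fun b _ => U.smul_mem _ (hU _ _ (hU _ _ hf))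
  · exact borelSum_apply_one (hUχ (hU g f hf)) hg (by rw [h0]; rfl)

instance (χ : Eˣ →* ℂˣ) : Nontrivial (PSSpace (k := k) χ) :=
  Module.nontrivial_of_finrank_pos (R := ℂ) (by rw [finrank_ps]; omega)

instance : Nontrivial (StSpace k E) :=
  Module.nontrivial_of_finrank_pos (R := ℂ) (by rw [finrank_steinberg]; exact Fintype.card_pos)

/-- The test space consists of the vectors on which the Borel subgroup acts through χ. Such a vector
vanishing at 1 is supported on the big cell, where only χ̄⁻¹ ≠ χ can occur; evaluation at 1 is
therefore injective. -/
theorem isIrreducible_ps {χ : Eˣ →* ℂˣ} (hχ : χ ≠ conjInv k χ) : (ps k χ).IsIrreducible := by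
  refine isIrreducible_of_eval _ ((rightBorel χ).comap (PSSpace (k := k) χ).subtype)
    ((LinearMap.proj 1).comp (PSSpace (k := k) χ).subtype) ?_ ?_
  · intro f hf h1
    refine Subtype.ext (eq_zero_of_apply f.2 hf h1 ?_)
    by_contra hw
    exact hχ (eq_conjInv_of_apply_w_ne_zero f.2 hf hw)
  · intro U hU f hf hf0
    obtain ⟨F, ⟨F', hF', rfl⟩, hF, hF0⟩ := exists_mem_rightBorel (χ := χ)
      (U := U.map (PSSpace (k := k) χ).subtype) (by
        rintro g _ ⟨f, hf, rfl⟩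
        exact ⟨_, hU g f hf, rfl⟩) (by
        rintro _ ⟨f, hf, rfl⟩
        exact f.2) ⟨f, hf, rfl⟩ (fun h => hf0 (Subtype.ext h))
    exact ⟨F', hF', hF, fun h => hF0 (by rw [h]; rfl)⟩

theorem exists_mem_rightBorel_steinberg {U : Submodule ℂ (StSpace k E)}
    (hU : ∀ g, ∀ f ∈ U, steinberg k E g f ∈ U) {f : StSpace k E} (hf : f ∈ U) (hf0 : f ≠ 0) :
    ∃ F ∈ U, F.1 ∈ rightBorel (k := k) (1 : Eˣ →* ℂˣ) ∧ F ≠ 0 := by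
  obtain ⟨F, ⟨F', hF', rfl⟩, hF, hF0⟩ := exists_mem_rightBorel (χ := 1)
    (U := U.map (StSpace k E).subtype) (by
      rintro g _ ⟨f, hf, rfl⟩
      exact ⟨_, hU g f hf, rfl⟩) (by
      rintro _ ⟨f, hf, rfl⟩
      exact f.2.1) ⟨f, hf, rfl⟩ (fun h => hf0 (Subtype.ext h))
  exact ⟨F', hF', hF, fun h => hF0 (by rw [h]; rfl)⟩

/-- The test space consists of the vectors fixed by the Borel subgroup. Such a function vanishing at
1 is constant on the big cell and zero elsewhere, so total sum zero forces it to vanish. -/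
theorem isIrreducible_steinbergTwist (η : E1 k E →* ℂˣ) : (steinbergTwist η).IsIrreducible := by
  refine isIrreducible_of_eval _ ((rightBorel 1).comap (StSpace k E).subtype)
    ((LinearMap.proj 1).comp (StSpace k E).subtype) ?_ ?_
  · classical
    intro f hf h1
    have h1' : f.1 1 = 0 := h1
    have hf : f.1 ∈ rightBorel (k := k) (1 : Eˣ →* ℂˣ) := hf
    refine Subtype.ext (eq_zero_of_apply f.2.1 hf h1 ?_)
    have hsum := f.2.2
    have hval : ∀ g : U2 k E, f.1 g = if g ∈ borel k E then 0 else f.1 (wU k E) := by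
      intro g
      rcases bruhat g with ⟨a, s, rfl⟩ | ⟨a, s, r, rfl⟩
      · rw [if_pos, PSSpace_unipU_mul f.2.1, ← mul_one (diagU a), PSSpace_diagU_mul f.2.1, h1',
          mul_zero]
        exact mul_mem (unipU_10 s : unipU s ∈ borel k E) (diagU_10 a : diagU a ∈ borel k E)
      · rw [if_neg, PSSpace_unipU_mul f.2.1, ← mul_assoc, rightBorel_unipU hf,
          rightBorel_diagU hf]
        · simp
        · intro hmem
          have h2 : entry (unipU s * (wU k E * (diagU a * unipU r))) 1 0 = 0 := hmem
          simp [entry_mul] at h2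
    rw [Finset.sum_congr rfl fun g _ => hval g, Finset.sum_ite, Finset.sum_const_zero, zero_add,
      Finset.sum_const, nsmul_eq_mul] at hsum
    refine (mul_eq_zero.1 hsum).resolve_left ?_
    rw [← Ne, Nat.cast_ne_zero, ← Nat.pos_iff_ne_zero, Finset.card_pos]
    refine ⟨wU k E, ?_⟩
    simp only [Finset.mem_filter, Finset.mem_univ, true_and]
    intro h
    have h2 : entry (wU k E) 1 0 = 0 := h
    simp at h2
  · intro U hU f hf hf0
    exact exists_mem_rightBorel_steinberg (mem_of_twist_invariant _ _ hU) hf hf0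

theorem WSpace_zero {μ : E1 k E →* ℂˣ} (hμ : μ ≠ 1) {f : E → ℂ} (hf : f ∈ WSpace μ) : f 0 = 0 := by
  obtain ⟨y, hy⟩ : ∃ y, μ⁻¹ y ≠ 1 := by
    by_contra! h0
    exact hμ (MonoidHom.ext fun y => inv_eq_one.1 (h0 y))
  have h := hf y 0
  rw [mul_zero] at h
  have h2 : ((μ⁻¹ y : ℂˣ) : ℂ) - 1 ≠ 0 := by
    rw [sub_ne_zero, Ne, Units.val_eq_one]; exact hy
  refine (mul_eq_zero.1 (?_ : (((μ⁻¹ y : ℂˣ) : ℂ) - 1) * f 0 = 0)).resolve_left h2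
  linear_combination -h

theorem sum_psi_mul {ψ : AddChar k ℂ} (hψ : ψ ≠ 1) {s : k} (hs : s ≠ 0) :
    ∑ b : k, ψ (b * s) = 0 := by
  rw [Fintype.sum_bijective (· * s) (mulRight_bijective₀ s hs) _ (fun a => ψ a) fun _ => rfl]
  exact AddChar.sum_eq_zero_of_ne_one hψ

/-- The test space L is the ψ-eigenspace of the unipotent radical, the functions supported on norm
one. There E¹ acts simply transitively, so f(1) determines f. -/
theorem isIrreducible_cusp {ψ : AddChar k ℂ} (hψ : ψ ≠ 1) {μ : E1 k E →* ℂˣ} (hμ : μ ≠ 1)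
    (η : E1 k E →* ℂˣ) : (cusp ψ hψ μ η).IsIrreducible := by
  have : Nontrivial (WSpace μ) := Module.nontrivial_of_finrank_pos (R := ℂ) (by
    have h1 := finrank_cusp hψ hμ
    have h2 := three_le_card k
    omega)
  let L : Submodule ℂ (WSpace μ) :=
    { carrier := {f | ∀ x : E, Algebra.norm k x ≠ 1 → f.1 x = 0}
      zero_mem' := fun _ _ => rfl
      add_mem' := fun {f f'} hf hf' x hx => by
        change f.1 x + f'.1 x = 0
        rw [hf x hx, hf' x hx, add_zero]
      smul_mem' := fun c f hf x hx => by
        change c * f.1 x = 0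
        rw [hf x hx, mul_zero] }
  refine isIrreducible_of_eval _ L ((LinearMap.proj 1).comp (WSpace μ).subtype) ?_ ?_
  · intro f hf h1
    have h1' : f.1 1 = 0 := h1
    refine Subtype.ext (funext fun x => ?_)
    by_cases hx : Algebra.norm k x = 1
    · have hx0 : x ≠ 0 := by
        rintro rfl
        rw [Algebra.norm_zero] at hx
        exact zero_ne_one hx
      have h2 := f.2 ⟨Units.mk0 x hx0, (mem_E1 _).2 hx⟩ 1
      rw [h1', mul_zero, mul_one] at h2
      exact h2
    · exact hf x hx
  · intro U hU' f hf hf0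
    have hU := mem_of_twist_invariant _ _ hU'
    obtain ⟨x, hx⟩ : ∃ x, f.1 x ≠ 0 := by
      by_contra! h0
      exact hf0 (Subtype.ext (funext h0))
    have hx0 : x ≠ 0 := by
      rintro rfl
      exact hx (WSpace_zero hμ f.2)
    let σ := (weil ψ hψ).subrepresentation (WSpace μ) fun g _ hf => weil_mem ψ hψ g hf
    let f' : WSpace μ := σ (diagU (Units.mk0 x hx0)) f
    have hf' : f'.1 1 = f.1 x := by
      change weil ψ hψ (diagU (Units.mk0 x hx0)) f.1 1 = _
      rw [weil_diag, mul_one, Units.val_mk0]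
    -- Up to a factor q this is the projection onto L: it multiplies f' by the sum of ψ(b(Nm(y) -
    -- 1)) over b, which is q on norm one and 0 elsewhere. The torus has first moved a point of the
    -- support to 1, so F(1) ≠ 0.
    let F : WSpace μ := ∑ b : k, ψ (-b) • σ (unipU b) f'
    have hF : ∀ y, F.1 y = (∑ b : k, ψ (b * (Algebra.norm k y - 1))) * f'.1 y := by
      intro y
      have h1 : F.1 y = ∑ b : k, ψ (-b) * (weil ψ hψ (unipU b) f'.1 y) := by
        simp only [F, Submodule.coe_sum, Finset.sum_apply]
        rfl
      rw [h1, Finset.sum_mul]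
      refine Finset.sum_congr rfl fun b _ => ?_
      rw [weil_unip, ← mul_assoc, ← AddChar.map_add_eq_mul]
      ring_nf
    refine ⟨F, U.sum_mem fun b _ => U.smul_mem _ (hU _ _ (hU _ _ hf)), fun y hy => ?_, fun h0 => ?_⟩
    · rw [hF, sum_psi_mul hψ (sub_ne_zero.2 hy), zero_mul]
    · have h1 := hF 1
      rw [h0, hf'] at h1
      have h2 : (0 : ℂ) = (Fintype.card k : ℂ) * f.1 x := by simpa using h1
      exact mul_ne_zero (by simp) hx h2.symm

/-! ## Isomorphisms between the irreducible representations -/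

theorem iso_finrank_eq {G V W : Type*} [Group G] [AddCommGroup V] [Module ℂ V]
    [AddCommGroup W] [Module ℂ W] {ρ : Representation ℂ G V} {σ : Representation ℂ G W}
    (h : Iso ρ σ) : Module.finrank ℂ V = Module.finrank ℂ W :=
  h.some.toLinearEquiv.finrank_eq

theorem eq_of_comp_divConj_eq {η η' : E1 k E →* ℂˣ}
    (h : ∀ a : Eˣ, η (divConj k E a) = η' (divConj k E a)) : η = η' := by
  ext z
  obtain ⟨a, rfl⟩ := divConj_surjective z
  rw [h]

theorem conjInv_conjInv (χ : Eˣ →* ℂˣ) : conjInv k (conjInv k χ) = χ := by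
  ext a
  have h : Units.map (conj k E : E →* E) (Units.map (conj k E : E →* E) a) = a :=
    Units.ext (conj_conj _)
  change (((χ (Units.map (conj k E : E →* E) (Units.map (conj k E : E →* E) a)))⁻¹)⁻¹ : ℂˣ).1 = _
  rw [h, inv_inv]

theorem eq_of_iso_charRep {η η' : E1 k E →* ℂˣ}
    (h : Iso (charRep (k := k) η) (charRep η')) : η' = η := by
  obtain ⟨e⟩ := h
  refine eq_of_comp_divConj_eq fun a => ?_
  have h1 := congrFun (Representation.char_iso e) (diagU a)
  rw [char_charRep, char_charRep, detU_diagU_eq] at h1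
  exact (Units.ext h1).symm

/-- A Borel-fixed vector of St is carried to a vector of St on which the Borel subgroup acts through
a ↦ (η/η')(a/ā). Only the trivial character can occur in I(1), and the quotients a/ā exhaust E¹. -/
theorem eq_of_iso_steinbergTwist {η η' : E1 k E →* ℂˣ}
    (h : Iso (steinbergTwist (k := k) η) (steinbergTwist η')) : η' = η := by
  obtain ⟨e⟩ := h
  obtain ⟨f, hf0⟩ := exists_ne (0 : StSpace k E)
  obtain ⟨F, -, hF, hF0⟩ := exists_mem_rightBorel_steinberg (U := ⊤)
    (fun _ _ _ => Submodule.mem_top) (Submodule.mem_top (x := f)) hf0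
  have he : ∀ b : borel k E, (η' (detU b.1) : ℂ) • steinberg k E b.1 (e F) =
      (η (detU b.1) : ℂ) • e F := by
    intro b
    have h1 := Representation.IntertwiningMap.isIntertwining _ _ e.toIntertwiningMap b.1 F
    have h2 : steinbergTwist η b.1 F = (η (detU b.1) : ℂ) • F := by
      change (η (detU b.1) : ℂ) • steinberg k E b.1 F = _
      congr 1
      refine Subtype.ext (funext fun g => ?_)
      change F.1 (g * b.1) = F.1 g
      rw [hF g b]; simp
    rw [h2, map_smul] at h1
    exact h1.symm
  let θ : Eˣ →* ℂˣ := (η / η').comp (divConj k E)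
  have hdet : ∀ b : borel k E, detU b.1 = divConj k E (borelDiag b) := by
    intro b
    obtain ⟨h00, h11⟩ := borel_entry (g := b.1) b.2
    refine Subtype.ext (Units.ext ?_)
    rw [(hasEigenvalues_borel (g := b.1) b.2).2, coe_divConj, h11, div_eq_mul_inv]
    rfl
  have hθ : (e F).1 ∈ rightBorel (k := k) θ := by
    intro g b
    have h1 := congrFun (congrArg Subtype.val (he b)) g
    have h2 : (η' (detU b.1) : ℂ) * (e F).1 (g * b.1) = (η (detU b.1) : ℂ) * (e F).1 g := h1
    have h3 : (θ (borelDiag b) : ℂ) = η (detU b.1) / η' (detU b.1) := by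
      rw [hdet]; simp [θ]
    rw [h3, div_mul_eq_mul_div, ← h2, mul_div_cancel_left₀ _ (Units.ne_zero _)]
  have hF' : (e F).1 ≠ 0 := by
    intro h0
    apply hF0
    apply e.toLinearEquiv.injective
    rw [map_zero]
    exact Subtype.ext h0
  have h1 : conjInv k (1 : Eˣ →* ℂˣ) = 1 := by ext; simp [conjInv]
  have h2 := eq_or_eq_of_ne_zero (e F).2.1 hθ hF'
  rw [h1, or_self] at h2
  refine eq_of_comp_divConj_eq fun a => ?_
  have h3 := DFunLike.congr_fun h2 a
  have h4 : η (divConj k E a) / η' (divConj k E a) = 1 := h3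
  exact (div_eq_one.1 h4).symm

/-- I(χ) contains a vector on which the Borel subgroup acts through χ, and I(χ') admits only χ' and
its conjugate inverse as such characters. -/
theorem eq_or_eq_of_iso_ps {χ χ' : Eˣ →* ℂˣ} (h : Iso (ps k χ) (ps k χ')) :
    χ' = χ ∨ χ' = conjInv k χ := by
  obtain ⟨e⟩ := h
  obtain ⟨f, hf0⟩ := exists_ne (0 : PSSpace (k := k) χ)
  obtain ⟨F, hFχ, hF, hF0⟩ := exists_mem_rightBorel (χ := χ) (U := PSSpace (k := k) χ)
    (fun g f hf => (ps k χ g ⟨f, hf⟩).2) le_rfl f.2 (fun h => hf0 (Subtype.ext h))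
  have hF' : (e ⟨F, hFχ⟩).1 ∈ rightBorel (k := k) χ := by
    intro g b
    have h1 := Representation.IntertwiningMap.isIntertwining _ _ e.toIntertwiningMap b.1 ⟨F, hFχ⟩
    have h2 : ps k χ b.1 ⟨F, hFχ⟩ = (χ (borelDiag b) : ℂ) • ⟨F, hFχ⟩ :=
      Subtype.ext (funext fun g => hF g b)
    rw [h2, map_smul] at h1
    exact (congrFun (congrArg Subtype.val h1) g).symm
  have hF0' : (e ⟨F, hFχ⟩).1 ≠ 0 := by
    intro h0
    have : (⟨F, hFχ⟩ : PSSpace (k := k) χ) = 0 := by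
      apply e.toLinearEquiv.injective
      rw [map_zero]
      exact Subtype.ext h0
    exact hF0 (congrArg Subtype.val this)
  rcases eq_or_eq_of_ne_zero (e ⟨F, hFχ⟩).2 hF' hF0' with h | h
  · exact .inl h.symm
  · right
    rw [h, conjInv_conjInv]

/-- Pairing both sides with β' in the variable z isolates α'(z') on the right. On the left at most
one of α, β can equal β', and the other one is then α'. -/
theorem eq_or_eq_of_symm_sum_eq {H : Type*} [CommGroup H] [Fintype H] {α β α' β' : H →* ℂˣ}
    (hαβ : α ≠ β) (hαβ' : α' ≠ β')
    (h : ∀ z z', (α z : ℂ) * β z' + β z * α z' = α' z * β' z' + β' z * α' z') :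
    (α' = α ∧ β' = β) ∨ (α' = β ∧ β' = α) := by
  classical
  have hH : (Fintype.card H : ℂ) ≠ 0 := by simp
  have horth : ∀ φ : H →* ℂˣ, ∑ z, (φ z : ℂ) * (β' z : ℂ)⁻¹ =
      if φ = β' then (Fintype.card H : ℂ) else 0 := by
    intro φ
    have h1 := sum_char (φ / β')
    have h2 : φ / β' = 1 ↔ φ = β' := by
      constructor
      · intro h0
        ext z
        have h3 : φ z / β' z = 1 := DFunLike.congr_fun h0 z
        rw [div_eq_one.1 h3]
      · rintro rfl
        ext z
        simp
    simp only [h2] at h1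
    rw [← h1]
    exact Finset.sum_congr rfl fun z _ => by simp [div_eq_mul_inv]
  have hsum : ∀ z', (if α = β' then (Fintype.card H : ℂ) else 0) * β z' +
      (if β = β' then (Fintype.card H : ℂ) else 0) * α z' = Fintype.card H * α' z' := by
    intro z'
    have h1 : ∑ z, ((α z : ℂ) * β z' + β z * α z') * (β' z : ℂ)⁻¹ =
        ∑ z, ((α' z : ℂ) * β' z' + β' z * α' z') * (β' z : ℂ)⁻¹ :=
      Finset.sum_congr rfl fun z _ => by rw [h]
    have h2 : ∀ φ φ' : H →* ℂˣ, ∑ z, ((φ z : ℂ) * φ' z' + φ' z * φ z') * (β' z : ℂ)⁻¹ =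
        (∑ z, (φ z : ℂ) * (β' z : ℂ)⁻¹) * φ' z' + (∑ z, (φ' z : ℂ) * (β' z : ℂ)⁻¹) * φ z' := by
      intro φ φ'
      rw [Finset.sum_mul, Finset.sum_mul, ← Finset.sum_add_distrib]
      exact Finset.sum_congr rfl fun z _ => by ring
    rw [h2, h2] at h1
    simp only [horth] at h1
    rw [h1, if_neg hαβ', if_pos trivial]
    ring
  by_cases h1 : α = β'
  · have h2 : β ≠ β' := fun h2 => hαβ (h1.trans h2.symm)
    right
    refine ⟨?_, h1.symm⟩
    ext z
    have := hsum z
    rw [if_pos h1, if_neg h2, zero_mul, add_zero] at this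
    exact (mul_left_cancel₀ hH this).symm
  · by_cases h2 : β = β'
    · left
      refine ⟨?_, h2.symm⟩
      ext z
      have := hsum z
      rw [if_neg h1, if_pos h2, zero_mul, zero_add] at this
      exact (mul_left_cancel₀ hH this).symm
    · exfalso
      have := hsum 1
      rw [if_neg h1, if_neg h2, zero_mul, zero_mul, add_zero] at this
      exact mul_ne_zero hH (Units.ne_zero _) this.symm

/-- Up to sign, the character on anisotropic elements is α(z)β(z') + β(z)α(z') with α = ημ⁻¹ and β =
η. Scalars supply the case z = z', so the unordered pair {α, β} is recovered. -/
theorem eq_or_eq_of_iso_cusp {ψ : AddChar k ℂ} (hψ : ψ ≠ 1) {μ η μ' η' : E1 k E →* ℂˣ}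
    (hμ : μ ≠ 1) (hμ' : μ' ≠ 1) (h : Iso (cusp ψ hψ μ η) (cusp ψ hψ μ' η')) :
    (μ', η') = (μ, η) ∨ (μ', η') = (μ⁻¹, η * μ⁻¹) := by
  obtain ⟨e⟩ := h
  have he := congrFun (Representation.char_iso e)
  have hne : ∀ {μ η : E1 k E →* ℂˣ}, μ ≠ 1 → η * μ⁻¹ ≠ η := by
    intro μ η hμ h0
    apply hμ
    ext z
    have h1 : η z * (μ z)⁻¹ = η z := DFunLike.congr_fun h0 z
    rw [mul_eq_left, inv_eq_one] at h1
    rw [h1]; rfl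
  have key : ∀ z z' : E1 k E, (η (z * z') : ℂ) * ((μ z : ℂ)⁻¹ + (μ z' : ℂ)⁻¹) =
      η' (z * z') * ((μ' z : ℂ)⁻¹ + (μ' z' : ℂ)⁻¹) := by
    intro z z'
    by_cases hz : z = z'
    · subst hz
      have h1 := he (diagU (z : Eˣ))
      rw [char_cusp_scalar hψ η hμ, char_cusp_scalar hψ η' hμ'] at h1
      have := mul_left_cancel₀ (card_sub_one_ne_zero k) h1
      linear_combination 2 * this
    · obtain ⟨g, hg⟩ := exists_aniso z z'
      have h1 := he g
      rw [char_cusp_aniso hψ η hμ hz hg, char_cusp_aniso hψ η' hμ' hz hg,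
        detU_of_hasEigenvalues hg] at h1
      exact neg_injective h1
  have hval : ∀ (μ η : E1 k E →* ℂˣ) (z : E1 k E),
      (((η * μ⁻¹) z : ℂˣ) : ℂ) = η z * (μ z : ℂ)⁻¹ := fun μ η z => by
    rw [← Units.val_inv_eq_inv_val]; rfl
  have := eq_or_eq_of_symm_sum_eq (hne hμ (η := η)) (hne hμ' (η := η')) fun z z' => by
    simp only [hval]
    have h1 := key z z'
    rw [map_mul, map_mul, Units.val_mul, Units.val_mul] at h1
    linear_combination h1
  rcases this with ⟨h1, h2⟩ | ⟨h1, h2⟩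
  · left
    subst h2
    refine Prod.ext ?_ rfl
    ext z
    have h3 : η' z * (μ' z)⁻¹ = η' z * (μ z)⁻¹ := DFunLike.congr_fun h1 z
    rw [inv_injective (mul_left_cancel h3)]
  · right
    refine Prod.ext ?_ h2
    subst h2
    ext z
    have h3 : η z * (μ z)⁻¹ * (μ' z)⁻¹ = η z := DFunLike.congr_fun h1 z
    have h4 : μ' z = (μ z)⁻¹ := by
      rw [mul_assoc, mul_eq_left, mul_inv_eq_one] at h3
      exact h3.symm
    rw [h4]; rfl

end Irreducible

/-! ## Sums over sets of representatives -/

section Representatives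

open scoped Classical in
-- Without fixed points S is the disjoint union of A and its image under σ, and σ matches the two
-- halves of the sum.
theorem IsRepresentatives.two_mul_sum {X : Type*} [Fintype X] {S : Set X} {σ : X → X} {A : Set X}
    (hA : IsRepresentatives S σ A) (hS : ∀ x ∈ S, σ x ∈ S) (hσ : ∀ x ∈ S, σ (σ x) = x)
    (hfix : ∀ x ∈ S, σ x ≠ x) (P : X → Prop) (hP : ∀ x ∈ S, P x → P (σ x)) (f : X → ℂ)
    (hf : ∀ x ∈ S, f (σ x) = f x) [Fintype {x // x ∈ A ∧ P x}] :
    2 * ∑ x : {x // x ∈ A ∧ P x}, f x = ∑ x with x ∈ S ∧ P x, f x := by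
  have h1 : ∑ x : {x // x ∈ A ∧ P x}, f x = ∑ x with x ∈ A ∧ P x, f x :=
    (Finset.sum_subtype _ (by simp) _).symm
  have hσA : ∀ x ∈ A, σ x ∉ A := by
    intro x hx hx'
    obtain ⟨a, -, ha⟩ := hA.existsUnique x (hA.subset hx)
    exact hfix x (hA.subset hx) ((ha _ ⟨hx', Or.inr rfl⟩).trans (ha _ ⟨hx, Or.inl rfl⟩).symm)
  have h2 : ∑ x with x ∈ A ∧ P x, f x = ∑ x with (x ∈ S ∧ P x) ∧ x ∉ A, f x := by
    refine Finset.sum_nbij' σ σ ?_ ?_ ?_ ?_ ?_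
    · intro x hx
      obtain ⟨hx, hx'⟩ := (Finset.mem_filter.1 hx).2
      simpa using ⟨⟨hS x (hA.subset hx), hP x (hA.subset hx) hx'⟩, hσA x hx⟩
    · intro x hx
      obtain ⟨⟨hx, hx'⟩, hxA⟩ := (Finset.mem_filter.1 hx).2
      obtain ⟨a, ⟨haA, rfl | rfl⟩, -⟩ := hA.existsUnique x hx
      · exact absurd haA hxA
      · simpa using ⟨haA, hP x hx hx'⟩
    · intro x hx
      exact hσ x (hA.subset (Finset.mem_filter.1 hx).2.1)
    · intro x hx
      exact hσ x (Finset.mem_filter.1 hx).2.1.1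
    · intro x hx
      exact (hf x (hA.subset (Finset.mem_filter.1 hx).2.1)).symm
  have h3 := Finset.sum_filter_add_sum_filter_not (Finset.univ.filter fun x => x ∈ S ∧ P x)
    (fun x => x ∈ A) f
  rw [Finset.filter_filter, Finset.filter_filter, ← h2] at h3
  rw [h1, two_mul, ← h3]
  congr 2
  ext x
  simp only [Finset.mem_filter, Finset.mem_univ, true_and]
  exact ⟨fun h => ⟨⟨hA.subset h.1, h.2⟩, h.1⟩, fun h => ⟨h.2, h.1.2⟩⟩

open scoped Classical in
theorem IsRepresentatives.two_mul_sum_univ {X : Type*} [Fintype X] {S : Set X} {σ : X → X}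
    {A : Set X} (hA : IsRepresentatives S σ A) (hS : ∀ x ∈ S, σ x ∈ S)
    (hσ : ∀ x ∈ S, σ (σ x) = x) (hfix : ∀ x ∈ S, σ x ≠ x) (f : X → ℂ)
    (hf : ∀ x ∈ S, f (σ x) = f x) [Fintype A] :
    2 * ∑ x : A, f x = ∑ x with x ∈ S, f x := by
  have h := hA.two_mul_sum hS hσ hfix (fun _ => True) (fun _ _ => id) f hf
  simp only [and_true] at h
  rw [← h]
  congr 1
  exact Fintype.sum_equiv (Equiv.subtypeEquivRight (by simp)) _ _ fun _ => rfl

end Representatives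

/-! ## Sums over pairs of characters of an abelian group -/

section PairSum

variable {H : Type*} [CommGroup H] [Fintype H]

theorem inv_ne_one_of_ne_one {μ : H →* ℂˣ} (h : μ ≠ 1) : μ⁻¹ ≠ 1 := by
  contrapose! h
  ext z
  have := DFunLike.congr_fun h z
  rw [MonoidHom.inv_apply, MonoidHom.one_apply, inv_eq_one] at this
  rw [this, MonoidHom.one_apply]

open scoped Classical in
theorem sum_ne_one_inv (z : H) :
    ∑ μ : H →* ℂˣ with μ ≠ 1, ((μ z)⁻¹ : ℂ) =
      (Fintype.card H : ℂ) * (if z = 1 then 1 else 0) - 1 := by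
  have h := Finset.sum_filter_add_sum_filter_not Finset.univ (fun μ : H →* ℂˣ => μ = 1)
    fun μ => ((μ z)⁻¹ : ℂ)
  rw [sum_dual_inv, Finset.filter_eq' Finset.univ (1 : H →* ℂˣ), if_pos (Finset.mem_univ _),
    Finset.sum_singleton] at h
  simp only [MonoidHom.one_apply, Units.val_one, inv_one] at h
  rw [mul_ite, mul_one, mul_zero, ← h]
  ring

open scoped Classical in
/-- The sum of `η(d) μ(z)⁻¹` over the pairs `(μ, η)` with `μ ≠ 1` that satisfy `P`. -/
def pairSum (P : (H →* ℂˣ) × (H →* ℂˣ) → Prop) (z d : H) : ℂ :=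
  ∑ p : (H →* ℂˣ) × (H →* ℂˣ) with p.1 ≠ 1 ∧ P p, (p.2 d : ℂ) * (p.1 z : ℂ)⁻¹

open scoped Classical in
-- The weight w stands for the indicator of P, written as a combination of point indicators in η so
-- that orthogonality evaluates the inner sum.
theorem pairSum_eq {P : (H →* ℂˣ) × (H →* ℂˣ) → Prop} (w : (H →* ℂˣ) → (H →* ℂˣ) → ℂ)
    (hw : ∀ μ η, μ ≠ 1 → P (μ, η) → w μ η = 1) (hw' : ∀ μ η, μ ≠ 1 → ¬ P (μ, η) → w μ η = 0)
    (z d : H) : pairSum P z d = ∑ μ : H →* ℂˣ with μ ≠ 1, (μ z : ℂ)⁻¹ *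
      ∑ η : H →* ℂˣ, (η d : ℂ) * w μ η := by
  rw [pairSum, Finset.sum_filter, Finset.sum_filter, Fintype.sum_prod_type]
  refine Finset.sum_congr rfl fun μ _ => ?_
  by_cases h : μ = 1
  · simp [h]
  · rw [if_pos h, Finset.mul_sum]
    refine Finset.sum_congr rfl fun η _ => ?_
    by_cases h' : P (μ, η)
    · simp [h, h', hw μ η h h', mul_comm]
    · simp [h', hw' μ η h h']

open scoped Classical in
theorem pairSum_true (z d : H) : pairSum (fun _ => True) z d =
    ((Fintype.card H : ℂ) * (if z = 1 then 1 else 0) - 1) *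
      (Fintype.card H * if d = 1 then 1 else 0) := by
  rw [pairSum_eq (fun _ _ => 1) (by simp) (by simp)]
  simp only [mul_one]
  rw [← Finset.sum_mul, sum_ne_one_inv, sum_dual]
  simp

open scoped Classical in
theorem sum_ne_one_inv_mul (z z' : H) :
    ∑ μ : H →* ℂˣ with μ ≠ 1, ((μ z)⁻¹ : ℂ) * μ (z * z') =
      (Fintype.card H : ℂ) * (if z' = 1 then 1 else 0) - 1 := by
  have h := sum_ne_one_inv z'⁻¹
  simp only [inv_eq_one] at h
  rw [← h]
  refine Finset.sum_congr rfl fun μ _ => ?_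
  have : (μ z : ℂ) ≠ 0 := Units.ne_zero _
  simp [this]

open scoped Classical in
-- The two excluded values η = 1 and η = μ are distinct because μ ≠ 1, so each is subtracted once.
-- The second contributes μ(z)⁻¹μ(zz') = μ(z').
theorem pairSum_ne_ne (z z' : H) : pairSum (fun p => p.2 ≠ 1 ∧ p.2 ≠ p.1) z (z * z') =
    ((Fintype.card H : ℂ) * (if z = 1 then 1 else 0) - 1) *
      (Fintype.card H * (if z * z' = 1 then 1 else 0) - 1) -
        (Fintype.card H * (if z' = 1 then 1 else 0) - 1) := by
  rw [pairSum_eq (fun μ η => 1 - (if η = 1 then 1 else 0) - (if η = μ then 1 else 0)),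
    ← sum_ne_one_inv_mul z z', ← sum_ne_one_inv z, Finset.sum_mul, ← Finset.sum_sub_distrib]
  · refine Finset.sum_congr rfl fun μ hμ => ?_
    simp only [mul_sub, Finset.sum_sub_distrib, mul_one, sum_dual, mul_ite, mul_zero,
      Finset.sum_ite_eq', Finset.mem_univ, if_true, MonoidHom.one_apply, Units.val_one]
  · rintro μ η - ⟨h, h'⟩
    simp_all
  · intro μ η hμ h
    dsimp only at h
    by_cases h1 : η = 1
    · simp [h1, hμ.symm]
    · have h2 : η = μ := by tauto
      simp [h2, hμ]

theorem inv_mul_eq_one_iff (μ₁ μ : H →* ℂˣ) : μ₁⁻¹ * μ = 1 ↔ μ = μ₁ := by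
  constructor
  · intro h
    ext z
    have := DFunLike.congr_fun h z
    rw [MonoidHom.mul_apply, MonoidHom.inv_apply, MonoidHom.one_apply, inv_mul_eq_one] at this
    rw [this]
  · rintro rfl
    ext z
    simp

/-- Inclusion and exclusion for four forbidden values among which only e = a and b = c may coincide;
the two added terms undo the double subtraction. -/
theorem indicator_eq {X : Type*} [DecidableEq X] {a b c e : X} (hab : a ≠ b) (hac : a ≠ c) (hbe : b ≠ e)
    (hce : c ≠ e) (x : X) (p : Prop) [Decidable p] (hp : p ↔ x ≠ a ∧ x ≠ b ∧ x ≠ c ∧ x ≠ e) :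
    1 - (if x = a then 1 else 0) - (if x = b then 1 else 0) - (if x = c then 1 else 0) -
      (if x = e then 1 else 0) + (if e = a then (if x = a then 1 else 0) else 0) +
      (if b = c then (if x = c then 1 else 0) else 0) = (if p then 1 else 0 : ℂ) := by
  by_cases h1 : x = a
  · subst h1
    by_cases h : e = x
    · subst h
      simp [hp, hab, hac]
    · simp [hp, hab, hac, h, Ne.symm h]
  · by_cases h2 : x = b
    · subst h2
      by_cases h : x = c
      · subst h
        simp [hp, h1, hbe]
      · simp [hp, h1, hbe, h]
    · by_cases h3 : x = c
      · subst h3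
        simp [hp, h1, h2, hce, Ne.symm h2]
      · by_cases h4 : x = e
        · subst h4
          simp [hp, h1, h2, h3]
        · simp [hp, h1, h2, h3, h4]

open scoped Classical in
-- The forbidden values of η coincide only for μ = μ₁ (then μ₁⁻¹μ = 1) and for μ = μ₁⁻¹. These two
-- corrections produce the final terms μ₁(z)⁻¹ and μ₁(z')⁻¹.
theorem pairSum_ne_ne_ne_ne {μ₁ : H →* ℂˣ} (hμ₁ : μ₁ ≠ 1) (z z' : H) :
    pairSum (fun p => p.2 ≠ 1 ∧ p.2 ≠ p.1 ∧ p.2 ≠ μ₁⁻¹ ∧ p.2 ≠ μ₁⁻¹ * p.1) z (z * z') =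
    ((Fintype.card H : ℂ) * (if z = 1 then 1 else 0) - 1) *
      (Fintype.card H * (if z * z' = 1 then 1 else 0) - 1 - (μ₁ z : ℂ)⁻¹ * (μ₁ z' : ℂ)⁻¹) -
        (Fintype.card H * (if z' = 1 then 1 else 0) - 1) *
          (1 + (μ₁ z : ℂ)⁻¹ * (μ₁ z' : ℂ)⁻¹) + (μ₁ z : ℂ)⁻¹ + (μ₁ z' : ℂ)⁻¹ := by
  have hμ₁' := inv_ne_one_of_ne_one hμ₁
  have key : ∀ μ η : H →* ℂˣ, μ ≠ 1 → _ := fun μ η hμ =>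
    indicator_eq (a := 1) (b := μ) (c := μ₁⁻¹) (e := μ₁⁻¹ * μ) hμ.symm hμ₁'.symm
      (fun h => hμ₁' (by
        ext z
        have := DFunLike.congr_fun h z
        rw [MonoidHom.mul_apply, eq_comm, mul_eq_right] at this
        rw [this, MonoidHom.one_apply]))
      (fun h => hμ (by
        ext z
        have := DFunLike.congr_fun h z
        rw [MonoidHom.mul_apply, eq_comm, mul_eq_left] at this
        rw [this, MonoidHom.one_apply])) η _ Iff.rfl
  rw [pairSum_eq (fun μ η => 1 - (if η = 1 then 1 else 0) - (if η = μ then 1 else 0) -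
      (if η = μ₁⁻¹ then 1 else 0) - (if η = μ₁⁻¹ * μ then 1 else 0) +
      (if μ₁⁻¹ * μ = 1 then (if η = 1 then 1 else 0) else 0) +
      (if μ = μ₁⁻¹ then (if η = μ₁⁻¹ then 1 else 0) else 0))
      (fun μ η hμ h => by rw [key μ η hμ, if_pos h])
      (fun μ η hμ h => by rw [key μ η hμ, if_neg h]),
    ← sum_ne_one_inv_mul z z', ← sum_ne_one_inv z]
  have h2 : ∀ μ : H →* ℂˣ, μ ≠ 1 → (μ z : ℂ)⁻¹ * ∑ η : H →* ℂˣ, (η (z * z') : ℂ) *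
      (1 - (if η = 1 then 1 else 0) - (if η = μ then 1 else 0) -
      (if η = μ₁⁻¹ then 1 else 0) - (if η = μ₁⁻¹ * μ then 1 else 0) +
      (if μ₁⁻¹ * μ = 1 then (if η = 1 then 1 else 0) else 0) +
      (if μ = μ₁⁻¹ then (if η = μ₁⁻¹ then 1 else 0) else 0)) =
      (μ z : ℂ)⁻¹ * (Fintype.card H * (if z * z' = 1 then 1 else 0) - 1 -
        (μ₁ z : ℂ)⁻¹ * (μ₁ z' : ℂ)⁻¹) -
      (μ z : ℂ)⁻¹ * μ (z * z') * (1 + (μ₁ z : ℂ)⁻¹ * (μ₁ z' : ℂ)⁻¹) +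
      (if μ = μ₁ then (μ₁ z : ℂ)⁻¹ else 0) + (if μ = μ₁⁻¹ then (μ₁ z' : ℂ)⁻¹ else 0) := by
    intro μ hμ
    have hz : (μ₁ z : ℂ) ≠ 0 := Units.ne_zero _
    have hz' : (μ₁ z' : ℂ) ≠ 0 := Units.ne_zero _
    have h0 : ∀ η₀ : H →* ℂˣ, ∑ η : H →* ℂˣ, (η (z * z') : ℂ) * (if η = η₀ then 1 else 0) =
        η₀ (z * z') := by simp
    have h3 : ∀ (c : Prop) [Decidable c] (η₀ : H →* ℂˣ), ∑ η : H →* ℂˣ, (η (z * z') : ℂ) *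
        (if c then (if η = η₀ then 1 else 0) else 0) = if c then (η₀ (z * z') : ℂ) else 0 := by
      intro c _ η₀
      split_ifs <;> simp
    simp only [mul_add, mul_sub, Finset.sum_sub_distrib, Finset.sum_add_distrib,
      h0, h3, mul_one, sum_dual, inv_mul_eq_one_iff]
    have h4 : (μ z : ℂ)⁻¹ * (if μ = μ₁ then (((1 : H →* ℂˣ) (z * z') : ℂˣ) : ℂ) else 0) =
        if μ = μ₁ then (μ₁ z : ℂ)⁻¹ else 0 := by
      split_ifs with h
      · simp [h]
      · simp
    have h5 : (μ z : ℂ)⁻¹ * (if μ = μ₁⁻¹ then ((μ₁⁻¹ (z * z') : ℂˣ) : ℂ) else 0) =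
        if μ = μ₁⁻¹ then (μ₁ z' : ℂ)⁻¹ else 0 := by
      split_ifs with h
      · simp [h]; field_simp
      · simp
    have h6 : (if z * z' = 1 then (Fintype.card H : ℂ) else 0) =
        Fintype.card H * if z * z' = 1 then 1 else 0 := by simp
    rw [h4, h5, h6]
    simp only [MonoidHom.one_apply, MonoidHom.inv_apply, MonoidHom.mul_apply, map_mul,
      Units.val_mul, Units.val_inv_eq_inv_val, Units.val_one]
    ring
  rw [Finset.sum_congr rfl fun μ hμ => h2 μ (Finset.mem_filter.1 hμ).2]
  rw [Finset.sum_add_distrib, Finset.sum_add_distrib, Finset.sum_sub_distrib, ← Finset.sum_mul,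
    ← Finset.sum_mul]
  congr 1
  · congr 1
    rw [Finset.sum_ite_eq', if_pos (by simpa using hμ₁)]
  · rw [Finset.sum_ite_eq', if_pos (by simpa using hμ₁')]

end PairSum

/-! ## Character sums over the families of representations -/

section FamilySums

variable {k E : Type*} [Field k] [Fintype k] [Field E] [Fintype E] [Algebra k E]
  [Algebra.IsQuadraticExtension k E] [NeZero (2 : k)]

/-- The equality χ(x̄)⁻¹ = χ(x) says χ(Nm x) = 1, and norms exhaust kˣ. Hence the involution has no
fixed points on the characters represented by A. -/
theorem conjInv_eq_self_iff (χ : Eˣ →* ℂˣ) :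
    conjInv k χ = χ ↔ χ.comp (Units.map (algebraMap k E : k →* E)) = 1 := by
  have h : ∀ x : Eˣ, Units.map (algebraMap k E : k →* E) (Units.map (Algebra.norm k : E →* k) x) =
      x * Units.map (conj k E : E →* E) x := fun x => Units.ext (conj_mul_self (k := k) (x : E)).symm
  have h' : ∀ x : Eˣ, conjInv k χ x = χ x ↔ χ (Units.map (algebraMap k E : k →* E)
      (Units.map (Algebra.norm k : E →* k) x)) = 1 := by
    intro x
    rw [h, map_mul]
    change (χ (Units.map (conj k E : E →* E) x))⁻¹ = χ x ↔ _
    rw [inv_eq_iff_mul_eq_one, mul_comm]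
  constructor
  · intro hχ
    refine MonoidHom.ext fun c => ?_
    obtain ⟨x, rfl⟩ := FiniteField.unitsMap_norm_surjective k E c
    exact (h' x).1 (DFunLike.congr_fun hχ x)
  · intro hχ
    exact MonoidHom.ext fun x => (h' x).2 (DFunLike.congr_fun hχ _)

theorem char_ps_conjInv (χ : Eˣ →* ℂˣ) (g : U2 k E) :
    (ps k (conjInv k χ)).character g = (ps k χ).character g := by
  induction g using type_induction with
  | scalar z => rw [char_ps_scalar, char_ps_scalar, conjInv_E1]
  | unip g z hg h => rw [char_ps_unip _ hg h, char_ps_unip _ hg h, conjInv_E1]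
  | split g x hx h => rw [char_ps_split _ hx h, char_ps_split _ hx h, conjInv_conjInv, add_comm]
  | aniso g z z' hz h => rw [char_ps_aniso _ hz h, char_ps_aniso _ hz h]

/-! ### Sums of principal series characters over A -/

section PrincipalSeries

variable {A : Set (Eˣ →* ℂˣ)}

open scoped Classical in
theorem IsRepsA.two_mul_sum (hA : IsRepsA k A) [Fintype A] (g : U2 k E) :
    2 * ∑ χ : A, (ps k χ.1).character g =
      ∑ χ : Eˣ →* ℂˣ with χ.comp (Units.map (algebraMap k E : k →* E)) ≠ 1,
        (ps k χ).character g := by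
  refine (IsRepresentatives.two_mul_sum_univ hA ?_ (fun χ _ => conjInv_conjInv χ)
    (fun χ h h' => h ((conjInv_eq_self_iff χ).1 h')) (fun χ => (ps k χ).character g)
    fun χ _ => char_ps_conjInv χ g).trans (by congr)
  intro χ h h'
  rw [← conjInv_eq_self_iff, conjInv_conjInv] at h'
  exact h ((conjInv_eq_self_iff χ).1 h'.symm)

/-- Exactly one element of A is χ₁ or its conjugate inverse, and its principal series has the same
character as I(χ₁). -/
theorem IsRepsA.sum_erase (hA : IsRepsA k A) [Fintype A] {χ₁ : Eˣ →* ℂˣ}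
    [Fintype {χ : Eˣ →* ℂˣ // χ ∈ A ∧ χ ≠ χ₁ ∧ χ ≠ conjInv k χ₁}]
    (h₁ : χ₁ ≠ conjInv k χ₁) (g : U2 k E) :
    ∑ χ : {χ : Eˣ →* ℂˣ // χ ∈ A ∧ χ ≠ χ₁ ∧ χ ≠ conjInv k χ₁}, (ps k χ.1).character g =
      ∑ χ : A, (ps k χ.1).character g - (ps k χ₁).character g := by
  classical
  obtain ⟨a, ⟨haA, ha⟩, hu⟩ := hA.existsUnique χ₁
    fun h => h₁ ((conjInv_eq_self_iff χ₁).2 h).symm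
  have h2 : (ps k χ₁).character g = (ps k a).character g := by
    rcases ha with rfl | rfl
    · rfl
    · rw [char_ps_conjInv]
  rw [h2, eq_sub_iff_add_eq,
    ← Finset.sum_subtype (Finset.univ.filter fun χ => χ ∈ A ∧ χ ≠ χ₁ ∧ χ ≠ conjInv k χ₁) (by simp)
      (fun χ => (ps k χ).character g),
    ← Finset.sum_subtype (Finset.univ.filter fun χ => χ ∈ A) (by simp)
      (fun χ => (ps k χ).character g),
    ← Finset.add_sum_erase (Finset.univ.filter fun χ => χ ∈ A) _ (a := a) (by simpa using haA),
    add_comm]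
  congr 2
  ext χ
  simp only [Finset.mem_filter, Finset.mem_univ, true_and, Finset.mem_erase]
  constructor
  · rintro ⟨h, h', h''⟩
    refine ⟨?_, h⟩
    rintro rfl
    exact ha.elim h' h''
  · rintro ⟨h, h'⟩
    exact ⟨h', fun h3 => h (hu χ ⟨h', Or.inl h3⟩), fun h3 => h (hu χ ⟨h', Or.inr h3⟩)⟩

open scoped Classical in
-- An element of E¹ lies in k exactly when z² = 1, because z/z̄ = z².
theorem sum_nontrivial_E1 (z : E1 k E) :
    (∑ χ : Eˣ →* ℂˣ with χ.comp (Units.map (algebraMap k E : k →* E)) ≠ 1, (χ (z : Eˣ) : ℂ)) =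
      ((Fintype.card k : ℂ) ^ 2 - 1) * (if z = 1 then 1 else 0) -
        (Fintype.card k + 1) * (if z * z = 1 then 1 else 0) := by
  rw [sum_dual_nontrivial]
  congr 1
  · simp
  · rw [mul_ite, mul_one, mul_zero]
    congr 1
    rw [← divConj_eq_one_iff, divConj_E1]

open scoped Classical in
theorem IsRepsA.two_mul_sum_scalar (hA : IsRepsA k A) [Fintype A] (z : E1 k E) :
    2 * ∑ χ : A, (ps k χ.1).character (diagU (z : Eˣ)) =
      (Fintype.card k + 1) * (((Fintype.card k : ℂ) ^ 2 - 1) * (if z = 1 then 1 else 0) -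
        (Fintype.card k + 1) * (if z * z = 1 then 1 else 0)) := by
  rw [hA.two_mul_sum, ← sum_nontrivial_E1, Finset.mul_sum]
  exact Finset.sum_congr rfl fun χ _ => char_ps_scalar χ z

open scoped Classical in
theorem IsRepsA.two_mul_sum_unip (hA : IsRepsA k A) [Fintype A] {g : U2 k E} {z : E1 k E}
    (hg : ∀ z' : E1 k E, g ≠ diagU (z' : Eˣ)) (h : HasEigenvalues g (z : Eˣ) (z : Eˣ)) :
    2 * ∑ χ : A, (ps k χ.1).character g =
      ((Fintype.card k : ℂ) ^ 2 - 1) * (if z = 1 then 1 else 0) -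
        (Fintype.card k + 1) * (if z * z = 1 then 1 else 0) := by
  rw [hA.two_mul_sum, ← sum_nontrivial_E1]
  exact Finset.sum_congr rfl fun χ _ => char_ps_unip χ hg h

open scoped Classical in
-- The values χ(x) and χ(x̄⁻¹) are summed separately. Neither argument is 1, as x is not in E¹, and
-- both lie in k or neither does.
theorem IsRepsA.two_mul_sum_split (hA : IsRepsA k A) [Fintype A] {g : U2 k E} {x : Eˣ}
    (hx : x ∉ E1 k E) (h : HasEigenvalues g x (conj k E (x : E))⁻¹) :
    2 * ∑ χ : A, (ps k χ.1).character g =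
      -2 * (Fintype.card k + 1) * (if divConj k E x = 1 then 1 else 0) := by
  have hx1 : ∀ y : Eˣ, y ∉ E1 k E → y ≠ 1 := fun y hy h => hy (h ▸ one_mem _)
  let y : Eˣ := (Units.map (conj k E : E →* E) x)⁻¹
  have hxy : x = (Units.map (conj k E : E →* E) y)⁻¹ := by
      rw [← map_inv, inv_inv]
      exact Units.ext (conj_conj (x : E)).symm
  have hyx : conj k E (y : E) = y ↔ conj k E (x : E) = x := by
    have : (y : E) = (conj k E (x : E))⁻¹ := by simp [y]
    rw [this, map_inv₀, conj_conj, inv_inj, eq_comm]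
  have hy : y ≠ 1 := by
    intro h
    apply hx1 x hx
    rw [hxy, h]
    simp
  rw [hA.two_mul_sum, Finset.sum_congr rfl fun χ _ => char_ps_split χ hx h,
    Finset.sum_add_distrib]
  have h2 : ∀ χ : Eˣ →* ℂˣ, conjInv k χ x = χ y := fun χ => (map_inv χ _).symm
  simp only [h2]
  rw [sum_dual_nontrivial, sum_dual_nontrivial, if_neg (hx1 x hx), if_neg hy]
  simp only [hyx, divConj_eq_one_iff]
  by_cases h3 : conj k E (x : E) = x
  · rw [if_pos h3, if_pos h3]; ring
  · rw [if_neg h3, if_neg h3]; ring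

theorem sum_ps_aniso {ι : Type*} [Fintype ι] (f : ι → Eˣ →* ℂˣ) {g : U2 k E} {z z' : E1 k E}
    (hz : z ≠ z') (h : HasEigenvalues g (z : Eˣ) (z' : Eˣ)) :
    ∑ i, (ps k (f i)).character g = 0 :=
  Finset.sum_eq_zero fun i _ => char_ps_aniso (f i) hz h

end PrincipalSeries

/-! ### Sums of cuspidal characters over B -/

section Cuspidal

variable {ψ : AddChar k ℂ} (hψ : ψ ≠ 1)

/-- As det g = zz', one has (ημ⁻¹)(zz')μ(z) = η(zz')μ(z')⁻¹: the change of parameters only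
interchanges the two eigenvalues. -/
theorem char_cusp_inv {μ : E1 k E →* ℂˣ} (hμ : μ ≠ 1) (η : E1 k E →* ℂˣ) (g : U2 k E) :
    (cusp ψ hψ μ⁻¹ (η * μ⁻¹)).character g = (cusp ψ hψ μ η).character g := by
  have hμ' := inv_ne_one_of_ne_one hμ
  have h0 : ∀ z, (μ z : ℂ) ≠ 0 := fun z => Units.ne_zero _
  induction g using type_induction with
  | scalar z =>
    have := h0 z
    rw [char_cusp_scalar hψ _ hμ', char_cusp_scalar hψ _ hμ]
    simp only [MonoidHom.mul_apply, MonoidHom.inv_apply, map_mul, Units.val_mul,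
      Units.val_inv_eq_inv_val]
    field_simp
  | unip g z hg h =>
    have := h0 z
    rw [char_cusp_unip hψ _ hμ' hg h, char_cusp_unip hψ _ hμ hg h, detU_of_hasEigenvalues h]
    simp only [MonoidHom.mul_apply, MonoidHom.inv_apply, map_mul, Units.val_mul,
      Units.val_inv_eq_inv_val]
    field_simp
  | split g x hx h => rw [char_cusp_split hψ _ hμ' hx h, char_cusp_split hψ _ hμ hx h]
  | aniso g z z' hz h =>
    have := h0 z
    have := h0 z'
    rw [char_cusp_aniso hψ _ hμ' hz h, char_cusp_aniso hψ _ hμ hz h, detU_of_hasEigenvalues h]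
    simp only [MonoidHom.mul_apply, MonoidHom.inv_apply, map_mul, Units.val_mul,
      Units.val_inv_eq_inv_val]
    field_simp
    ring

variable {B : Set ((E1 k E →* ℂˣ) × (E1 k E →* ℂˣ))}
  {P : (E1 k E →* ℂˣ) × (E1 k E →* ℂˣ) → Prop}

open scoped Classical in
theorem IsRepsB.two_mul_sum (hB : IsRepsB B) (hP : ∀ p, p.1 ≠ 1 → P p → P (p.1⁻¹, p.2 * p.1⁻¹))
    [Fintype {p // p ∈ B ∧ P p}] (g : U2 k E) :
    2 * ∑ p : {p // p ∈ B ∧ P p}, (cusp ψ hψ p.1.1 p.1.2).character g =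
      ∑ p : (E1 k E →* ℂˣ) × (E1 k E →* ℂˣ) with p.1 ≠ 1 ∧ P p,
        (cusp ψ hψ p.1 p.2).character g := by
  refine (IsRepresentatives.two_mul_sum hB (fun p hp => inv_ne_one_of_ne_one hp) ?_ ?_ P hP
    (fun p => (cusp ψ hψ p.1 p.2).character g) fun p hp => char_cusp_inv hψ hp p.2 g).trans
    (by congr)
  · rintro ⟨μ, η⟩ -
    refine Prod.ext ?_ ?_ <;> ext z <;> simp
  · rintro ⟨μ, η⟩ hμ h
    apply hμ
    ext z
    have := DFunLike.congr_fun (congrArg Prod.snd h) z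
    simp only [MonoidHom.mul_apply, MonoidHom.inv_apply, mul_eq_left, inv_eq_one] at this
    rw [this, MonoidHom.one_apply]

theorem IsRepsB.two_mul_sum_scalar (hB : IsRepsB B)
    (hP : ∀ p, p.1 ≠ 1 → P p → P (p.1⁻¹, p.2 * p.1⁻¹)) [Fintype {p // p ∈ B ∧ P p}] (z : E1 k E) :
    2 * ∑ p : {p // p ∈ B ∧ P p}, (cusp ψ hψ p.1.1 p.1.2).character (diagU (z : Eˣ)) =
      ((Fintype.card k : ℂ) - 1) * pairSum P z (z * z) := by
  classical
  rw [hB.two_mul_sum hψ hP, pairSum, Finset.mul_sum]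
  exact Finset.sum_congr rfl fun p hp =>
    char_cusp_scalar hψ _ (Finset.mem_filter.1 hp).2.1 z

theorem IsRepsB.two_mul_sum_unip (hB : IsRepsB B)
    (hP : ∀ p, p.1 ≠ 1 → P p → P (p.1⁻¹, p.2 * p.1⁻¹)) [Fintype {p // p ∈ B ∧ P p}]
    {g : U2 k E} {z : E1 k E}
    (hg : ∀ z' : E1 k E, g ≠ diagU (z' : Eˣ)) (h : HasEigenvalues g (z : Eˣ) (z : Eˣ)) :
    2 * ∑ p : {p // p ∈ B ∧ P p}, (cusp ψ hψ p.1.1 p.1.2).character g = -pairSum P z (z * z) := by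
  classical
  rw [hB.two_mul_sum hψ hP, pairSum, ← Finset.sum_neg_distrib, ← detU_of_hasEigenvalues h]
  exact Finset.sum_congr rfl fun p hp =>
    char_cusp_unip hψ _ (Finset.mem_filter.1 hp).2.1 hg h

theorem IsRepsB.sum_split (hB : IsRepsB B) [Fintype {p // p ∈ B ∧ P p}]
    {g : U2 k E} {x : Eˣ}
    (hx : x ∉ E1 k E) (h : HasEigenvalues g x (conj k E (x : E))⁻¹) :
    ∑ p : {p // p ∈ B ∧ P p}, (cusp ψ hψ p.1.1 p.1.2).character g = 0 :=
  Finset.sum_eq_zero fun p _ => char_cusp_split hψ _ (hB.subset p.2.1) hx h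

theorem IsRepsB.two_mul_sum_aniso (hB : IsRepsB B)
    (hP : ∀ p, p.1 ≠ 1 → P p → P (p.1⁻¹, p.2 * p.1⁻¹)) [Fintype {p // p ∈ B ∧ P p}]
    {g : U2 k E} {z z' : E1 k E} (hz : z ≠ z') (h : HasEigenvalues g (z : Eˣ) (z' : Eˣ)) :
    2 * ∑ p : {p // p ∈ B ∧ P p}, (cusp ψ hψ p.1.1 p.1.2).character g =
      -(pairSum P z (z * z') + pairSum P z' (z' * z)) := by
  classical
  rw [hB.two_mul_sum hψ hP, pairSum, pairSum, ← Finset.sum_add_distrib, ← Finset.sum_neg_distrib,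
    mul_comm z' z, ← detU_of_hasEigenvalues h]
  refine Finset.sum_congr rfl fun p hp => ?_
  rw [char_cusp_aniso hψ _ (Finset.mem_filter.1 hp).2.1 hz h]
  ring

end Cuspidal

end FamilySums

/-! ### Characters of sums and tensor products -/

section HasCharacter

variable {G : Type*} [Group G]

/-- The representation `ρ` has character `f`. -/
def HasCharacter {V : Type*} [AddCommMonoid V] [Module ℂ V] (ρ : Representation ℂ G V)
    (f : G → ℂ) : Prop :=
  ∀ g, LinearMap.trace ℂ V (ρ g) = f g

theorem hasCharacter_character {V : Type*} [AddCommGroup V] [Module ℂ V]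
    (ρ : Representation ℂ G V) : HasCharacter ρ ρ.character := fun _ => rfl

/-- Only additive monoids are assumed, so that nested sums and tensor products compose freely;
negation is recovered from the scalar -1. -/
theorem HasCharacter.prod {V W : Type*} [AddCommMonoid V] [Module ℂ V] [Module.Finite ℂ V]
    [AddCommMonoid W] [Module ℂ W] [Module.Finite ℂ W] {ρ : Representation ℂ G V}
    {σ : Representation ℂ G W} {f f' : G → ℂ} (h : HasCharacter ρ f) (h' : HasCharacter σ f') :
    HasCharacter (ρ.prod σ) (f + f') := by
  let _ := Module.addCommMonoidToAddCommGroup ℂ (M := V)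
  let _ := Module.addCommMonoidToAddCommGroup ℂ (M := W)
  intro g
  rw [Pi.add_apply, ← h, ← h']
  exact char_prod (V := V) (W := W) ρ σ g

theorem HasCharacter.directSum {ι : Type*} [Fintype ι] {V : ι → Type*} [∀ i, AddCommMonoid (V i)]
    [∀ i, Module ℂ (V i)] [∀ i, Module.Finite ℂ (V i)]
    {ρ : ∀ i, Representation ℂ G (V i)} {f : ι → G → ℂ} (h : ∀ i, HasCharacter (ρ i) (f i)) :
    HasCharacter (Representation.directSum ρ) (fun g => ∑ i, f i g) := by
  let _ := fun i => Module.addCommMonoidToAddCommGroup ℂ (M := V i)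
  intro g
  simp only [← h _ g]
  exact char_directSum (V := V) ρ g

theorem HasCharacter.tprod {V W : Type*} [AddCommMonoid V] [Module ℂ V] [Module.Finite ℂ V]
    [AddCommMonoid W] [Module ℂ W] [Module.Finite ℂ W] {ρ : Representation ℂ G V}
    {σ : Representation ℂ G W} {f f' : G → ℂ} (h : HasCharacter ρ f) (h' : HasCharacter σ f') :
    HasCharacter (ρ.tprod σ) (f * f') := by
  let _ := Module.addCommMonoidToAddCommGroup ℂ (M := V)
  let _ := Module.addCommMonoidToAddCommGroup ℂ (M := W)
  intro g
  rw [Pi.mul_apply, ← h, ← h']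
  exact LinearMap.trace_tensorProduct' (ρ g) (σ g)

theorem HasCharacter.iso [Fintype G] {V W : Type*} [AddCommMonoid V] [Module ℂ V]
    [Module.Finite ℂ V] [AddCommMonoid W] [Module ℂ W] [Module.Finite ℂ W]
    {ρ : Representation ℂ G V} {σ : Representation ℂ G W} {f f' : G → ℂ} (h : HasCharacter ρ f)
    (h' : HasCharacter σ f') (hf : ∀ g, f g = f' g) : Iso ρ σ := by
  let _ := Module.addCommMonoidToAddCommGroup ℂ (M := V)
  let _ := Module.addCommMonoidToAddCommGroup ℂ (M := W)
  exact iso_of_character_eq (V := V) (W := W)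
    (funext fun g => (h g).trans ((hf g).trans (h' g).symm))

end HasCharacter

/-! ## The tensor products with the Weil representation -/

section Decomposition

variable {k E : Type*} [Field k] [Fintype k] [Field E] [Fintype E] [Algebra k E]
  [Algebra.IsQuadraticExtension k E] [NeZero (2 : k)] {ψ : AddChar k ℂ} (hψ : ψ ≠ 1)

open scoped Classical in
theorem sum_steinbergTwist (g : U2 k E) :
    ∑ η : E1 k E →* ℂˣ, (steinbergTwist η).character g =
      (Fintype.card k + 1) * (if detU g = 1 then 1 else 0) *
        ((ps k (1 : Eˣ →* ℂˣ)).character g - 1) := by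
  simp only [char_steinbergTwist]
  rw [← Finset.sum_mul, sum_dual, card_E1]
  simp

open scoped Classical in
theorem sum_steinbergTwist_ne_ne {η₁ : E1 k E →* ℂˣ} (h₁ : η₁ ≠ 1)
    [Fintype {η : E1 k E →* ℂˣ // η ≠ 1 ∧ η ≠ η₁}] (g : U2 k E) :
    ∑ η : {η : E1 k E →* ℂˣ // η ≠ 1 ∧ η ≠ η₁}, (steinbergTwist η.1).character g =
      ((Fintype.card k + 1) * (if detU g = 1 then 1 else 0) - 1 - η₁ (detU g)) *
        ((ps k (1 : Eˣ →* ℂˣ)).character g - 1) := by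
  have h2 := sum_steinbergTwist g
  rw [← Finset.add_sum_erase _ _ (Finset.mem_univ (1 : E1 k E →* ℂˣ)),
    ← Finset.add_sum_erase _ _ (Finset.mem_erase.2 ⟨h₁, Finset.mem_univ η₁⟩),
    char_steinbergTwist, char_steinbergTwist] at h2
  rw [← Finset.sum_subtype ((Finset.univ.erase (1 : E1 k E →* ℂˣ)).erase η₁)
    (by simp [and_comm]) (fun η => (steinbergTwist η).character g)]
  simp only [MonoidHom.one_apply, Units.val_one] at h2
  linear_combination h2

open scoped Classical in
-- This reflects the decomposition of functions on E under E¹, in which the E¹-invariant functions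
-- account for St.
theorem char_charRep_tensor_weil (η₁ : E1 k E →* ℂˣ)
    [Fintype {μ : E1 k E →* ℂˣ // μ ≠ 1}] (g : U2 k E) :
    (charRep η₁).character g * (weil ψ hψ).character g = (steinbergTwist η₁).character g +
      ∑ μ : {μ : E1 k E →* ℂˣ // μ ≠ 1}, (cusp ψ hψ μ.1 η₁).character g := by
  have hsum : ∀ F : (E1 k E →* ℂˣ) → ℂ, ∑ μ : {μ : E1 k E →* ℂˣ // μ ≠ 1}, F μ =
      ∑ μ : E1 k E →* ℂˣ with μ ≠ 1, F μ := fun F =>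
    (Finset.sum_subtype _ (by simp) _).symm
  rw [hsum fun μ => (cusp ψ hψ μ η₁).character g, char_charRep, char_steinbergTwist]
  have hc : (Fintype.card (E1 k E) : ℂ) = Fintype.card k + 1 := card_E1
  induction g using type_induction with
  | scalar z =>
    rw [Finset.sum_congr rfl fun μ hμ => char_cusp_scalar hψ η₁ (Finset.mem_filter.1 hμ).2 z,
      ← Finset.mul_sum, ← Finset.mul_sum, sum_ne_one_inv, hc, char_weil_scalar hψ, char_ps_scalar,
      detU_diagU_eq, divConj_E1, MonoidHom.one_apply, Units.val_one]
    ring_nf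
  | unip g z hg h =>
    rw [Finset.sum_congr rfl fun μ hμ => char_cusp_unip hψ η₁ (Finset.mem_filter.1 hμ).2 hg h,
      Finset.sum_neg_distrib, ← Finset.mul_sum, sum_ne_one_inv, hc, char_weil_unip hψ hg h,
      char_ps_unip _ hg h, MonoidHom.one_apply, Units.val_one]
    ring_nf
  | split g x hx h =>
    rw [Finset.sum_congr rfl fun μ hμ => char_cusp_split hψ η₁ (Finset.mem_filter.1 hμ).2 hx h,
      Finset.sum_const_zero, char_weil_split hψ hx h,
      char_ps_split _ hx h]
    simp [conjInv]
  | aniso g z z' hz h =>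
    rw [Finset.sum_congr rfl fun μ hμ => char_cusp_aniso hψ η₁ (Finset.mem_filter.1 hμ).2 hz h,
      Finset.sum_neg_distrib, ← Finset.mul_sum, Finset.sum_add_distrib, sum_ne_one_inv,
      sum_ne_one_inv, hc, char_weil_aniso hψ hz h, char_ps_aniso _ hz h]
    ring_nf

variable {A : Set (Eˣ →* ℂˣ)} {B : Set ((E1 k E →* ℂˣ) × (E1 k E →* ℂˣ))}

theorem one_conjInv_one (x : Eˣ) :
    (((1 : Eˣ →* ℂˣ) x : ℂˣ) : ℂ) + (conjInv k (1 : Eˣ →* ℂˣ) x : ℂˣ) = 2 := by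
  simp [conjInv]; norm_num

/-- Restoring the erased orbit to A uses up one copy of I(χ₁), so the claim is that I(χ₁)(ω_ψ - 1)
equals the full sum over A, St_η and B. The left side does not depend on χ₁: it vanishes off
unipotent elements, is (q+1)(q²-1) at 1 and -(q+1) at the others. -/
theorem char_ps_tensor_weil (hA : IsRepsA k A) (hB : IsRepsB B) [Fintype A]
    [Fintype {p // p ∈ B ∧ True}] {χ₁ : Eˣ →* ℂˣ}
    [Fintype {χ : Eˣ →* ℂˣ // χ ∈ A ∧ χ ≠ χ₁ ∧ χ ≠ conjInv k χ₁}]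
    (h₁ : χ₁ ≠ conjInv k χ₁) (g : U2 k E) :
    (ps k χ₁).character g * (weil ψ hψ).character g =
      (ps k χ₁).character g + (ps k χ₁).character g +
        (∑ χ : {χ : Eˣ →* ℂˣ // χ ∈ A ∧ χ ≠ χ₁ ∧ χ ≠ conjInv k χ₁}, (ps k χ.1).character g +
        (∑ η : E1 k E →* ℂˣ, (steinbergTwist η).character g +
        ∑ p : {p // p ∈ B ∧ True}, (cusp ψ hψ p.1.1 p.1.2).character g)) := by
  classical
  have hc : (Fintype.card (E1 k E) : ℂ) = Fintype.card k + 1 := card_E1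
  have hP : ∀ p : (E1 k E →* ℂˣ) × (E1 k E →* ℂˣ), p.1 ≠ 1 → True → True := fun _ _ => id
  rw [hA.sum_erase h₁, sum_steinbergTwist]
  -- The sums over representatives are known after doubling.
  apply mul_left_cancel₀ (two_ne_zero (α := ℂ))
  induction g using type_induction with
  | scalar z =>
    have hA' := hA.two_mul_sum_scalar z
    have hB' := hB.two_mul_sum_scalar hψ (P := fun _ => True) hP z
    rw [pairSum_true, hc] at hB'
    rw [char_weil_scalar hψ, char_ps_scalar, char_ps_scalar, detU_diagU_eq, divConj_E1,
      MonoidHom.one_apply, Units.val_one]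
    by_cases hz : z = 1
    · subst hz
      simp only [mul_one, if_true, OneMemClass.coe_one, map_one, Units.val_one] at hA' hB' ⊢
      linear_combination -hA' - hB'
    · by_cases hd : z * z = 1 <;> simp only [hz, hd, if_true, if_false] at hA' hB' ⊢ <;>
        linear_combination -hA' - hB'
  | unip g z hg h =>
    have hA' := hA.two_mul_sum_unip hg h
    have hB' := hB.two_mul_sum_unip hψ (P := fun _ => True) hP hg h
    rw [pairSum_true, hc] at hB'
    rw [char_weil_unip hψ hg h, char_ps_unip _ hg h, char_ps_unip _ hg h,
      detU_of_hasEigenvalues h, MonoidHom.one_apply, Units.val_one]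
    by_cases hz : z = 1
    · subst hz
      simp only [mul_one, if_true, OneMemClass.coe_one, map_one, Units.val_one] at hA' hB' ⊢
      linear_combination -hA' - hB'
    · by_cases hd : z * z = 1 <;> simp only [hz, hd, if_true, if_false] at hA' hB' ⊢ <;>
        linear_combination -hA' - hB'
  | split g x hx h =>
    have hA' := hA.two_mul_sum_split hx h
    rw [hB.sum_split hψ hx h, char_weil_split hψ hx h, char_ps_split _ hx h, char_ps_split _ hx h,
      detU_of_split h, one_conjInv_one]
    linear_combination -hA'
  | aniso g z z' hz h =>
    have hB' := hB.two_mul_sum_aniso hψ (P := fun _ => True) hP hz h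
    rw [pairSum_true, pairSum_true, hc, mul_comm z' z] at hB'
    rw [sum_ps_aniso _ hz h, char_weil_aniso hψ hz h, char_ps_aniso _ hz h, char_ps_aniso _ hz h,
      detU_of_hasEigenvalues h]
    -- The indicators are not independent: z and z' are distinct, so at most one is 1, and in that
    -- case zz' ≠ 1.
    by_cases h1 : z = 1
    · subst h1
      simp only [one_mul, if_true, Ne.symm hz, if_false] at hB' ⊢
      linear_combination -hB'
    · by_cases h2 : z' = 1
      · subst h2
        simp only [mul_one, if_true, hz, if_false] at hB' ⊢
        linear_combination -hB'
      · by_cases hd : z * z' = 1 <;> simp only [h1, h2, hd, if_true, if_false] at hB' ⊢ <;>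
          linear_combination -hB'

theorem char_steinberg_tensor_weil (hA : IsRepsA k A) (hB : IsRepsB B) [Fintype A]
    [Fintype {p // p ∈ B ∧ p.2 ≠ 1 ∧ p.2 ≠ p.1}] (g : U2 k E) :
    (steinberg k E).character g * (weil ψ hψ).character g =
      (charRep (1 : E1 k E →* ℂˣ)).character g + (∑ χ : A, (ps k χ.1).character g +
        (∑ η : E1 k E →* ℂˣ, (steinbergTwist η).character g +
        ∑ p : {p // p ∈ B ∧ p.2 ≠ 1 ∧ p.2 ≠ p.1}, (cusp ψ hψ p.1.1 p.1.2).character g)) := by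
  classical
  have hc : (Fintype.card (E1 k E) : ℂ) = Fintype.card k + 1 := card_E1
  -- The involution replaces η by ημ⁻¹ and μ by μ⁻¹, and so interchanges the two conditions.
  have hP : ∀ p : (E1 k E →* ℂˣ) × (E1 k E →* ℂˣ), p.1 ≠ 1 → p.2 ≠ 1 ∧ p.2 ≠ p.1 →
      p.2 * p.1⁻¹ ≠ 1 ∧ p.2 * p.1⁻¹ ≠ p.1⁻¹ := by
    rintro p - ⟨h, h'⟩
    refine ⟨fun h0 => h' ?_, fun h0 => h ?_⟩
    · ext z
      have := DFunLike.congr_fun h0 z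
      rw [MonoidHom.mul_apply, MonoidHom.inv_apply, MonoidHom.one_apply, mul_inv_eq_one] at this
      rw [this]
    · ext z
      have := DFunLike.congr_fun h0 z
      rw [MonoidHom.mul_apply, mul_eq_right] at this
      rw [this, MonoidHom.one_apply]
  rw [sum_steinbergTwist, char_steinberg, char_charRep]
  apply mul_left_cancel₀ (two_ne_zero (α := ℂ))
  induction g using type_induction with
  | scalar z =>
    have hA' := hA.two_mul_sum_scalar z
    have hB' := hB.two_mul_sum_scalar hψ (P := fun p => p.2 ≠ 1 ∧ p.2 ≠ p.1) hP z
    rw [pairSum_ne_ne, hc] at hB'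
    rw [char_weil_scalar hψ, char_ps_scalar, detU_diagU_eq, divConj_E1]
    simp only [MonoidHom.one_apply, Units.val_one]
    by_cases hz : z = 1
    · subst hz
      simp only [mul_one, if_true] at hA' hB' ⊢
      linear_combination -hA' - hB'
    · by_cases hd : z * z = 1 <;> simp only [hz, hd, if_true, if_false] at hA' hB' ⊢ <;>
        linear_combination -hA' - hB'
  | unip g z hg h =>
    have hA' := hA.two_mul_sum_unip hg h
    have hB' := hB.two_mul_sum_unip hψ (P := fun p => p.2 ≠ 1 ∧ p.2 ≠ p.1) hP hg h
    rw [pairSum_ne_ne, hc] at hB'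
    rw [char_weil_unip hψ hg h, char_ps_unip _ hg h,
      detU_of_hasEigenvalues h]
    simp only [MonoidHom.one_apply, Units.val_one]
    by_cases hz : z = 1
    · subst hz
      simp only [mul_one, if_true] at hA' hB' ⊢
      linear_combination -hA' - hB'
    · by_cases hd : z * z = 1 <;> simp only [hz, hd, if_true, if_false] at hA' hB' ⊢ <;>
        linear_combination -hA' - hB'
  | split g x hx h =>
    have hA' := hA.two_mul_sum_split hx h
    rw [hB.sum_split hψ hx h, char_weil_split hψ hx h, char_ps_split _ hx h,
      detU_of_split h, one_conjInv_one, MonoidHom.one_apply, Units.val_one]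
    linear_combination -hA'
  | aniso g z z' hz h =>
    have hB' := hB.two_mul_sum_aniso hψ (P := fun p => p.2 ≠ 1 ∧ p.2 ≠ p.1) hP hz h
    rw [pairSum_ne_ne, pairSum_ne_ne, hc, mul_comm z' z] at hB'
    rw [sum_ps_aniso _ hz h, char_weil_aniso hψ hz h, char_ps_aniso _ hz h,
      detU_of_hasEigenvalues h, MonoidHom.one_apply, Units.val_one]
    by_cases h1 : z = 1
    · subst h1
      simp only [one_mul, if_true, Ne.symm hz, if_false] at hB' ⊢
      linear_combination -hB'
    · by_cases h2 : z' = 1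
      · subst h2
        simp only [mul_one, if_true, hz, if_false] at hB' ⊢
        linear_combination -hB'
      · by_cases hd : z * z' = 1 <;> simp only [h1, h2, hd, if_true, if_false] at hB' ⊢ <;>
          linear_combination -hB'

theorem char_cusp_tensor_weil (hA : IsRepsA k A) (hB : IsRepsB B) [Fintype A]
    {μ₁ : E1 k E →* ℂˣ} (hμ₁ : μ₁ ≠ 1) [Fintype {η : E1 k E →* ℂˣ // η ≠ 1 ∧ η ≠ μ₁⁻¹}]
    [Fintype {p // p ∈ B ∧ p.2 ≠ 1 ∧ p.2 ≠ p.1 ∧ p.2 ≠ μ₁⁻¹ ∧ p.2 ≠ μ₁⁻¹ * p.1}] (g : U2 k E) :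
    (cusp ψ hψ μ₁ 1).character g * (weil ψ hψ).character g =
      (charRep (1 : E1 k E →* ℂˣ)).character g + ((charRep μ₁⁻¹).character g +
        (∑ χ : A, (ps k χ.1).character g +
        (∑ η : {η : E1 k E →* ℂˣ // η ≠ 1 ∧ η ≠ μ₁⁻¹}, (steinbergTwist η.1).character g +
        ∑ p : {p // p ∈ B ∧ p.2 ≠ 1 ∧ p.2 ≠ p.1 ∧ p.2 ≠ μ₁⁻¹ ∧ p.2 ≠ μ₁⁻¹ * p.1},
          (cusp ψ hψ p.1.1 p.1.2).character g))) := by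
  classical
  have hc : (Fintype.card (E1 k E) : ℂ) = Fintype.card k + 1 := card_E1
  -- The involution interchanges the first two conditions, and likewise the last two.
  have hP : ∀ p : (E1 k E →* ℂˣ) × (E1 k E →* ℂˣ), p.1 ≠ 1 →
      p.2 ≠ 1 ∧ p.2 ≠ p.1 ∧ p.2 ≠ μ₁⁻¹ ∧ p.2 ≠ μ₁⁻¹ * p.1 →
      p.2 * p.1⁻¹ ≠ 1 ∧ p.2 * p.1⁻¹ ≠ p.1⁻¹ ∧ p.2 * p.1⁻¹ ≠ μ₁⁻¹ ∧
        p.2 * p.1⁻¹ ≠ μ₁⁻¹ * p.1⁻¹ := by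
    rintro p - ⟨h, h', h'', h3⟩
    refine ⟨fun h0 => h' ?_, fun h0 => h ?_, fun h0 => h3 ?_, fun h0 => h'' ?_⟩ <;> ext z <;>
      have := DFunLike.congr_fun h0 z
    · rw [MonoidHom.mul_apply, MonoidHom.inv_apply, MonoidHom.one_apply, mul_inv_eq_one] at this
      rw [this]
    · rw [MonoidHom.mul_apply, mul_eq_right] at this
      rw [this, MonoidHom.one_apply]
    · rw [MonoidHom.mul_apply, MonoidHom.inv_apply, mul_inv_eq_iff_eq_mul] at this
      rw [this, MonoidHom.mul_apply]
    · rw [MonoidHom.mul_apply, MonoidHom.mul_apply, mul_left_inj] at this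
      rw [this]
  have h0 : ∀ z, (μ₁ z : ℂ) ≠ 0 := fun z => Units.ne_zero _
  rw [sum_steinbergTwist_ne_ne (inv_ne_one_of_ne_one hμ₁), char_charRep, char_charRep]
  apply mul_left_cancel₀ (two_ne_zero (α := ℂ))
  induction g using type_induction with
  | scalar z =>
    have hz0 := h0 z
    have hA' := hA.two_mul_sum_scalar z
    have hB' := hB.two_mul_sum_scalar hψ
      (P := fun p => p.2 ≠ 1 ∧ p.2 ≠ p.1 ∧ p.2 ≠ μ₁⁻¹ ∧ p.2 ≠ μ₁⁻¹ * p.1) hP z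
    rw [pairSum_ne_ne_ne_ne hμ₁, hc] at hB'
    rw [char_weil_scalar hψ, char_ps_scalar, char_cusp_scalar hψ _ hμ₁, detU_diagU_eq, divConj_E1]
    simp only [MonoidHom.one_apply, Units.val_one, MonoidHom.inv_apply, Units.val_inv_eq_inv_val,
      map_mul, Units.val_mul]
    by_cases hz : z = 1
    · subst hz
      simp only [mul_one, if_true, map_one, Units.val_one, inv_one] at hA' hB' ⊢
      linear_combination -hA' - hB'
    · by_cases hd : z * z = 1 <;> simp only [hz, hd, if_true, if_false] at hA' hB' ⊢ <;>
        linear_combination -hA' - hB'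
  | unip g z hg h =>
    have hA' := hA.two_mul_sum_unip hg h
    have hB' := hB.two_mul_sum_unip hψ
      (P := fun p => p.2 ≠ 1 ∧ p.2 ≠ p.1 ∧ p.2 ≠ μ₁⁻¹ ∧ p.2 ≠ μ₁⁻¹ * p.1) hP hg h
    rw [pairSum_ne_ne_ne_ne hμ₁, hc] at hB'
    rw [char_weil_unip hψ hg h, char_ps_unip _ hg h, char_cusp_unip hψ _ hμ₁ hg h,
      detU_of_hasEigenvalues h]
    simp only [MonoidHom.one_apply, Units.val_one, MonoidHom.inv_apply, Units.val_inv_eq_inv_val,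
      map_mul, Units.val_mul]
    by_cases hz : z = 1
    · subst hz
      simp only [mul_one, if_true, map_one, Units.val_one, inv_one] at hA' hB' ⊢
      linear_combination -hA' - hB'
    · by_cases hd : z * z = 1 <;> simp only [hz, hd, if_true, if_false] at hA' hB' ⊢ <;>
        linear_combination -hA' - hB'
  | split g x hx h =>
    have hA' := hA.two_mul_sum_split hx h
    rw [hB.sum_split hψ hx h, char_weil_split hψ hx h, char_ps_split _ hx h,
      char_cusp_split hψ _ hμ₁ hx h, detU_of_split h, one_conjInv_one, MonoidHom.one_apply,
      Units.val_one]
    linear_combination -hA'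
  | aniso g z z' hz h =>
    have hB' := hB.two_mul_sum_aniso hψ
      (P := fun p => p.2 ≠ 1 ∧ p.2 ≠ p.1 ∧ p.2 ≠ μ₁⁻¹ ∧ p.2 ≠ μ₁⁻¹ * p.1) hP hz h
    rw [pairSum_ne_ne_ne_ne hμ₁, pairSum_ne_ne_ne_ne hμ₁, hc, mul_comm z' z] at hB'
    rw [sum_ps_aniso _ hz h, char_weil_aniso hψ hz h, char_ps_aniso _ hz h,
      char_cusp_aniso hψ _ hμ₁ hz h, detU_of_hasEigenvalues h]
    simp only [MonoidHom.one_apply, Units.val_one, MonoidHom.inv_apply, Units.val_inv_eq_inv_val,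
      map_mul, Units.val_mul]
    by_cases h1 : z = 1
    · subst h1
      simp only [one_mul, if_true, Ne.symm hz, if_false, map_one, Units.val_one, inv_one] at hB' ⊢
      linear_combination -hB'
    · by_cases h2 : z' = 1
      · subst h2
        simp only [mul_one, if_true, hz, if_false, map_one, Units.val_one, inv_one] at hB' ⊢
        linear_combination -hB'
      · by_cases hd : z * z' = 1 <;> simp only [h1, h2, hd, if_true, if_false] at hB' ⊢ <;>
          linear_combination -hB'

end Decomposition

end FinU2

end

/-! ### The decomposition theorem -/

theorem proposition7p2 {k E : Type*} [Field k] [Fintype k] [NeZero (2 : k)]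
    [Field E] [Fintype E] [Algebra k E] [Algebra.IsQuadraticExtension k E]
    (ψ : AddChar k ℂ) (hψ : ψ ≠ 1)
    (A : Set (Eˣ →* ℂˣ)) (hA : FinU2.IsRepsA k A)
    (B : Set ((FinU2.E1 k E →* ℂˣ) × (FinU2.E1 k E →* ℂˣ))) (hB : FinU2.IsRepsB B) :
    -- the constituents are irreducible
    ((∀ η : FinU2.E1 k E →* ℂˣ, (FinU2.charRep η).IsIrreducible) ∧
      (∀ η : FinU2.E1 k E →* ℂˣ, (FinU2.steinbergTwist η).IsIrreducible) ∧
      (∀ χ : Eˣ →* ℂˣ, χ ≠ FinU2.conjInv k χ → (FinU2.ps k χ).IsIrreducible) ∧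
      (∀ μ η : FinU2.E1 k E →* ℂˣ, μ ≠ 1 → (FinU2.cusp ψ hψ μ η).IsIrreducible)) ∧
    -- and the only isomorphisms between them are the evident ones
    ((∀ η η' : FinU2.E1 k E →* ℂˣ,
        FinU2.Iso (FinU2.charRep η) (FinU2.charRep η') → η' = η) ∧
      (∀ η η' : FinU2.E1 k E →* ℂˣ,
        FinU2.Iso (FinU2.steinbergTwist η) (FinU2.steinbergTwist η') → η' = η) ∧
      (∀ χ χ' : Eˣ →* ℂˣ, χ ≠ FinU2.conjInv k χ → χ' ≠ FinU2.conjInv k χ' →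
        FinU2.Iso (FinU2.ps k χ) (FinU2.ps k χ') → χ' = χ ∨ χ' = FinU2.conjInv k χ) ∧
      (∀ μ η μ' η' : FinU2.E1 k E →* ℂˣ, μ ≠ 1 → μ' ≠ 1 →
        FinU2.Iso (FinU2.cusp ψ hψ μ η) (FinU2.cusp ψ hψ μ' η') →
          (μ', η') = (μ, η) ∨ (μ', η') = (μ⁻¹, η * μ⁻¹)) ∧
      (∀ η η' : FinU2.E1 k E →* ℂˣ,
        ¬ FinU2.Iso (FinU2.charRep η) (FinU2.steinbergTwist η')) ∧
      (∀ (η : FinU2.E1 k E →* ℂˣ) (χ : Eˣ →* ℂˣ), χ ≠ FinU2.conjInv k χ →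
        ¬ FinU2.Iso (FinU2.charRep η) (FinU2.ps k χ)) ∧
      (∀ η μ η' : FinU2.E1 k E →* ℂˣ, μ ≠ 1 →
        ¬ FinU2.Iso (FinU2.charRep η) (FinU2.cusp ψ hψ μ η')) ∧
      (∀ (η : FinU2.E1 k E →* ℂˣ) (χ : Eˣ →* ℂˣ), χ ≠ FinU2.conjInv k χ →
        ¬ FinU2.Iso (FinU2.steinbergTwist η) (FinU2.ps k χ)) ∧
      (∀ η μ η' : FinU2.E1 k E →* ℂˣ, μ ≠ 1 →
        ¬ FinU2.Iso (FinU2.steinbergTwist η) (FinU2.cusp ψ hψ μ η')) ∧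
      (∀ (χ : Eˣ →* ℂˣ) (μ η : FinU2.E1 k E →* ℂˣ), χ ≠ FinU2.conjInv k χ → μ ≠ 1 →
        ¬ FinU2.Iso (FinU2.ps k χ) (FinU2.cusp ψ hψ μ η))) ∧
    -- `η₁ ⊗ ω_ψ`
    (∀ η₁ : FinU2.E1 k E →* ℂˣ,
      FinU2.Iso ((FinU2.charRep η₁).tprod (FinU2.weil ψ hψ))
        ((FinU2.steinbergTwist η₁).prod
          (Representation.directSum
            fun μ : {μ : FinU2.E1 k E →* ℂˣ // μ ≠ 1} => FinU2.cusp ψ hψ μ.1 η₁))) ∧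
    -- `I(χ₁) ⊗ ω_ψ`
    (∀ χ₁ : Eˣ →* ℂˣ, χ₁ ≠ FinU2.conjInv k χ₁ →
      FinU2.Iso ((FinU2.ps k χ₁).tprod (FinU2.weil ψ hψ))
        (((FinU2.ps k χ₁).prod (FinU2.ps k χ₁)).prod
          ((Representation.directSum
            fun χ : {χ : Eˣ →* ℂˣ // χ ∈ A ∧ χ ≠ χ₁ ∧ χ ≠ FinU2.conjInv k χ₁} =>
              FinU2.ps k χ.1).prod
          ((Representation.directSum
            fun η : FinU2.E1 k E →* ℂˣ => FinU2.steinbergTwist η).prod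
          (Representation.directSum fun p : B => FinU2.cusp ψ hψ p.1.1 p.1.2))))) ∧
    -- `St ⊗ ω_ψ`
    FinU2.Iso ((FinU2.steinberg k E).tprod (FinU2.weil ψ hψ))
      ((FinU2.charRep (1 : FinU2.E1 k E →* ℂˣ)).prod
        ((Representation.directSum fun χ : A => FinU2.ps k χ.1).prod
        ((Representation.directSum
          fun η : FinU2.E1 k E →* ℂˣ => FinU2.steinbergTwist η).prod
        (Representation.directSum
          fun p : {p : (FinU2.E1 k E →* ℂˣ) × (FinU2.E1 k E →* ℂˣ) //
            p ∈ B ∧ p.2 ≠ 1 ∧ p.2 ≠ p.1} => FinU2.cusp ψ hψ p.1.1 p.1.2)))) ∧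
    -- `ω_{ψ,μ₁,1} ⊗ ω_ψ`
    (∀ μ₁ : FinU2.E1 k E →* ℂˣ, μ₁ ≠ 1 →
      FinU2.Iso ((FinU2.cusp ψ hψ μ₁ 1).tprod (FinU2.weil ψ hψ))
        ((FinU2.charRep (1 : FinU2.E1 k E →* ℂˣ)).prod
          ((FinU2.charRep μ₁⁻¹).prod
          ((Representation.directSum fun χ : A => FinU2.ps k χ.1).prod
          ((Representation.directSum
            fun η : {η : FinU2.E1 k E →* ℂˣ // η ≠ 1 ∧ η ≠ μ₁⁻¹} =>
              FinU2.steinbergTwist η.1).prod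
          (Representation.directSum
            fun p : {p : (FinU2.E1 k E →* ℂˣ) × (FinU2.E1 k E →* ℂˣ) //
              p ∈ B ∧ p.2 ≠ 1 ∧ p.2 ≠ p.1 ∧ p.2 ≠ μ₁⁻¹ ∧ p.2 ≠ μ₁⁻¹ * p.1} =>
              FinU2.cusp ψ hψ p.1.1 p.1.2)))))) := by
  have hq := FinU2.three_le_card k
  refine ⟨⟨FinU2.isIrreducible_charRep, FinU2.isIrreducible_steinbergTwist,
      fun χ hχ => FinU2.isIrreducible_ps hχ, fun μ η hμ => FinU2.isIrreducible_cusp hψ hμ η⟩,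
    ⟨fun η η' h => FinU2.eq_of_iso_charRep h, fun η η' h => FinU2.eq_of_iso_steinbergTwist h,
      fun χ χ' _ _ h => FinU2.eq_or_eq_of_iso_ps h,
      fun μ η μ' η' hμ hμ' h => FinU2.eq_or_eq_of_iso_cusp hψ hμ hμ' h,
      fun η η' h => ?_, fun η χ _ h => ?_, fun η μ η' hμ h => ?_, fun η χ _ h => ?_,
      fun η μ η' hμ h => ?_, fun χ μ η _ hμ h => ?_⟩,
    fun η₁ => ?_,
    fun χ₁ h₁ => ?_,
    ?_,
    fun μ₁ hμ₁ => ?_⟩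
  -- The six exclusions between families compare the dimensions 1, q, q + 1 and q - 1.
  · have := FinU2.iso_finrank_eq h
    rw [Module.finrank_self, FinU2.finrank_steinberg] at this
    omega
  · have := FinU2.iso_finrank_eq h
    rw [Module.finrank_self, FinU2.finrank_ps] at this
    omega
  · have := FinU2.iso_finrank_eq h
    have h' := FinU2.finrank_cusp (E := E) hψ hμ
    rw [Module.finrank_self] at this
    omega
  · have := FinU2.iso_finrank_eq h
    rw [FinU2.finrank_steinberg, FinU2.finrank_ps] at this
    omega
  · have := FinU2.iso_finrank_eq h
    have h' := FinU2.finrank_cusp (E := E) hψ hμ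
    rw [FinU2.finrank_steinberg] at this
    omega
  · have := FinU2.iso_finrank_eq h
    have h' := FinU2.finrank_cusp (E := E) hψ hμ
    rw [FinU2.finrank_ps] at this
    omega
  · classical
    exact (((FinU2.hasCharacter_character _).tprod (FinU2.hasCharacter_character _)).iso
      ((FinU2.hasCharacter_character _).prod (.directSum fun _ => FinU2.hasCharacter_character _))
      (FinU2.char_charRep_tensor_weil hψ η₁))
  · classical
    -- The sum over all of B is the case of the trivial condition on pairs.
    have hB' : ∀ g, ∑ p : B, (FinU2.cusp ψ hψ p.1.1 p.1.2).character g =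
        ∑ p : {p // p ∈ B ∧ True}, (FinU2.cusp ψ hψ p.1.1 p.1.2).character g := fun g =>
      Fintype.sum_equiv (Equiv.subtypeEquivRight (by simp)) _ _ fun _ => rfl
    refine ((FinU2.hasCharacter_character _).tprod (FinU2.hasCharacter_character _)).iso
      (((FinU2.hasCharacter_character _).prod (FinU2.hasCharacter_character _)).prod
        (.prod (.directSum fun _ => FinU2.hasCharacter_character _)
        (.prod (.directSum fun _ => FinU2.hasCharacter_character _)
        (.directSum fun _ => FinU2.hasCharacter_character _)))) fun g => ?_
    refine (FinU2.char_ps_tensor_weil hψ hA hB h₁ g).trans ?_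
    rw [← hB']
    rfl
  · classical
    exact ((FinU2.hasCharacter_character _).tprod (FinU2.hasCharacter_character _)).iso
      ((FinU2.hasCharacter_character _).prod (.prod (.directSum fun _ => FinU2.hasCharacter_character _)
        (.prod (.directSum fun _ => FinU2.hasCharacter_character _)
        (.directSum fun _ => FinU2.hasCharacter_character _))))
      (FinU2.char_steinberg_tensor_weil hψ hA hB)
  · classical
    exact ((FinU2.hasCharacter_character _).tprod (FinU2.hasCharacter_character _)).iso
      ((FinU2.hasCharacter_character _).prod ((FinU2.hasCharacter_character _).prod
        (.prod (.directSum fun _ => FinU2.hasCharacter_character _)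
        (.prod (.directSum fun _ => FinU2.hasCharacter_character _)
        (.directSum fun _ => FinU2.hasCharacter_character _)))))
      (FinU2.char_cusp_tensor_weil hψ hA hB hμ₁)
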